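/- **Proposition.** Let $\theta>0$ and $n\ge 2$. Let $\mathfrak{a},\mathfrak{a}^\dagger$ be the annihilation and creation operators on $\ell^2(\mathbb{N})$, $\mathfrak{a}|k\rangle=\sqrt{k}\,|k-1\rangle$ and $\mathfrak{a}^\dagger|k\rangle=\sqrt{k+1}\,|k+1\rangle$, let $\mathcal{K}$ be the $C^*$-algebra of compact operators on $\ell^2(\mathbb{N})$, let $\mathcal{S}(\mathbb{N})\subset\ell^2(\mathbb{N})$ be the space of rapid decay sequences and $\mathcal{S}(\mathbb{N}^2)\subset\mathcal{K}$ the dense $*$-algebra of rapid decay matrices, and let $X_n\in M_n(\mathbb{C})$ have entries $\sqrt1,\dots,\sqrt{n-1}$ just below the diagonal and $0$ elsewhere. Put $$T_n=\big(M_n(\mathbb{C}),\ \mathbb{C}^n\otimes\mathbb{C}^2,\ D_n\big),\qquad D_n=\sqrt{\tfrac2\theta}\begin{pmatrix}0&X_n^*\\ X_n&0\end{pmatrix},$$ $$T_S=\big(\mathcal{S}(\mathbb{N}^2),\ \ell^2(\mathbb{N})\otimes\mathbb{C}^2,\ D\big),\qquad D=\sqrt{\tfrac2\theta}\begin{pmatrix}0&\mathfrak{a}\\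 \mathfrak{a}^\dagger&0\end{pmatrix}$$ (the truncation, and the Schrödinger spectral triple of the Moyal plane). These are spectral triples. *Terminology.* For a spectral triple $T=(\mathcal{A},H,D)$ let $A$ be the $C^*$-completion of $\mathcal{A}$ and $\Omega^1_D$ the span of the operators $a[D,b]$, $a,b\in\mathcal{A}$. A *correspondence* $T\to T'=(\mathcal{A}',H',D')$ is a triple $(E,\nabla,U)$ in which $E$ is a Morita equivalence $A'$-$A$ bimodule; $\nabla:E_1\to E_1\otimes_{\mathcal{A}}\Omega^1_D$ is a connection, $\nabla(\eta a)=(\nabla\eta)a+\eta\otimes[D,a]$, defined on a dense $\mathcal{A}'$-$\mathcal{A}$ sub-bimodule $E_1\subset E$; and $U$ is a unitary from the completed tensor product $E\otimes_A H$ onto $H'$ that intertwines the left actions of $A'$ and for which $D'$ is the closure of $U(1\otimes_\nabla D)U^*$, where $(1\otimes_\nabla D)(\eta\otimes\psi)=\eta\otimes D\psi+(\nabla\eta)\psi$. The *composition* of $(E,\nabla,U):T\to T'$ with $(E',\nabla',U'):T'\to T''$ is $(E'',\nabla'',U'')$, where $E''=E'\otimes_{A'}E$ (completed), $U''=U'(\mathrm{id}\otimes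 U)$ and, on the image of $E'_1\otimes E_1$, $$\nabla''(\eta'\otimes\eta)=(\mathrm{id}\otimes\sigma)(\nabla'\eta'\otimes\eta)+\eta'\otimes\nabla\eta,\qquad \sigma\big(a[D',b]\otimes\eta\big)=a\nabla(b\eta)-ab\nabla\eta .$$ Correspondences $(E,\nabla,U)$ and $(\tilde E,\tilde\nabla,\tilde U)$ with the same source and target are *similar* if there is a unitary right $A$-linear map $V:E\to\tilde E$ with $\tilde U(V\otimes\mathrm{id}_H)=U$. The *identity correspondence* of $T$ is $(A,\nabla_D,m)$, where $m$ is the multiplication $A\otimes_A H\to H$ and $\nabla_D a=[D,a]$ for $a\in\mathcal{A}$, under the identification $\mathcal{A}\otimes_{\mathcal{A}}\Omega^1_D\cong\Omega^1_D$ given by multiplication. Spectral triples are *isomorphic in the Morita category* if there are correspondences between them, in both directions, whose two compositions are identities up to similarity. *The two correspondences.* 1. $E=\ell^2(\mathbb{N})\otimes\overline{\mathbb{C}^n}$, $E_1=\mathcal{S}(\mathbb{N})\otimes\overline{\mathbb{C}^n}$, $U$ is the multiplication map induced by $\overline{\mathbb{C}^n}\otimes_{M_n(\mathbb{C})}\mathbb{C}^n\cong\mathbb{C}$,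 and, when $E_1\otimes_{M_n(\mathbb{C})}\Omega^1_{D_n}$ is identified with the off-diagonal $2\times2$ matrices over $E_1$, $$\nabla\eta=\sqrt{\tfrac2\theta}\begin{pmatrix}0&\mathfrak{a}\eta-\eta X_n^*\\ \mathfrak{a}^\dagger\eta-\eta X_n&0\end{pmatrix}.$$ 2. $\overline E=\mathbb{C}^n\otimes\overline{\ell^2(\mathbb{N})}$, $\overline E_1=\mathbb{C}^n\otimes\overline{\mathcal{S}(\mathbb{N})}$, $\overline U$ is the multiplication map induced by $\overline{\ell^2(\mathbb{N})}\otimes_{\mathcal{K}}\ell^2(\mathbb{N})\cong\mathbb{C}$, and, with the analogous identification, $$\overline\nabla\xi=\sqrt{\tfrac2\theta}\begin{pmatrix}0&X_n^*\xi-\xi\mathfrak{a}\\ X_n\xi-\xi\mathfrak{a}^\dagger&0\end{pmatrix}.$$ *Conclusion.* $(E,\nabla,U)$ is a correspondence $T_n\to T_S$ and $(\overline E,\overline\nabla,\overline U)$ is a correspondence $T_S\to T_n$; here the displayed formulas determine the connections uniquely. They are mutually inverse up to similarity: the composition $T_n\to T_S\to T_n$ exists and is similar to the identity correspondence $(M_n(\mathbb{C}),\nabla_{D_n},m)$,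 and the composition $T_S\to T_n\to T_S$ exists and is similar to the identity correspondence $(\mathcal{K},\nabla_D,m)$. In both cases the similarity $V$ also intertwines the connections: it maps the domain of $\nabla''$ into that of the connection of the identity correspondence, and $(V\otimes\mathrm{id})\nabla''=\nabla_{D_n}V$, respectively $(V\otimes\mathrm{id})\nabla''=\nabla_D V$, on it. Hence the Schrödinger spectral triple of the Moyal plane is isomorphic in the Morita category to each truncation $T_n$ with $n\ge2$. -/

import Mathlib

open scoped TensorProduct InnerProductSpace Matrix.Norms.L2Operator

noncomputable section

namespace MoritaCat

/-! ## Balanced tensor products -/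

section Balanced

variable {M N A : Type} [AddCommGroup M] [Module ℂ M] [AddCommGroup N] [Module ℂ N]

/-- The subspace of `M ⊗ N` spanned by the elements `m·a ⊗ n - m ⊗ a·n`. The right action on `M` and
the left action on `N` are given by their graphs: `r m a m'` says `m' = m·a` and `l a n n'` says
`n' = a·n`. -/
def balancedRel (r : M → A → M → Prop) (l : A → N → N → Prop) : Submodule ℂ (M ⊗[ℂ] N) :=
  Submodule.span ℂ {t | ∃ m a m' n n', r m a m' ∧ l a n n' ∧ t = m' ⊗ₜ[ℂ] n - m ⊗ₜ[ℂ] n'}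

/-- The algebraic tensor product `M ⊗_A N`. -/
abbrev BalancedTensor (r : M → A → M → Prop) (l : A → N → N → Prop) : Type :=
  (M ⊗[ℂ] N) ⧸ balancedRel r l

/-- The class of `m ⊗ n` in `M ⊗_A N`. -/
def btmul (r : M → A → M → Prop) (l : A → N → N → Prop) (m : M) (n : N) : BalancedTensor r l :=
  Submodule.Quotient.mk (m ⊗ₜ[ℂ] n)

/-- A bilinear map on `M × N` that is balanced over `A` descends to `M ⊗_A N`. -/
def btLift {P : Type} [AddCommGroup P] [Module ℂ P] (r : M → A → M → Prop) (l : A → N → N → Prop)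
    (f : M →ₗ[ℂ] N →ₗ[ℂ] P)
    (hf : ∀ m a m' n n', r m a m' → l a n n' → f m' n = f m n') :
    BalancedTensor r l →ₗ[ℂ] P :=
  Submodule.liftQ _ (TensorProduct.lift f) (by
    rw [balancedRel, Submodule.span_le]
    rintro t ⟨m, a, m', n, n', h₁, h₂, rfl⟩
    simp [hf m a m' n n' h₁ h₂])

/-- Functoriality of the balanced tensor product. -/
def btMap {M₂ N₂ A₂ : Type} [AddCommGroup M₂] [Module ℂ M₂] [AddCommGroup N₂] [Module ℂ N₂]
    (r : M → A → M → Prop) (l : A → N → N → Prop)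
    (r₂ : M₂ → A₂ → M₂ → Prop) (l₂ : A₂ → N₂ → N₂ → Prop)
    (f : M →ₗ[ℂ] M₂) (g : N →ₗ[ℂ] N₂)
    (h : ∀ m a m' n n', r m a m' → l a n n' →
      ∃ a₂, r₂ (f m) a₂ (f m') ∧ l₂ a₂ (g n) (g n')) :
    BalancedTensor r l →ₗ[ℂ] BalancedTensor r₂ l₂ :=
  Submodule.mapQ _ _ (TensorProduct.map f g) (by
    rw [balancedRel, Submodule.span_le]
    rintro t ⟨m, a, m', n, n', h₁, h₂, rfl⟩
    obtain ⟨a₂, h₃, h₄⟩ := h m a m' n n' h₁ h₂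
    exact Submodule.subset_span ⟨f m, a₂, f m', g n, g n', h₃, h₄, by simp⟩)

end Balanced

/-! ## Spectral triples -/

/-- The data of a spectral triple: the involutive algebra `smooth`, given inside its `C*`-completion
`A`, a representation of `A` on the Hilbert space `H`, and an operator `D` on `H`. -/
structure TripleData where
  A : Type
  [cstar : NonUnitalCStarAlgebra A]
  smooth : NonUnitalStarSubalgebra ℂ A
  H : Type
  [normed : NormedAddCommGroup H]
  [innerSpace : InnerProductSpace ℂ H]
  [complete : CompleteSpace H]
  rep : A →⋆ₙₐ[ℂ] (H →L[ℂ] H)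
  D : H →ₗ.[ℂ] H

attribute [instance] TripleData.cstar TripleData.normed TripleData.innerSpace TripleData.complete

/-- `a` preserves the domain of `D` and the bounded operator `K` is the commutator `[D, a]`. -/
def IsCommutator {H : Type} [NormedAddCommGroup H] [InnerProductSpace ℂ H]
    (D : H →ₗ.[ℂ] H) (a K : H →L[ℂ] H) : Prop :=
  ∀ ψ : D.domain, ∃ h : a ψ ∈ D.domain, K ψ = D ⟨a ψ, h⟩ - a (D ψ)

/-- `R = (1 + D²)^{-1/2}`: the positive bounded operator whose square is inverse to `1 + D²`. -/
def IsInvSqrt {H : Type} [NormedAddCommGroup H] [InnerProductSpace ℂ H]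
    (D : H →ₗ.[ℂ] H) (R : H →L[ℂ] H) : Prop :=
  R.IsPositive ∧
  ∀ ψ : H, ∃ (h₁ : R (R ψ) ∈ D.domain) (h₂ : D ⟨R (R ψ), h₁⟩ ∈ D.domain),
    R (R ψ) + D ⟨D ⟨R (R ψ), h₁⟩, h₂⟩ = ψ

/-- The axioms of a spectral triple, the representation being faithful and non-degenerate. -/
structure IsSpectralTriple (T : TripleData) : Prop where
  separable : TopologicalSpace.SeparableSpace T.H
  smooth_dense : Dense (T.smooth : Set T.A)
  faithful : Function.Injective T.rep
  nondegenerate :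
    (Submodule.span ℂ {ψ : T.H | ∃ a φ, ψ = T.rep a φ}).topologicalClosure = ⊤
  selfAdjoint : IsSelfAdjoint T.D
  bounded_commutator : ∀ a ∈ T.smooth, ∃ K, IsCommutator T.D (T.rep a) K
  compact_resolvent : ∃ R, IsInvSqrt T.D R ∧
    ∀ a ∈ T.smooth, IsCompactOperator (T.rep a ∘L R)

/-- The space `Ω¹_D(𝒜)` of one-forms, spanned by the operators `a [D, b]` with `a, b ∈ 𝒜`. -/
def TripleData.oneForms (T : TripleData) : Submodule ℂ (T.H →L[ℂ] T.H) :=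
  Submodule.span ℂ {ω | ∃ a ∈ T.smooth, ∃ b ∈ T.smooth, ∃ K,
    IsCommutator T.D (T.rep b) K ∧ ω = T.rep a ∘L K}

/-! ## Morita equivalence bimodules -/

/-- The data of a `B`-`A` Hilbert bimodule. -/
structure BimoduleData (B A : Type) [NonUnitalCStarAlgebra B] [NonUnitalCStarAlgebra A] where
  E : Type
  [addCommGroup : AddCommGroup E]
  [module : Module ℂ E]
  ract : E →ₗ[ℂ] A →ₗ[ℂ] E
  lact : B →ₗ[ℂ] E →ₗ[ℂ] E
  rinner : E → E → A
  linner : E → E → B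

attribute [instance] BimoduleData.addCommGroup BimoduleData.module

/-- Positivity in a `C*`-algebra. -/
def IsPos {A : Type} [NonUnitalCStarAlgebra A] (x : A) : Prop := ∃ c, x = star c * c

namespace BimoduleData

variable {B A : Type} [NonUnitalCStarAlgebra B] [NonUnitalCStarAlgebra A]

/-- The Hilbert module norm `‖(η, η)_A‖^{1/2}`. -/
def rnorm (X : BimoduleData B A) (η : X.E) : ℝ := √‖X.rinner η η‖

/-- The Hilbert module norm `‖(η, η)_B‖^{1/2}`. -/
def lnorm (X : BimoduleData B A) (η : X.E) : ℝ := √‖X.linner η η‖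

/-- `X` is a Morita equivalence bimodule between `A` and `B`: a full Hilbert bimodule that satisfies
the two boundedness inequalities. -/
structure IsMorita (X : BimoduleData B A) : Prop where
  ract_mul : ∀ η a b, X.ract η (a * b) = X.ract (X.ract η a) b
  lact_mul : ∀ a b η, X.lact (a * b) η = X.lact a (X.lact b η)
  lact_ract : ∀ b η a, X.lact b (X.ract η a) = X.ract (X.lact b η) a
  rinner_add : ∀ η ξ ζ, X.rinner η (ξ + ζ) = X.rinner η ξ + X.rinner η ζ
  rinner_smul : ∀ η (c : ℂ) ξ, X.rinner η (c • ξ) = c • X.rinner η ξ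
  rinner_star : ∀ η ξ, star (X.rinner η ξ) = X.rinner ξ η
  rinner_ract : ∀ η a ξ b, X.rinner (X.ract η a) (X.ract ξ b) = star a * X.rinner η ξ * b
  rinner_pos : ∀ η, IsPos (X.rinner η η)
  rinner_definite : ∀ η, X.rinner η η = 0 → η = 0
  linner_add : ∀ η ξ ζ, X.linner (η + ξ) ζ = X.linner η ζ + X.linner ξ ζ
  linner_smul : ∀ (c : ℂ) η ξ, X.linner (c • η) ξ = c • X.linner η ξ
  linner_star : ∀ η ξ, star (X.linner η ξ) = X.linner ξ η
  linner_lact : ∀ a η b ξ, X.linner (X.lact a η) (X.lact b ξ) = a * X.linner η ξ * star b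
  linner_pos : ∀ η, IsPos (X.linner η η)
  linner_definite : ∀ η, X.linner η η = 0 → η = 0
  rcomplete : ∀ u : ℕ → X.E, (∀ ε > 0, ∃ N, ∀ p ≥ N, ∀ q ≥ N, X.rnorm (u p - u q) < ε) →
    ∃ x, ∀ ε > 0, ∃ N, ∀ p ≥ N, X.rnorm (u p - x) < ε
  lcomplete : ∀ u : ℕ → X.E, (∀ ε > 0, ∃ N, ∀ p ≥ N, ∀ q ≥ N, X.lnorm (u p - u q) < ε) →
    ∃ x, ∀ ε > 0, ∃ N, ∀ p ≥ N, X.lnorm (u p - x) < ε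
  compatible : ∀ η ξ ζ, X.ract η (X.rinner ξ ζ) = X.lact (X.linner η ξ) ζ
  rfull : (Submodule.span ℂ {x | ∃ η ξ, x = X.rinner η ξ}).topologicalClosure = ⊤
  lfull : (Submodule.span ℂ {x | ∃ η ξ, x = X.linner η ξ}).topologicalClosure = ⊤
  linner_ract_le : ∀ η a, IsPos
    (((‖a‖ ^ 2 : ℝ) : ℂ) • X.linner η η - X.linner (X.ract η a) (X.ract η a))
  rinner_lact_le : ∀ b η, IsPos
    (((‖b‖ ^ 2 : ℝ) : ℂ) • X.rinner η η - X.rinner (X.lact b η) (X.lact b η))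

/-- The algebraic tensor product `X' ⊗_B X` of a `C`-`B` bimodule and a `B`-`A` bimodule. -/
abbrev Tensor {C : Type} [NonUnitalCStarAlgebra C]
    (X' : BimoduleData C B) (X : BimoduleData B A) : Type :=
  BalancedTensor (fun (η : X'.E) (b : B) η' => η' = X'.ract η b)
    (fun (b : B) (ξ : X.E) ξ' => ξ' = X.lact b ξ)

/-- The element `η ⊗ ξ` of `X' ⊗_B X`. -/
def tmul {C : Type} [NonUnitalCStarAlgebra C] (X' : BimoduleData C B) (X : BimoduleData B A)
    (η : X'.E) (ξ : X.E) : Tensor X' X :=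
  btmul _ _ η ξ

/-- `j : X' ⊗_B X → Y` exhibits `Y` as the completed tensor product of Hilbert bimodules: `j` is a
bimodule map, preserves both inner products (given on `X' ⊗_B X` by the usual formulas) and has
dense range. When `Y` is complete, this determines `Y` up to a unique unitary. -/
structure IsCompletedTensor {C : Type} [NonUnitalCStarAlgebra C]
    (X' : BimoduleData C B) (X : BimoduleData B A) (Y : BimoduleData C A)
    (j : Tensor X' X →ₗ[ℂ] Y.E) : Prop where
  map_lact : ∀ c η ξ, j (tmul X' X (X'.lact c η) ξ) = Y.lact c (j (tmul X' X η ξ))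
  map_ract : ∀ η ξ a, j (tmul X' X η (X.ract ξ a)) = Y.ract (j (tmul X' X η ξ)) a
  rinner : ∀ η₁ ξ₁ η₂ ξ₂, Y.rinner (j (tmul X' X η₁ ξ₁)) (j (tmul X' X η₂ ξ₂)) =
    X.rinner ξ₁ (X.lact (X'.rinner η₁ η₂) ξ₂)
  linner : ∀ η₁ ξ₁ η₂ ξ₂, Y.linner (j (tmul X' X η₁ ξ₁)) (j (tmul X' X η₂ ξ₂)) =
    X'.linner (X'.ract η₁ (X.linner ξ₁ ξ₂)) η₂
  dense : ∀ y, ∀ ε > 0, ∃ t, Y.rnorm (y - j t) < ε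

/-- The algebraic tensor product `X ⊗_A H`. -/
abbrev HTensor (T : TripleData) (X : BimoduleData B T.A) : Type :=
  BalancedTensor (fun (η : X.E) (a : T.A) η' => η' = X.ract η a)
    (fun (a : T.A) (ψ : T.H) ψ' => ψ' = T.rep a ψ)

/-- The element `η ⊗ ψ` of `X ⊗_A H`. -/
def hmul (T : TripleData) (X : BimoduleData B T.A) (η : X.E) (ψ : T.H) : HTensor T X :=
  btmul _ _ η ψ

/-- The tensor product `X₁ ⊗_𝒜 Ω¹_D(𝒜)`, where `X₁` is a subspace of `X`. -/
abbrev FormTensor (T : TripleData) (X : BimoduleData B T.A) (X₁ : Submodule ℂ X.E) : Type :=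
  BalancedTensor (fun (η : X₁) (a : T.smooth) (η' : X₁) => (η' : X.E) = X.ract η a)
    (fun (a : T.smooth) (ω : T.oneForms) (ω' : T.oneForms) =>
      (ω' : T.H →L[ℂ] T.H) = T.rep a ∘L (ω : T.H →L[ℂ] T.H))

/-- The element `η ⊗ ω` of `X₁ ⊗_𝒜 Ω¹_D(𝒜)`. -/
def fmul (T : TripleData) (X : BimoduleData B T.A) (X₁ : Submodule ℂ X.E) (η : X₁)
    (ω : T.oneForms) : FormTensor T X X₁ :=
  btmul _ _ η ω

/-- The action `t ↦ tψ` of `X₁ ⊗_𝒜 Ω¹_D(𝒜)` on a vector `ψ`: `(η ⊗ ω)ψ = η ⊗ ωψ`. -/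
def formApply (T : TripleData) (X : BimoduleData B T.A) (X₁ : Submodule ℂ X.E) (ψ : T.H) :
    FormTensor T X X₁ →ₗ[ℂ] HTensor T X :=
  btMap _ _ _ _ X₁.subtype
    ((ContinuousLinearMap.apply ℂ T.H ψ).toLinearMap ∘ₗ T.oneForms.subtype)
    (by
      intro m a m' n n' h₁ h₂
      exact ⟨a, h₁, by simp [h₂]⟩)

/-- The map `id ⊗ ρ` for a map `ρ` of one-forms given by right multiplication by some `a`. -/
def formRight (T : TripleData) (X : BimoduleData B T.A) (X₁ : Submodule ℂ X.E) (a : T.A)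
    (ρ : T.oneForms →ₗ[ℂ] T.oneForms)
    (hρ : ∀ ω, (ρ ω : T.H →L[ℂ] T.H) = (ω : T.H →L[ℂ] T.H) ∘L T.rep a) :
    FormTensor T X X₁ →ₗ[ℂ] FormTensor T X X₁ :=
  btMap _ _ _ _ LinearMap.id ρ
    (by
      intro m b m' n n' h₁ h₂
      exact ⟨b, h₁, by simp [hρ, h₂, ContinuousLinearMap.comp_assoc]⟩)

/-- `f : X₁ → Y₁` is right `𝒜`-linear. -/
def IsRightLinear {C : Type} [NonUnitalCStarAlgebra C] (T : TripleData)
    (X : BimoduleData B T.A) (Y : BimoduleData C T.A) {X₁ : Submodule ℂ X.E}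
    {Y₁ : Submodule ℂ Y.E} (f : X₁ →ₗ[ℂ] Y₁) : Prop :=
  ∀ a ∈ T.smooth, ∀ η η' : X₁, (η' : X.E) = X.ract η a → (f η' : Y.E) = Y.ract (f η) a

/-- The map `f ⊗ id : X₁ ⊗_𝒜 Ω¹ → Y₁ ⊗_𝒜 Ω¹` for a right `𝒜`-linear `f`. -/
def formMap {C : Type} [NonUnitalCStarAlgebra C] (T : TripleData)
    (X : BimoduleData B T.A) (Y : BimoduleData C T.A) {X₁ : Submodule ℂ X.E}
    {Y₁ : Submodule ℂ Y.E} (f : X₁ →ₗ[ℂ] Y₁) (hf : IsRightLinear T X Y f) :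
    FormTensor T X X₁ →ₗ[ℂ] FormTensor T Y Y₁ :=
  btMap _ _ _ _ f LinearMap.id
    (by
      intro m a m' n n' h₁ h₂
      exact ⟨a, hf a a.2 m m' h₁, h₂⟩)

end BimoduleData

/-! ## Correspondences -/

open BimoduleData

/-- The data `(E, ∇, U)` of a correspondence from `T` to `T'`; the connection `∇` is defined on the
subspace `dom` of the bimodule. -/
structure CorrData (T T' : TripleData) where
  X : BimoduleData T'.A T.A
  dom : Submodule ℂ X.E
  conn : dom → FormTensor T X dom
  U : HTensor T X →ₗ[ℂ] T'.H

/-- `(E, ∇, U)` is a correspondence: `E` is a Morita equivalence bimodule between the completed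
algebras, `∇` is a densely defined connection, and `U` is a unitary equivalence between the
fluctuation of `T` by `(E, ∇)` and `T'`. -/
structure IsCorrespondence {T T' : TripleData} (C : CorrData T T') : Prop where
  morita : C.X.IsMorita
  dom_dense : ∀ η, ∀ ε > 0, ∃ ξ ∈ C.dom, C.X.rnorm (η - ξ) < ε
  dom_ract : ∀ η ∈ C.dom, ∀ a ∈ T.smooth, C.X.ract η a ∈ C.dom
  dom_lact : ∀ b ∈ T'.smooth, ∀ η ∈ C.dom, C.X.lact b η ∈ C.dom
  conn_add : ∀ η ξ, C.conn (η + ξ) = C.conn η + C.conn ξ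
  conn_smul : ∀ (c : ℂ) η, C.conn (c • η) = c • C.conn η
  /-- The Leibniz rule `∇(ηa) = (∇η)a + η ⊗ [D, a]`. -/
  leibniz : ∀ a ∈ T.smooth,
    ∃ (ρ : T.oneForms →ₗ[ℂ] T.oneForms)
      (hρ : ∀ ω, (ρ ω : T.H →L[ℂ] T.H) = (ω : T.H →L[ℂ] T.H) ∘L T.rep a) (δ : T.oneForms),
      IsCommutator T.D (T.rep a) δ ∧
      ∀ η η' : C.dom, (η' : C.X.E) = C.X.ract η a →
        C.conn η' = formRight T C.X C.dom a ρ hρ (C.conn η) + fmul T C.X C.dom η δ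
  /-- `U` is isometric for `⟨η₁ ⊗ ψ₁, η₂ ⊗ ψ₂⟩ = ⟨ψ₁, (η₁, η₂)_A ψ₂⟩` and has dense range: it extends
  to a unitary from the Hilbert space completion of `E ⊗_A H`. -/
  isometric : ∀ η₁ ψ₁ η₂ ψ₂, ⟪C.U (hmul T C.X η₁ ψ₁), C.U (hmul T C.X η₂ ψ₂)⟫_ℂ =
    ⟪ψ₁, T.rep (C.X.rinner η₁ η₂) ψ₂⟫_ℂ
  denseRange : DenseRange C.U
  /-- `U` intertwines the left action on `E` with the representation of the target. -/
  U_lact : ∀ b η ψ, C.U (hmul T C.X (C.X.lact b η) ψ) = T'.rep b (C.U (hmul T C.X η ψ))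
  /-- `D' U = U (1 ⊗_∇ D)` on `E₁ ⊗ Dom D`. -/
  intertwine : ∀ (η : C.dom) (ψ : T.D.domain),
    ∃ h : C.U (hmul T C.X η ψ) ∈ T'.D.domain,
      T'.D ⟨C.U (hmul T C.X η ψ), h⟩ =
        C.U (hmul T C.X η (T.D ψ) + formApply T C.X C.dom ψ (C.conn η))
  /-- `D'` is the closure of `U (1 ⊗_∇ D) U*`. -/
  core : T'.D.HasCore
    (Submodule.span ℂ {φ | ∃ (η : C.dom) (ψ : T.D.domain), φ = C.U (hmul T C.X η ψ)})

/-- The bimodule `Ω¹_{D'}(𝒜') ⊗_𝒜' E₁`. -/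
abbrev SigmaTensor {T T' : TripleData} (C : CorrData T T') : Type :=
  BalancedTensor
    (fun (ω : T'.oneForms) (a : T'.smooth) (ω' : T'.oneForms) =>
      (ω' : T'.H →L[ℂ] T'.H) = (ω : T'.H →L[ℂ] T'.H) ∘L T'.rep a)
    (fun (a : T'.smooth) (η : C.dom) (η' : C.dom) => (η' : C.X.E) = C.X.lact a η)

/-- `σ : Ω¹_{D'}(𝒜') ⊗_𝒜' E₁ → E₁ ⊗_𝒜 Ω¹_D(𝒜)` is the map
`σ(a[D', b] ⊗ η) = a ∇(bη) - ab ∇η` for `a, b ∈ 𝒜'`; `L b` is left multiplication by `b` on `E₁`. -/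
def IsSigma {T T' : TripleData} (C : CorrData T T')
    (σ : SigmaTensor C →ₗ[ℂ] FormTensor T C.X C.dom) : Prop :=
  ∃ (L : T'.smooth → C.dom →ₗ[ℂ] C.dom) (hL : ∀ b, IsRightLinear T C.X C.X (L b)),
    (∀ b η, (L b η : C.X.E) = C.X.lact b η) ∧
    ∀ (a b : T'.smooth) (K : T'.H →L[ℂ] T'.H) (ω : T'.oneForms) (η : C.dom),
      IsCommutator T'.D (T'.rep b) K → (ω : T'.H →L[ℂ] T'.H) = T'.rep a ∘L K →
      σ (btmul _ _ ω η) = formMap T C.X C.X (L a) (hL a) (C.conn (L b η)) -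
        formMap T C.X C.X (L (a * b)) (hL (a * b)) (C.conn η)

/-- `C''` is the composition `T → T' → T''` of the correspondences `C` and `C'`:
`E'' = E' ⊗ E` (completed), `U'' = U'(id ⊗ U)`, and on the image of `E₁' ⊗ E₁` the connection is
`∇''(η' ⊗ η) = (id ⊗ σ)(∇'η' ⊗ η) + η' ⊗ ∇η`. Here `J ξ' x` is `ξ' ⊗ x`, so that `J ξ' ⊗ id` is
`t ↦ ξ' ⊗ t`, and `Λ` is the map `ξ' ⊗ ω' ↦ ξ' ⊗ σ(ω' ⊗ η)`. -/
def IsComposition {T T' T'' : TripleData} (C' : CorrData T' T'') (C : CorrData T T')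
    (C'' : CorrData T T'') : Prop :=
  ∃ j : Tensor C'.X C.X →ₗ[ℂ] C''.X.E,
    IsCompletedTensor C'.X C.X C''.X j ∧
    C''.dom = Submodule.span ℂ {y | ∃ η' ∈ C'.dom, ∃ η ∈ C.dom, y = j (tmul C'.X C.X η' η)} ∧
    (∀ η' η ψ, C''.U (hmul T C''.X (j (tmul C'.X C.X η' η)) ψ) =
      C'.U (hmul T' C'.X η' (C.U (hmul T C.X η ψ)))) ∧
    ∃ (J : C'.dom → C.dom →ₗ[ℂ] C''.dom) (hJ : ∀ ξ', IsRightLinear T C.X C''.X (J ξ'))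
      (σ : SigmaTensor C →ₗ[ℂ] FormTensor T C.X C.dom),
      (∀ ξ' x, (J ξ' x : C''.X.E) = j (tmul C'.X C.X ξ' x)) ∧ IsSigma C σ ∧
      ∀ η : C.dom,
        ∃ Λ : FormTensor T' C'.X C'.dom →ₗ[ℂ] FormTensor T C''.X C''.dom,
          (∀ ξ' ω', Λ (fmul T' C'.X C'.dom ξ' ω') =
            formMap T C.X C''.X (J ξ') (hJ ξ') (σ (btmul _ _ ω' η))) ∧
          ∀ η' : C'.dom, C''.conn (J η' η) =
            Λ (C'.conn η') + formMap T C.X C''.X (J η') (hJ η') (C.conn η)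

/-- `F` is the formula for `∇` under the identification of `E₁ ⊗_𝒜 Ω¹_D(𝒜)` with operators
`H → H'`, `t ↦ (ψ ↦ U(tψ))`: the element `∇η` is the only one that acts as `F η`. -/
def ConnIs {T T' : TripleData} (C : CorrData T T') (F : C.dom → T.H → T'.H) : Prop :=
  ∀ η t, t = C.conn η ↔ ∀ ψ, C.U (formApply T C.X C.dom ψ t) = F η ψ

/-- `V` is a similarity between `C₁` and `C₂`: a unitary right `A`-linear map with
`U₂ (V ⊗ id) = U₁`. -/
structure IsSimilarity {T T' : TripleData} (C₁ C₂ : CorrData T T')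
    (V : C₁.X.E ≃ₗ[ℂ] C₂.X.E) : Prop where
  map_ract : ∀ η a, V (C₁.X.ract η a) = C₂.X.ract (V η) a
  rinner : ∀ η ξ, C₂.X.rinner (V η) (V ξ) = C₁.X.rinner η ξ
  U_eq : ∀ η ψ, C₂.U (hmul T C₂.X (V η) ψ) = C₁.U (hmul T C₁.X η ψ)

/-- `V` maps the domain of `∇₁` into that of `∇₂`, and `(V ⊗ id) ∇₁ = ∇₂ V` there. -/
def IntertwinesConn {T T' : TripleData} (C₁ C₂ : CorrData T T')
    (V : C₁.X.E ≃ₗ[ℂ] C₂.X.E) : Prop :=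
  ∃ (f : C₁.dom →ₗ[ℂ] C₂.dom) (hf : IsRightLinear T C₁.X C₂.X f),
    (∀ η, (f η : C₂.X.E) = V η) ∧
    ∀ η, formMap T C₁.X C₂.X f hf (C₁.conn η) = C₂.conn (f η)

/-- A `C*`-algebra as a bimodule over itself, with inner products `a*b` and `ab*`. -/
def selfBimodule (A : Type) [NonUnitalCStarAlgebra A] : BimoduleData A A where
  E := A
  ract := LinearMap.mul ℂ A
  lact := LinearMap.mul ℂ A
  rinner a b := star a * b
  linner a b := a * star b

/-- The multiplication map `A ⊗_A H → H`. -/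
def multMap (T : TripleData) : HTensor T (selfBimodule T.A) →ₗ[ℂ] T.H :=
  btLift _ _ (M := T.A)
    (LinearMap.mk₂ ℂ (fun a ψ => T.rep a ψ) (by simp) (by simp) (by simp) (by simp))
    (by
      rintro m a m' n n' rfl rfl
      change T.rep (m * a) n = T.rep m (T.rep a n)
      simp)

/-- The identity correspondence `(A, ∇_D, m)`. The connection `∇_D` is defined on `𝒜`, and sends `a`
to the preimage of `[D, a]` under the multiplication map `𝒜 ⊗_𝒜 Ω¹_D(𝒜) → Ω¹_D(𝒜)`; for unital `𝒜`
this is `1 ⊗ [D, a]`. -/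
def idCorr (T : TripleData) : CorrData T T where
  X := selfBimodule T.A
  dom := T.smooth.toNonUnitalSubalgebra.toSubmodule
  conn a := Classical.epsilon fun t => ∃ K, IsCommutator T.D (T.rep a.1) K ∧
    ∀ ψ, multMap T (formApply T (selfBimodule T.A) _ ψ t) = K ψ
  U := multMap T

/-- The connection of the identity correspondence is `a ↦ [D, a]`. -/
def IdConnIsCommutator (T : TripleData) : Prop :=
  ∃ K : (idCorr T).dom → T.H →L[ℂ] T.H, (∀ a, IsCommutator T.D (T.rep a.1) (K a)) ∧
    ConnIs (idCorr T) fun a ψ => K a ψ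

/-- The composition `C' ∘ C` is the identity morphism of `T`: it exists, and every correspondence that
represents it is similar to the identity correspondence. -/
def ComposesToId {T T' : TripleData} (C' : CorrData T' T) (C : CorrData T T') : Prop :=
  (∃ C'' : CorrData T T, IsCorrespondence C'' ∧ IsComposition C' C C'') ∧
  ∀ C'' : CorrData T T, IsCorrespondence C'' → IsComposition C' C C'' →
    ∃ V, IsSimilarity C'' (idCorr T) V ∧ IntertwinesConn C'' (idCorr T) V

/-- Isomorphism of spectral triples in the Morita category. -/
def MoritaIsomorphic (T T' : TripleData) : Prop :=
  ∃ (C : CorrData T T') (C' : CorrData T' T), IsCorrespondence C ∧ IsCorrespondence C' ∧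
    ComposesToId C' C ∧ ComposesToId C C'

end MoritaCat

namespace MoritaCat

open BimoduleData

/-! ## The Hilbert spaces `H₀ ⊗ ℂ²` -/

/-- `H₀ ⊗ ℂ²`, as the Hilbert space of column vectors `(v 0, v 1)` with entries in `H₀`. -/
abbrev Spinor (H₀ : Type) [NormedAddCommGroup H₀] [InnerProductSpace ℂ H₀] : Type :=
  PiLp 2 (fun _ : Fin 2 => H₀)

section Spinor

variable {H₀ : Type} [NormedAddCommGroup H₀] [InnerProductSpace ℂ H₀]

/-- The operator `T ⊗ 1₂`. -/
def amp (T : H₀ →L[ℂ] H₀) : Spinor H₀ →L[ℂ] Spinor H₀ where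
  toFun v := WithLp.toLp 2 (fun i => T (v i))
  map_add' v w := by ext i; simp
  map_smul' c v := by ext i; simp
  cont := by fun_prop

@[simp] theorem amp_apply (T : H₀ →L[ℂ] H₀) (v : Spinor H₀) (i : Fin 2) :
    amp T v i = T (v i) := rfl

/-- The representation `T ↦ T ⊗ 1₂`. -/
def ampHom [CompleteSpace H₀] : (H₀ →L[ℂ] H₀) →⋆ₙₐ[ℂ] (Spinor H₀ →L[ℂ] Spinor H₀) where
  toFun := amp
  map_smul' c T := by ext; simp
  map_zero' := by ext; simp
  map_add' S T := by ext; simp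
  map_mul' S T := by ext; simp
  map_star' T := by
    rw [ContinuousLinearMap.star_eq_adjoint, ContinuousLinearMap.star_eq_adjoint,
      ContinuousLinearMap.eq_adjoint_iff]
    intro v w
    simp [PiLp.inner_apply, ContinuousLinearMap.adjoint_inner_left]

/-- The odd operator `c (0 P; Q 0)`, that is `(v 0, v 1) ↦ (c P (v 1), c Q (v 0))`, on the vectors
both of whose entries lie in the domains of `P` and `Q`. -/
def oddOp (c : ℂ) (P Q : H₀ →ₗ.[ℂ] H₀) : Spinor H₀ →ₗ.[ℂ] Spinor H₀ where
  domain :=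
    { carrier := {v | ∀ i, v i ∈ P.domain ∧ v i ∈ Q.domain}
      add_mem' := fun hv hw i =>
        ⟨P.domain.add_mem (hv i).1 (hw i).1, Q.domain.add_mem (hv i).2 (hw i).2⟩
      zero_mem' := fun _ => ⟨P.domain.zero_mem, Q.domain.zero_mem⟩
      smul_mem' := fun a _ hv i =>
        ⟨P.domain.smul_mem a (hv i).1, Q.domain.smul_mem a (hv i).2⟩ }
  toFun :=
    { toFun := fun v => WithLp.toLp 2
        ![c • P ⟨v.1 1, (v.2 1).1⟩, c • Q ⟨v.1 0, (v.2 0).2⟩]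
      map_add' := fun v w => by
        ext i
        fin_cases i
        · simpa [smul_add] using congrArg (c • ·)
            (P.map_add ⟨v.1 1, (v.2 1).1⟩ ⟨w.1 1, (w.2 1).1⟩)
        · simpa [smul_add] using congrArg (c • ·)
            (Q.map_add ⟨v.1 0, (v.2 0).2⟩ ⟨w.1 0, (w.2 0).2⟩)
      map_smul' := fun a v => by
        ext i
        fin_cases i
        · simpa [smul_comm c a] using congrArg (c • ·) (P.map_smul a ⟨v.1 1, (v.2 1).1⟩)
        · simpa [smul_comm c a] using congrArg (c • ·) (Q.map_smul a ⟨v.1 0, (v.2 0).2⟩) }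

/-- The map `H₀ ⊗ ℂ² → K₀ ⊗ ℂ²` given by the matrix `c (0 P; Q 0)`. -/
def oddMap {K₀ : Type} [NormedAddCommGroup K₀] [InnerProductSpace ℂ K₀] (c : ℂ)
    (P Q : H₀ →ₗ[ℂ] K₀) (v : Spinor H₀) : Spinor K₀ :=
  WithLp.toLp 2 ![c • P (v 1), c • Q (v 0)]

/-- `m ⊗ id_{ℂ²}`, for a bilinear map `m : E × H₀ → K₀`. -/
def spinorMul {K₀ E : Type} [NormedAddCommGroup K₀] [InnerProductSpace ℂ K₀] [AddCommGroup E]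
    [Module ℂ E] (m : E →ₗ[ℂ] H₀ →ₗ[ℂ] K₀) : E →ₗ[ℂ] Spinor H₀ →ₗ[ℂ] Spinor K₀ :=
  LinearMap.mk₂ ℂ (fun η v => WithLp.toLp 2 (fun i => m η (v i)))
    (by intros; ext i; simp) (by intros; ext i; simp)
    (by intros; ext i; simp) (by intros; ext i; simp)

end Spinor

/-! ## The truncations -/

/-- The matrix `X_n`, with entries `√1, …, √(n-1)` just below the diagonal. -/
def Xmat (n : ℕ) : Matrix (Fin n) (Fin n) ℂ :=
  Matrix.of fun i j => if (i : ℕ) = j + 1 then ((√(i : ℕ) : ℝ) : ℂ) else 0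

/-- The factor `√(2/θ)`. -/
def scale (θ : ℝ) : ℂ := ((√(2 / θ) : ℝ) : ℂ)

/-- A matrix as an everywhere defined operator on `ℂⁿ`. -/
def matOp {n : ℕ} (M : Matrix (Fin n) (Fin n) ℂ) :
    EuclideanSpace ℂ (Fin n) →ₗ.[ℂ] EuclideanSpace ℂ (Fin n) :=
  (Matrix.toEuclideanLin M).toPMap ⊤

/-- The truncation `(M_n(ℂ), ℂⁿ ⊗ ℂ², D_n)`. -/
def truncation (n : ℕ) (θ : ℝ) : TripleData where
  A := Matrix (Fin n) (Fin n) ℂ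
  smooth := ⊤
  H := Spinor (EuclideanSpace ℂ (Fin n))
  rep := ampHom.comp
    ((Matrix.toEuclideanCLM (n := Fin n) (𝕜 := ℂ) :
      Matrix (Fin n) (Fin n) ℂ →⋆ₙₐ[ℂ] _))
  D := oddOp (scale θ) (matOp (Xmat n).conjTranspose) (matOp (Xmat n))

/-! ## The Schrödinger spectral triple -/

/-- The Hilbert space `ℓ²(ℕ)`. -/
abbrev L2 : Type := lp (fun _ : ℕ => ℂ) 2

theorem isCompactOperator_adjoint {T : L2 →L[ℂ] L2} (hT : IsCompactOperator T) :
    IsCompactOperator (ContinuousLinearMap.adjoint T) := by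
  set S := ContinuousLinearMap.adjoint T with hS
  have hTS : IsCompactOperator (T ∘L S) := hT.comp_clm S
  refine (isCompactOperator_iff_isCompact_closure_image_ball (S : L2 →ₗ[ℂ] L2) one_pos).2 ?_
  have h₁ := IsCompactOperator.isCompact_closure_image_ball
    (f := ((T ∘L S : L2 →L[ℂ] L2) : L2 →ₗ[ℂ] L2)) hTS 1
  have h₂ : TotallyBounded ((T ∘L S) '' Metric.ball 0 1) :=
    h₁.totallyBounded.subset subset_closure
  suffices TotallyBounded (S '' Metric.ball 0 1) from
    isCompact_iff_totallyBounded_isComplete.2 ⟨this.closure, isClosed_closure.isComplete⟩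
  refine Metric.totallyBounded_iff.2 fun ε hε => ?_
  obtain ⟨t, hts, htf, ht⟩ := Metric.finite_approx_of_totallyBounded h₂ (ε ^ 2 / 4) (by positivity)
  have hex : ∀ y : L2, ∃ x : L2, y ∈ t → x ∈ Metric.ball (0 : L2) 1 ∧ (T ∘L S) x = y := by
    intro y
    by_cases hy : y ∈ t
    · obtain ⟨x, hx⟩ := hts hy
      exact ⟨x, fun _ => hx⟩
    · exact ⟨0, fun h => absurd h hy⟩
  choose g hg using hex
  refine ⟨(fun y => S (g y)) '' t, htf.image _, ?_⟩
  rintro _ ⟨x, hx, rfl⟩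
  obtain ⟨y, hy, hxy⟩ := Set.mem_iUnion₂.1 (ht ⟨x, hx, rfl⟩)
  refine Set.mem_iUnion₂.2 ⟨S (g y), ⟨y, hy, rfl⟩, ?_⟩
  obtain ⟨hgy, hgy'⟩ := hg y hy
  have h3 : ‖T (S (x - g y))‖ < ε ^ 2 / 4 := by
    have : dist ((T ∘L S) x) y < ε ^ 2 / 4 := hxy
    rw [← hgy', dist_eq_norm, ← map_sub] at this
    exact this
  have h4 : ‖x - g y‖ ≤ 2 := by
    have hx1 : ‖x‖ < 1 := by simpa using hx
    have hg1 : ‖g y‖ < 1 := by simpa using hgy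
    linarith [norm_sub_le x (g y)]
  have h5 : ‖S (x - g y)‖ ^ 2 ≤ ‖T (S (x - g y))‖ * ‖x - g y‖ := by
    have h := norm_inner_le_norm (𝕜 := ℂ) (T (S (x - g y))) (x - g y)
    rw [← ContinuousLinearMap.adjoint_inner_right, inner_self_eq_norm_sq_to_K] at h
    simpa using h
  rw [Metric.mem_ball, dist_eq_norm, ← map_sub]
  have h6 : ‖S (x - g y)‖ ^ 2 < ε ^ 2 := by nlinarith [norm_nonneg (x - g y)]
  exact lt_of_pow_lt_pow_left₀ 2 hε.le h6

/-- The `C*`-algebra `𝒦` of compact operators on `ℓ²(ℕ)`. -/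
def compacts : NonUnitalStarSubalgebra ℂ (L2 →L[ℂ] L2) where
  carrier := {T | IsCompactOperator T}
  add_mem' hS hT := hS.add hT
  zero_mem' := isCompactOperator_zero
  mul_mem' {_ T} hS _ := hS.comp_clm T
  smul_mem' c _ hT := hT.smul c
  star_mem' hT := isCompactOperator_adjoint hT

instance compacts_isClosed : IsClosed (compacts : Set (L2 →L[ℂ] L2)) :=
  isClosed_setOfPred_isCompactOperator

/-- Rapid decay of a sequence. -/
def RapidSeq (v : ℕ → ℂ) : Prop :=
  ∀ p : ℕ, ∃ c : ℝ, ∀ k : ℕ, ((k : ℝ) + 1) ^ p * ‖v k‖ ≤ c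

/-- Rapid decay of the matrix `⟨j|T|k⟩` of an operator. -/
def RapidMatrix (T : L2 →L[ℂ] L2) : Prop :=
  ∀ p : ℕ, ∃ c : ℝ, ∀ j k : ℕ,
    ((j : ℝ) + 1) ^ p * ((k : ℝ) + 1) ^ p * ‖T (lp.single 2 k 1) j‖ ≤ c

theorem rapidMatrix_star {T : L2 →L[ℂ] L2} (h : RapidMatrix T) : RapidMatrix (star T) := by
  intro p
  obtain ⟨c, hc⟩ := h p
  refine ⟨c, fun j k => ?_⟩
  have h1 : ‖star T (lp.single 2 k 1) j‖ = ‖T (lp.single 2 j 1) k‖ := by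
    have h2 := lp.inner_single_left (𝕜 := ℂ) (G := fun _ : ℕ => ℂ) j 1 (star T (lp.single 2 k 1))
    have h3 := lp.inner_single_right (𝕜 := ℂ) (G := fun _ : ℕ => ℂ) k 1 (T (lp.single 2 j 1))
    rw [ContinuousLinearMap.star_eq_adjoint, ContinuousLinearMap.adjoint_inner_right, h3] at h2
    have h4 := congrArg norm h2
    simpa [ContinuousLinearMap.star_eq_adjoint] using h4.symm
  rw [h1, mul_comm (((j : ℝ) + 1) ^ p)]
  exact hc k j

theorem memLp_inv : Memℓp (fun k : ℕ => (((k : ℂ) + 1)⁻¹)) 2 := by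
  refine memℓp_gen ?_
  have h := (summable_nat_add_iff 1).2 (Real.summable_nat_pow_inv.2 (one_lt_two))
  refine h.congr fun k => ?_
  have h1 : ‖(k : ℂ) + 1‖ = (k : ℝ) + 1 := by
    rw [show (k : ℂ) + 1 = ((k + 1 : ℕ) : ℂ) by push_cast; rfl, Complex.norm_natCast]
    push_cast; rfl
  simp [h1]

/-- The square summable sequence `1, 1/2, 1/3, …`. -/
def invSeq : L2 := ⟨_, memLp_inv⟩

theorem norm_le_invSeq (v : L2) (d : ℝ) (h : ∀ k : ℕ, ((k : ℝ) + 1) * ‖v k‖ ≤ d) :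
    ‖v‖ ≤ d * ‖invSeq‖ := by
  have hd : 0 ≤ d := le_trans (by positivity) (h 0)
  have h1 : ‖v‖ ≤ ‖(d : ℂ) • invSeq‖ := by
    refine lp.norm_mono (by norm_num) fun k => ?_
    have h2 : ‖(k : ℂ) + 1‖ = (k : ℝ) + 1 := by
      rw [show (k : ℂ) + 1 = ((k + 1 : ℕ) : ℂ) by push_cast; rfl, Complex.norm_natCast]
      push_cast; rfl
    have h3 : ‖((d : ℂ) • invSeq) k‖ = d * ((k : ℝ) + 1)⁻¹ := by
      change ‖(d : ℂ) * ((k : ℂ) + 1)⁻¹‖ = _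
      simp [h2, abs_of_nonneg hd]
    rw [h3, ← div_eq_mul_inv, le_div_iff₀ (by positivity), mul_comm]
    exact h k
  rw [norm_smul] at h1
  simpa [abs_of_nonneg hd] using h1

theorem RapidMatrix.column {T : L2 →L[ℂ] L2} (h : RapidMatrix T) (p : ℕ) :
    ∃ c : ℝ, 0 ≤ c ∧ ∀ k : ℕ, ((k : ℝ) + 1) ^ p * ‖T (lp.single 2 k 1)‖ ≤ c := by
  obtain ⟨c, hc⟩ := h (p + 1)
  have hc0 : 0 ≤ c := le_trans (by positivity) (hc 0 0)
  refine ⟨c * ‖invSeq‖, by positivity, fun k => ?_⟩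
  have h1 : ‖T (lp.single 2 k 1)‖ ≤ (c / ((k : ℝ) + 1) ^ p) * ‖invSeq‖ := by
    refine norm_le_invSeq _ _ fun j => ?_
    rw [le_div_iff₀ (by positivity)]
    refine le_trans ?_ (hc j k)
    have hj : ((j : ℝ) + 1) ≤ ((j : ℝ) + 1) ^ (p + 1) :=
      le_self_pow₀ (by linarith [j.cast_nonneg (α := ℝ)]) (by simp)
    have hk : ((k : ℝ) + 1) ^ p ≤ ((k : ℝ) + 1) ^ (p + 1) :=
      pow_le_pow_right₀ (by linarith [k.cast_nonneg (α := ℝ)]) (by simp)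
    calc ((j : ℝ) + 1) * ‖T (lp.single 2 k 1) j‖ * ((k : ℝ) + 1) ^ p
        = ((j : ℝ) + 1) * ((k : ℝ) + 1) ^ p * ‖T (lp.single 2 k 1) j‖ := by ring
      _ ≤ _ := by gcongr
  calc ((k : ℝ) + 1) ^ p * ‖T (lp.single 2 k 1)‖
      ≤ ((k : ℝ) + 1) ^ p * ((c / ((k : ℝ) + 1) ^ p) * ‖invSeq‖) := by gcongr
    _ = c * ‖invSeq‖ := by field_simp

theorem rapidMatrix_mul {S T : L2 →L[ℂ] L2} (hS : RapidMatrix S) (hT : RapidMatrix T) :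
    RapidMatrix (S * T) := by
  intro p
  obtain ⟨c, hc0, hc⟩ := (rapidMatrix_star hS).column p
  obtain ⟨d, hd0, hd⟩ := hT.column p
  refine ⟨c * d, fun j k => ?_⟩
  have h1 : ‖(S * T) (lp.single 2 k 1) j‖ ≤
      ‖star S (lp.single 2 j 1)‖ * ‖T (lp.single 2 k 1)‖ := by
    have h2 := lp.inner_single_left (𝕜 := ℂ) (G := fun _ : ℕ => ℂ) j 1 (S (T (lp.single 2 k 1)))
    rw [← ContinuousLinearMap.adjoint_inner_left] at h2
    have h3 := norm_inner_le_norm (𝕜 := ℂ) (ContinuousLinearMap.adjoint S (lp.single 2 j 1))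
      (T (lp.single 2 k 1))
    rw [h2] at h3
    simpa [ContinuousLinearMap.star_eq_adjoint] using h3
  calc _ ≤ ((j : ℝ) + 1) ^ p * ((k : ℝ) + 1) ^ p *
        (‖star S (lp.single 2 j 1)‖ * ‖T (lp.single 2 k 1)‖) := by gcongr
    _ = (((j : ℝ) + 1) ^ p * ‖star S (lp.single 2 j 1)‖) *
        (((k : ℝ) + 1) ^ p * ‖T (lp.single 2 k 1)‖) := by ring
    _ ≤ c * d := mul_le_mul (hc j) (hd k) (by positivity) hc0

/-- The algebra `𝒮(ℕ²)` of rapid decay matrices, inside the compact operators. -/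
def rapid : NonUnitalStarSubalgebra ℂ compacts where
  carrier := {T | RapidMatrix T}
  add_mem' {S T} hS hT := by
    intro p
    obtain ⟨c, hc⟩ := hS p
    obtain ⟨d, hd⟩ := hT p
    refine ⟨c + d, fun j k => ?_⟩
    have h : ‖((S + T : compacts) : L2 →L[ℂ] L2) (lp.single 2 k 1) j‖ ≤
        ‖(S : L2 →L[ℂ] L2) (lp.single 2 k 1) j‖ + ‖(T : L2 →L[ℂ] L2) (lp.single 2 k 1) j‖ :=
      norm_add_le _ _
    calc _ ≤ _ := mul_le_mul_of_nonneg_left h (by positivity)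
      _ ≤ c + d := by rw [mul_add]; exact add_le_add (hc j k) (hd j k)
  zero_mem' p := ⟨0, fun j k => by simp⟩
  mul_mem' hS hT := rapidMatrix_mul hS hT
  smul_mem' a T hT := by
    intro p
    obtain ⟨c, hc⟩ := hT p
    refine ⟨‖a‖ * c, fun j k => ?_⟩
    have h : ‖((a • T : compacts) : L2 →L[ℂ] L2) (lp.single 2 k 1) j‖ =
        ‖a‖ * ‖(T : L2 →L[ℂ] L2) (lp.single 2 k 1) j‖ := norm_mul _ _
    rw [h, mul_left_comm]
    exact mul_le_mul_of_nonneg_left (hc j k) (norm_nonneg a)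
  star_mem' hT := rapidMatrix_star hT

/-- The space `𝒮(ℕ)` of rapid decay sequences. -/
def rapidSeq : Submodule ℂ L2 where
  carrier := {v | RapidSeq v}
  add_mem' {v w} hv hw := by
    intro p
    obtain ⟨c, hc⟩ := hv p
    obtain ⟨d, hd⟩ := hw p
    refine ⟨c + d, fun k => ?_⟩
    calc _ ≤ _ := mul_le_mul_of_nonneg_left (norm_add_le (v k) (w k)) (by positivity)
      _ ≤ c + d := by rw [mul_add]; exact add_le_add (hc k) (hd k)
  zero_mem' p := ⟨0, fun k => by simp⟩
  smul_mem' a v hv := by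
    intro p
    obtain ⟨c, hc⟩ := hv p
    refine ⟨‖a‖ * c, fun k => ?_⟩
    have h : ‖(a • v : L2) k‖ = ‖a‖ * ‖v k‖ := norm_mul _ _
    rw [h, mul_left_comm]
    exact mul_le_mul_of_nonneg_left (hc k) (norm_nonneg a)

/-- The operator on `ℓ²(ℕ)` given by a linear map `F` of sequences, on its maximal domain of vectors
`v` with `F v` square summable. -/
def seqOp (F : (ℕ → ℂ) →ₗ[ℂ] (ℕ → ℂ)) : L2 →ₗ.[ℂ] L2 where
  domain :=
    { carrier := {v | Memℓp (F v) 2}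
      add_mem' := fun {v w} hv hw => by
        have h : F (v + w : L2) = F v + F w := F.map_add v w
        rw [Set.mem_ofPred_eq, h]
        exact Memℓp.add hv hw
      zero_mem' := by
        have h : F (0 : L2) = 0 := F.map_zero
        rw [Set.mem_ofPred_eq, h]
        exact zero_memℓp
      smul_mem' := fun a v hv => by
        have h : F (a • v : L2) = a • F v := F.map_smul a v
        rw [Set.mem_ofPred_eq, h]
        exact Memℓp.const_smul hv a }
  toFun :=
    { toFun := fun v => ⟨F v.1, v.2⟩
      map_add' := fun v w => Subtype.ext (F.map_add v.1.1 w.1.1)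
      map_smul' := fun a v => Subtype.ext (F.map_smul a v.1.1) }

/-- The sequence `𝔞 v`, where `𝔞|k⟩ = √k |k-1⟩`. -/
def annSeq : (ℕ → ℂ) →ₗ[ℂ] (ℕ → ℂ) where
  toFun v k := ((√(k + 1 : ℝ) : ℝ) : ℂ) * v (k + 1)
  map_add' v w := by ext k; simp [mul_add]
  map_smul' a v := by ext k; simp [mul_left_comm]

/-- The sequence `𝔞† v`, where `𝔞†|k⟩ = √(k+1) |k+1⟩`. -/
def creSeq : (ℕ → ℂ) →ₗ[ℂ] (ℕ → ℂ) where
  toFun v k := ((√(k : ℝ) : ℝ) : ℂ) * v (k - 1)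
  map_add' v w := by ext k; simp [mul_add]
  map_smul' a v := by ext k; simp [mul_left_comm]

/-- The annihilation operator `𝔞`. -/
def ann : L2 →ₗ.[ℂ] L2 := seqOp annSeq

/-- The creation operator `𝔞†`. -/
def cre : L2 →ₗ.[ℂ] L2 := seqOp creSeq

theorem memLp_of_le (v : ℕ → ℂ) (d : ℝ) (h : ∀ k : ℕ, ((k : ℝ) + 1) * ‖v k‖ ≤ d) :
    Memℓp v 2 := by
  have hs := (memLp_inv.const_smul (d : ℂ)).summable (by norm_num)
  refine memℓp_gen (Summable.of_nonneg_of_le (fun k => by positivity) (fun k => ?_) hs)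
  have hd : 0 ≤ d := le_trans (by positivity) (h 0)
  have h2 : ‖(k : ℂ) + 1‖ = (k : ℝ) + 1 := by
    rw [show (k : ℂ) + 1 = ((k + 1 : ℕ) : ℂ) by push_cast; rfl, Complex.norm_natCast]
    push_cast; rfl
  refine Real.rpow_le_rpow (norm_nonneg _) ?_ (by norm_num)
  have h3 : ‖((d : ℂ) • fun k : ℕ => ((k : ℂ) + 1)⁻¹) k‖ = d * ((k : ℝ) + 1)⁻¹ := by
    simp [h2, abs_of_nonneg hd]
  rw [h3, ← div_eq_mul_inv, le_div_iff₀ (by positivity), mul_comm]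
  exact h k

theorem rapidSeq_le_ann : rapidSeq ≤ ann.domain := by
  intro v hv
  obtain ⟨c, hc⟩ := hv 2
  refine memLp_of_le _ c fun k => le_trans ?_ (hc (k + 1))
  have h1 : ‖annSeq v k‖ = √((k : ℝ) + 1) * ‖v (k + 1)‖ := by
    simp [annSeq, abs_of_nonneg (Real.sqrt_nonneg _)]
  rw [h1, ← mul_assoc]
  refine mul_le_mul_of_nonneg_right ?_ (norm_nonneg _)
  have hk : (0 : ℝ) ≤ k := k.cast_nonneg
  have h2 : √((k : ℝ) + 1) ≤ (k : ℝ) + 1 := Real.sqrt_le_iff.2 ⟨by positivity, by nlinarith⟩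
  push_cast
  nlinarith

theorem rapidSeq_le_cre : rapidSeq ≤ cre.domain := by
  intro v hv
  obtain ⟨c, hc⟩ := hv 2
  refine memLp_of_le _ (2 * c) fun k => ?_
  rcases k with _ | k
  · simp only [creSeq, LinearMap.coe_mk, AddHom.coe_mk]
    have : 0 ≤ c := le_trans (by positivity) (hc 0)
    simpa using this
  · have h1 : ‖creSeq v (k + 1)‖ = √((k : ℝ) + 1) * ‖v k‖ := by
      simp [creSeq, abs_of_nonneg (Real.sqrt_nonneg _)]
    have hk : (0 : ℝ) ≤ k := k.cast_nonneg
    have h2 : √((k : ℝ) + 1) ≤ (k : ℝ) + 1 := Real.sqrt_le_iff.2 ⟨by positivity, by nlinarith⟩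
    have h3 : (((k + 1 : ℕ) : ℝ) + 1) * √((k : ℝ) + 1) ≤ 2 * ((k : ℝ) + 1) ^ 2 := by
      push_cast
      nlinarith
    rw [h1, ← mul_assoc]
    calc _ ≤ 2 * ((k : ℝ) + 1) ^ 2 * ‖v k‖ := mul_le_mul_of_nonneg_right h3 (norm_nonneg _)
      _ ≤ 2 * c := by rw [mul_assoc]; exact mul_le_mul_of_nonneg_left (hc k) (by norm_num)

/-- The Schrödinger spectral triple `(𝒮(ℕ²), ℓ²(ℕ) ⊗ ℂ², D)` of the Moyal plane. -/
def moyal (θ : ℝ) : TripleData where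
  A := compacts
  smooth := rapid
  H := Spinor L2
  rep := ampHom.comp (NonUnitalStarSubalgebraClass.subtype compacts)
  D := oddOp (scale θ) ann cre

/-! ## The correspondences -/

/-- The operator `|η⟩⟨ξ|`. -/
def ketBra (η ξ : L2) : compacts :=
  ⟨InnerProductSpace.rankOne ℂ η ξ, by
    change IsCompactOperator (InnerProductSpace.rankOne ℂ η ξ)
    rw [InnerProductSpace.rankOne_def']
    exact (isCompactOperator_of_locallyCompactSpace_rng
      (ContinuousLinearMap.toSpanSingleton ℂ η)).comp_clm (innerSL ℂ ξ)⟩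

/-- The product `ξT` of a row vector `ξ` with a bounded operator: `ξT = (T* ξ*)*`. -/
def rowMul (ξ : L2) (T : L2 →L[ℂ] L2) : L2 := star (ContinuousLinearMap.adjoint T (star ξ))

/-- The product of a row of vectors with a matrix. -/
def rowMat (n : ℕ) : (Fin n → L2) →ₗ[ℂ] Matrix (Fin n) (Fin n) ℂ →ₗ[ℂ] (Fin n → L2) :=
  LinearMap.mk₂ ℂ (fun η a j => ∑ i, a i j • η i)
    (by intros; ext1 j; simp [Finset.sum_add_distrib])
    (by intro c m a; ext1 j; simp only [Pi.smul_apply, Finset.smul_sum, smul_comm c])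
    (by intros; ext1 j; simp [Finset.sum_add_distrib, add_smul])
    (by intros; ext1 j; simp [Finset.smul_sum, mul_smul])

/-- The product of a matrix with a column of vectors. -/
def matCol (n : ℕ) : Matrix (Fin n) (Fin n) ℂ →ₗ[ℂ] (Fin n → L2) →ₗ[ℂ] (Fin n → L2) :=
  LinearMap.mk₂ ℂ (fun a ξ i => ∑ j, a i j • ξ j)
    (by intros; ext1 j; simp [Finset.sum_add_distrib, add_smul])
    (by intros; ext1 j; simp [Finset.smul_sum, mul_smul])
    (by intros; ext1 j; simp [Finset.sum_add_distrib])
    (by intro c a m; ext1 j; simp only [Pi.smul_apply, Finset.smul_sum, smul_comm c])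

/-- The `𝒦`-`M_n(ℂ)` bimodule `ℓ²(ℕ) ⊗ \overline{ℂⁿ}` of rows of length `n` with entries in the space
of column vectors `ℓ²(ℕ)`. -/
def bimod (n : ℕ) : BimoduleData compacts (Matrix (Fin n) (Fin n) ℂ) where
  E := Fin n → L2
  ract := rowMat n
  lact := LinearMap.mk₂ ℂ (fun T η i => (T : L2 →L[ℂ] L2) (η i))
    (by intros; ext1 j; simp) (by intros; ext1 j; simp)
    (by intros; ext1 j; simp) (by intros; ext1 j; simp)
  rinner η ξ := Matrix.of fun i j => ⟪η i, ξ j⟫_ℂ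
  linner η ξ := ∑ i, ketBra (η i) (ξ i)

/-- The conjugate `M_n(ℂ)`-`𝒦` bimodule `ℂⁿ ⊗ \overline{ℓ²(ℕ)}` of columns of length `n` with entries in
the space of square summable row vectors. -/
def bimodBar (n : ℕ) : BimoduleData (Matrix (Fin n) (Fin n) ℂ) compacts where
  E := Fin n → L2
  ract := LinearMap.mk₂ ℂ (fun ξ T i => rowMul (ξ i) (T : L2 →L[ℂ] L2))
    (by intros; ext1 j; simp [rowMul]) (by intros; ext1 j; simp [rowMul])
    (by intros; ext1 j; simp [rowMul])
    (by
      intro c m T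
      ext1 j
      change star (ContinuousLinearMap.adjoint (c • (T : L2 →L[ℂ] L2)) (star (m j))) = _
      rw [map_smulₛₗ]
      simp [rowMul])
  lact := matCol n
  rinner ξ ζ := ∑ i, ketBra (star (ξ i)) (star (ζ i))
  linner ξ ζ := Matrix.of fun i j => ⟪ζ j, ξ i⟫_ℂ

/-- The product `\overline{ℂⁿ} × ℂⁿ → ℂ` applied to the last factor of `ℓ²(ℕ) ⊗ \overline{ℂⁿ}`. -/
def pair (n : ℕ) : (Fin n → L2) →ₗ[ℂ] EuclideanSpace ℂ (Fin n) →ₗ[ℂ] L2 :=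
  LinearMap.mk₂ ℂ (fun η ψ => ∑ i, ψ i • η i)
    (by intros; simp [Finset.sum_add_distrib])
    (by intro c m a; simp only [Pi.smul_apply, Finset.smul_sum, smul_comm c])
    (by intros; simp [Finset.sum_add_distrib, add_smul])
    (by intros; simp [Finset.smul_sum, mul_smul])

/-- The product `\overline{ℓ²(ℕ)} × ℓ²(ℕ) → ℂ` of a row and a column, applied to the last factor of
`ℂⁿ ⊗ \overline{ℓ²(ℕ)}`. -/
def pairBar (n : ℕ) : (Fin n → L2) →ₗ[ℂ] L2 →ₗ[ℂ] EuclideanSpace ℂ (Fin n) :=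
  LinearMap.mk₂ ℂ (fun ξ v => WithLp.toLp 2 fun i => ⟪star (ξ i), v⟫_ℂ)
    (by intros; ext i; simp) (by intros; ext i; simp [mul_comm])
    (by intros; ext i; simp) (by intros; ext i; simp)

/-- The domain `𝒮(ℕ) ⊗ \overline{ℂⁿ}`, respectively `ℂⁿ ⊗ \overline{𝒮(ℕ)}`. -/
def rapidDom (n : ℕ) : Submodule ℂ (Fin n → L2) := Submodule.pi Set.univ fun _ => rapidSeq

theorem mem_rapidDom {n : ℕ} (η : rapidDom n) (i : Fin n) : η.1 i ∈ rapidSeq :=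
  η.2 i (Set.mem_univ i)

/-- `𝔞` applied entrywise. -/
def annE {n : ℕ} (η : rapidDom n) : Fin n → L2 := fun i =>
  ann ⟨η.1 i, rapidSeq_le_ann (mem_rapidDom η i)⟩

/-- `𝔞†` applied entrywise. -/
def creE {n : ℕ} (η : rapidDom n) : Fin n → L2 := fun i =>
  cre ⟨η.1 i, rapidSeq_le_cre (mem_rapidDom η i)⟩

/-- The unitary `U`. -/
def corrU (n : ℕ) (θ : ℝ) : HTensor (truncation n θ) (bimod n) →ₗ[ℂ] (moyal θ).H :=
  btLift _ _ (M := Fin n → L2) (N := Spinor (EuclideanSpace ℂ (Fin n))) (P := Spinor L2)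
    (spinorMul (pair n))
    (by
      rintro m (a : Matrix (Fin n) (Fin n) ℂ) m' v v' rfl rfl
      ext1 k
      change ∑ j, (v k).ofLp j • ∑ i, a i j • m i =
        ∑ i, (a.mulVec (v k).ofLp) i • m i
      simp only [Matrix.mulVec, dotProduct, Finset.smul_sum, Finset.sum_smul, smul_smul]
      rw [Finset.sum_comm]
      simp only [mul_comm])

/-- The unitary `\overline{U}`. -/
def corrUBar (n : ℕ) (θ : ℝ) : HTensor (moyal θ) (bimodBar n) →ₗ[ℂ] (truncation n θ).H :=
  btLift _ _ (M := Fin n → L2) (N := Spinor L2) (P := Spinor (EuclideanSpace ℂ (Fin n)))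
    (spinorMul (pairBar n))
    (by
      rintro m (T : compacts) m' v v' rfl rfl
      ext k i
      change ⟪star (rowMul (m i) (T : L2 →L[ℂ] L2)), v k⟫_ℂ = ⟪star (m i), (T : L2 →L[ℂ] L2) (v k)⟫_ℂ
      rw [rowMul, star_star, ContinuousLinearMap.adjoint_inner_left])

/-- The operator `ψ ↦ U((∇η)ψ)` for
`∇η = √(2/θ) (0, 𝔞η - ηX_n*; 𝔞†η - ηX_n, 0)`. -/
def connOp (n : ℕ) (θ : ℝ) (η : rapidDom n) (ψ : (truncation n θ).H) : (moyal θ).H :=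
  oddMap (scale θ)
    (pair n (annE η - rowMat n η.1 (Xmat n).conjTranspose))
    (pair n (creE η - rowMat n η.1 (Xmat n))) ψ

/-- The operator `ψ ↦ \overline{U}((\overline{∇}ξ)ψ)` for
`\overline{∇}ξ = √(2/θ) (0, X_n*ξ - ξ𝔞; X_nξ - ξ𝔞†, 0)`. On the entries of a row vector, right
multiplication by `𝔞` is the transposed operator `𝔞†`, and conversely. -/
def connBarOp (n : ℕ) (θ : ℝ) (ξ : rapidDom n) (ψ : (moyal θ).H) : (truncation n θ).H :=
  oddMap (scale θ)
    (pairBar n (matCol n (Xmat n).conjTranspose ξ.1 - creE ξ))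
    (pairBar n (matCol n (Xmat n) ξ.1 - annE ξ)) ψ

/-- The correspondence `(E, ∇, U)` from the truncation to the Schrödinger spectral triple. Under the
identification of `E₁ ⊗ Ω¹` with the off-diagonal matrices with entries in `E₁`, the connection is
`∇η = √(2/θ) (0, 𝔞η - ηX_n*; 𝔞†η - ηX_n, 0)`. -/
def corr (n : ℕ) (θ : ℝ) : CorrData (truncation n θ) (moyal θ) where
  X := bimod n
  dom := rapidDom n
  conn η := Classical.epsilon fun t => ∀ ψ,
    corrU n θ (formApply (truncation n θ) (bimod n) (rapidDom n) ψ t) = connOp n θ η ψ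
  U := corrU n θ

/-- The conjugate correspondence `(\overline{E}, \overline{∇}, \overline{U})`. Under the
identification of `\overline{E}₁ ⊗ Ω¹` with the off-diagonal matrices with entries in
`\overline{E}₁`, the connection is
`\overline{∇}ξ = √(2/θ) (0, X_n*ξ - ξ𝔞; X_nξ - ξ𝔞†, 0)`. -/
def corrBar (n : ℕ) (θ : ℝ) : CorrData (moyal θ) (truncation n θ) where
  X := bimodBar n
  dom := rapidDom n
  conn ξ := Classical.epsilon fun t => ∀ ψ,
    corrUBar n θ (formApply (moyal θ) (bimodBar n) (rapidDom n) ψ t) = connBarOp n θ ξ ψ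
  U := corrUBar n θ

end MoritaCat

end

/-! An element `t` of `E₁ ⊗ Ω¹` acts by the operator `ψ ↦ U(tψ)`, and the decisive property is that
this action is faithful (`FormsFaithful`). Granting it, the relation `D'U = U(1 ⊗_∇ D)` says that
`∇η` acts on `Dom D` as `D'U(η ⊗ ψ) - U(η ⊗ Dψ)`. Since `Dom D` is dense and forms act by bounded
operators, the connection is determined by `U`, `D` and `D'`. Linearity of `∇`, the Leibniz rule
(`leibniz_of_intertwines`), the existence of `σ` (`IsCorrespondence.exists_isSigma`), the formula
for the connection of a composition (`isComposition_of_completedTensor`) and the compatibility of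
similarities with connections (`intertwinesConn_idCorr`) all become telescoping operator identities.
Only the bimodule and the unitary of a composition remain to be understood.

For these, let `p(η', η)` be the element of `A` that represents `ψ ↦ U'(η' ⊗ U(η ⊗ ψ))`: a Gram
matrix in `M_n(ℂ)` in one order, a sum of operators `|η_i⟩⟨ξ_i|` in `𝒦` in the other. Through `p`
the algebra `A` is itself the completed tensor product, so the identity correspondence, with its
connection restricted to the span `F` of the values of `p` on the two domains, represents the
composition. For any other representative, `y ↦ U''(y ⊗ ·)` is an isometric map to `A` with closed
and dense range, hence a similarity (`exists_similarity`, `composesToId_of_pairing`). For `M_n(ℂ)`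
the span `F` is everything; for `𝒦` it consists of the finite-rank operators of rapid decay, a
proper part of `𝒮(ℕ²)`. This is why identity correspondences are studied on general sub-bimodules
`F`.

Three concrete inputs are needed. First, there must be enough one-forms. For `n ≥ 2` they are all
the odd matrices, because `[X_n, e₀₀]` and `[X_n*, e₀₀]` are multiples of different matrix units
that can be separated by multiplication on both sides; for `n = 1` there would be none. For the
Moyal plane they contain every odd matrix over `𝒮(ℕ²)`: an operator is factored through the diagonal
matrix of the square roots of its column norms, and splitting the columns modulo 3 separates the two
entries (`oddCLM_mem_moyal`).

Second, forms must act faithfully. Over `M_n(ℂ)` a form is a pair of elements of `E₁`. On the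
conjugate bimodule every form can be written `∑ eₖ⟨0| ⊗ ωₖ`, where the `ωₖ` can be read off. On `F ⊂
𝒜` any two elements have a common left factor that can be cancelled, so every form is one elementary
tensor (`HasCommonFactors`).

Third, `D²` is diagonal in the basis `|k⟩`. This gives `(1 + D²)^{-1/2}` explicitly and, with
symmetry, self-adjointness. Basis expansions of vectors in the domain converge in the graph norm, so
a subspace of the domain that contains the basis spinors is a core. -/

noncomputable section

namespace MoritaCat

open BimoduleData

/-! ## Generalities on balanced tensor products -/

section Balanced

variable {M N A : Type} [AddCommGroup M] [Module ℂ M] [AddCommGroup N] [Module ℂ N]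
  {r : M → A → M → Prop} {l : A → N → N → Prop}

/-- The canonical bilinear map `M × N → M ⊗_A N`. -/
def btmulₗ (r : M → A → M → Prop) (l : A → N → N → Prop) : M →ₗ[ℂ] N →ₗ[ℂ] BalancedTensor r l :=
  (TensorProduct.mk ℂ M N).compr₂ (Submodule.mkQ _)

theorem btmul_add_left (m m' : M) (n : N) :
    btmul r l (m + m') n = btmul r l m n + btmul r l m' n :=
  congrArg (· n) ((btmulₗ r l).map_add m m')

theorem btmul_smul_left (c : ℂ) (m : M) (n : N) :
    btmul r l (c • m) n = c • btmul r l m n :=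
  congrArg (· n) ((btmulₗ r l).map_smul c m)

theorem btmul_add_right (m : M) (n n' : N) :
    btmul r l m (n + n') = btmul r l m n + btmul r l m n' :=
  (btmulₗ r l m).map_add n n'

theorem btmul_smul_right (c : ℂ) (m : M) (n : N) :
    btmul r l m (c • n) = c • btmul r l m n :=
  (btmulₗ r l m).map_smul c n

theorem btmul_zero_left (n : N) : btmul r l 0 n = 0 :=
  congrArg (· n) (btmulₗ r l).map_zero

theorem btmul_zero_right (m : M) : btmul r l m 0 = 0 :=
  (btmulₗ r l m).map_zero

theorem btmul_balanced {m : M} {a : A} {m' : M} {n n' : N} (h₁ : r m a m') (h₂ : l a n n') :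
    btmul r l m' n = btmul r l m n' :=
  (Submodule.Quotient.eq _).2 (Submodule.subset_span ⟨m, a, m', n, n', h₁, h₂, rfl⟩)

theorem BalancedTensor.induction {p : BalancedTensor r l → Prop} (zero : p 0)
    (add : ∀ s t, p s → p t → p (s + t)) (mul : ∀ m n, p (btmul r l m n)) (t) : p t := by
  obtain ⟨x, rfl⟩ := Submodule.Quotient.mk_surjective _ t
  induction x with
  | zero => exact zero
  | tmul m n => exact mul m n
  | add x y hx hy => exact add _ _ hx hy

end Balanced

/-! ## Commutators and one-forms -/

section Commutator

variable {H : Type} [NormedAddCommGroup H] [InnerProductSpace ℂ H] {D : H →ₗ.[ℂ] H}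

theorem IsCommutator.unique (hD : Dense (D.domain : Set H)) {a K K' : H →L[ℂ] H}
    (h : IsCommutator D a K) (h' : IsCommutator D a K') : K = K' := by
  refine ContinuousLinearMap.coeFn_injective (Continuous.ext_on hD K.continuous K'.continuous ?_)
  intro ψ hψ
  obtain ⟨_, h₁⟩ := h ⟨ψ, hψ⟩
  obtain ⟨_, h₂⟩ := h' ⟨ψ, hψ⟩
  exact h₁.trans h₂.symm

theorem IsCommutator.mul {a b K L : H →L[ℂ] H} (ha : IsCommutator D a K)
    (hb : IsCommutator D b L) : IsCommutator D (a * b) (K * b + a * L) := by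
  intro ψ
  obtain ⟨h₁, h₂⟩ := hb ψ
  obtain ⟨h₃, h₄⟩ := ha ⟨b ψ, h₁⟩
  refine ⟨h₃, ?_⟩
  simp only [_root_.add_apply, mul_apply_eq_comp, h₂, map_sub]
  rw [h₄]
  exact sub_add_sub_cancel _ _ _

end Commutator

namespace IsSpectralTriple

variable {T : TripleData}

theorem dense_domain (hT : IsSpectralTriple T) : Dense (T.D.domain : Set T.H) :=
  hT.selfAdjoint.dense_domain

end IsSpectralTriple

theorem TripleData.comp_mem_oneForms (T : TripleData) {a : T.A} (ha : a ∈ T.smooth)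
    {ω : T.H →L[ℂ] T.H} (hω : ω ∈ T.oneForms) : T.rep a ∘L ω ∈ T.oneForms := by
  have h : T.oneForms ≤ T.oneForms.comap
      (LinearMap.mulLeft ℂ (T.rep a) : (T.H →L[ℂ] T.H) →ₗ[ℂ] _) := by
    refine Submodule.span_le.2 ?_
    rintro _ ⟨b, hb, c, hc, K, hK, rfl⟩
    refine Submodule.subset_span ⟨a * b, mul_mem ha hb, c, hc, K, hK, ?_⟩
    rw [map_mul]
    rfl
  exact h hω

/-- Leibniz: `b[D, c]a = b[D, ca] - bc[D, a]`, and both terms on the right are generators. -/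
theorem IsSpectralTriple.oneForms_comp_mem {T : TripleData} (hT : IsSpectralTriple T) {a : T.A}
    (ha : a ∈ T.smooth) {ω : T.H →L[ℂ] T.H} (hω : ω ∈ T.oneForms) :
    ω ∘L T.rep a ∈ T.oneForms := by
  have h : T.oneForms ≤ T.oneForms.comap
      (LinearMap.mulRight ℂ (T.rep a) : (T.H →L[ℂ] T.H) →ₗ[ℂ] _) := by
    refine Submodule.span_le.2 ?_
    rintro _ ⟨b, hb, c, hc, K, hK, rfl⟩
    obtain ⟨L, hL⟩ := hT.bounded_commutator a ha
    have h₁ : T.rep b ∘L (K * T.rep a + T.rep c * L) ∈ T.oneForms :=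
      Submodule.subset_span ⟨b, hb, c * a, mul_mem hc ha, _, by
        rw [map_mul]; exact hK.mul hL, rfl⟩
    have h₂ : T.rep (b * c) ∘L L ∈ T.oneForms :=
      Submodule.subset_span ⟨b * c, mul_mem hb hc, a, ha, L, hL, rfl⟩
    refine (congrArg (· ∈ T.oneForms) ?_).mp (T.oneForms.sub_mem h₁ h₂)
    ext ψ
    simp
  exact h hω

/-- Right multiplication of one-forms by an element of the algebra. -/
def IsSpectralTriple.mulRight {T : TripleData} (hT : IsSpectralTriple T) {a : T.A}
    (ha : a ∈ T.smooth) : T.oneForms →ₗ[ℂ] T.oneForms :=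
  ((LinearMap.mulRight ℂ (T.rep a) : (T.H →L[ℂ] T.H) →ₗ[ℂ] _).comp T.oneForms.subtype).codRestrict
    _ fun ω => hT.oneForms_comp_mem ha ω.2

/-! ## Correspondences whose forms act faithfully -/

section Corr

variable {T T' : TripleData}

/-- The action `t ↦ U(t ψ)` of forms. -/
def formU (C : CorrData T T') (ψ : T.H) : FormTensor T C.X C.dom →ₗ[ℂ] T'.H :=
  C.U ∘ₗ formApply T C.X C.dom ψ

@[simp] theorem formU_fmul (C : CorrData T T') (ψ : T.H) (η : C.dom) (ω : T.oneForms) :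
    formU C ψ (fmul T C.X C.dom η ω) = C.U (hmul T C.X η ((ω : T.H →L[ℂ] T.H) ψ)) := rfl

@[simp] theorem formU_btmul (C : CorrData T T') (ψ : T.H) (η : C.dom) (ω : T.oneForms) :
    formU C ψ (btmul _ _ η ω) = C.U (hmul T C.X η ((ω : T.H →L[ℂ] T.H) ψ)) := rfl

/-- A form that acts as zero is zero. -/
def FormsFaithful (C : CorrData T T') : Prop :=
  ∀ t, (∀ ψ, formU C ψ t = 0) → t = 0

theorem FormsFaithful.ext {C : CorrData T T'} (h : FormsFaithful C) {s t : FormTensor T C.X C.dom}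
    (hst : ∀ ψ, formU C ψ s = formU C ψ t) : s = t :=
  sub_eq_zero.1 (h _ fun ψ => by rw [map_sub, hst, sub_self])

/-! ### Bilinearity of `η ⊗ ψ` and boundedness of the operators that forms define. -/

theorem hmul_add_left (X : BimoduleData T'.A T.A) (η ξ : X.E) (ψ : T.H) :
    hmul T X (η + ξ) ψ = hmul T X η ψ + hmul T X ξ ψ := btmul_add_left _ _ _

theorem hmul_smul_left (X : BimoduleData T'.A T.A) (c : ℂ) (η : X.E) (ψ : T.H) :
    hmul T X (c • η) ψ = c • hmul T X η ψ := btmul_smul_left _ _ _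

theorem hmul_sub_left (X : BimoduleData T'.A T.A) (η ξ : X.E) (ψ : T.H) :
    hmul T X (η - ξ) ψ = hmul T X η ψ - hmul T X ξ ψ := by
  rw [eq_sub_iff_add_eq, ← hmul_add_left, sub_add_cancel]

theorem hmul_add_right (X : BimoduleData T'.A T.A) (η : X.E) (ψ φ : T.H) :
    hmul T X η (ψ + φ) = hmul T X η ψ + hmul T X η φ := btmul_add_right _ _ _

theorem hmul_smul_right (X : BimoduleData T'.A T.A) (c : ℂ) (η : X.E) (ψ : T.H) :
    hmul T X η (c • ψ) = c • hmul T X η ψ := btmul_smul_right _ _ _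

theorem hmul_sub_right (X : BimoduleData T'.A T.A) (η : X.E) (ψ φ : T.H) :
    hmul T X η (ψ - φ) = hmul T X η ψ - hmul T X η φ := by
  rw [eq_sub_iff_add_eq, ← hmul_add_right, sub_add_cancel]

theorem hmul_ract (X : BimoduleData T'.A T.A) (η : X.E) (a : T.A) (ψ : T.H) :
    hmul T X (X.ract η a) ψ = hmul T X η (T.rep a ψ) :=
  btmul_balanced (a := a) rfl rfl

/-- The map `U` preserves the inner product of `E ⊗_A H`. -/
def IsIsometric (C : CorrData T T') : Prop :=
  ∀ η₁ ψ₁ η₂ ψ₂, ⟪C.U (hmul T C.X η₁ ψ₁), C.U (hmul T C.X η₂ ψ₂)⟫_ℂ =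
    ⟪ψ₁, T.rep (C.X.rinner η₁ η₂) ψ₂⟫_ℂ

theorem IsIsometric.norm_le {C : CorrData T T'} (h : IsIsometric C) (η : C.X.E) (ψ : T.H) :
    ‖C.U (hmul T C.X η ψ)‖ ≤ √‖T.rep (C.X.rinner η η)‖ * ‖ψ‖ := by
  have h1 : ‖C.U (hmul T C.X η ψ)‖ ^ 2 ≤ ‖T.rep (C.X.rinner η η)‖ * ‖ψ‖ ^ 2 := by
    have h2 := congrArg norm (h η ψ η ψ)
    rw [inner_self_eq_norm_sq_to_K, norm_pow] at h2
    simp only [Complex.coe_algebraMap, Complex.norm_real, norm_norm] at h2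
    rw [h2]
    refine (norm_inner_le_norm _ _).trans ?_
    have h3 := (T.rep (C.X.rinner η η)).le_opNorm ψ
    nlinarith [norm_nonneg ψ]
  refine (pow_le_pow_iff_left₀ (norm_nonneg _) (by positivity) two_ne_zero).1 ?_
  rw [mul_pow, Real.sq_sqrt (norm_nonneg _)]
  exact h1

/-- The operator `ψ ↦ U(η ⊗ ψ)`. -/
def uOp {C : CorrData T T'} (h : IsIsometric C) (η : C.X.E) : T.H →L[ℂ] T'.H :=
  LinearMap.mkContinuousOfExistsBound
    { toFun := fun ψ => C.U (hmul T C.X η ψ)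
      map_add' := fun ψ φ => by rw [hmul_add_right, map_add]
      map_smul' := fun c ψ => by rw [hmul_smul_right, map_smul]; rfl }
    ⟨_, h.norm_le η⟩

@[simp] theorem uOp_apply {C : CorrData T T'} (h : IsIsometric C) (η : C.X.E) (ψ : T.H) :
    uOp h η ψ = C.U (hmul T C.X η ψ) := rfl

/-- An elementary tensor `η ⊗ ω` acts as `ω` followed by the bounded operator `uOp h η`. Boundedness
is what allows identities between forms to be tested on the dense subspace `Dom D`. -/
theorem IsIsometric.exists_formU {C : CorrData T T'} (h : IsIsometric C)
    (t : FormTensor T C.X C.dom) : ∃ B : T.H →L[ℂ] T'.H, ∀ ψ, formU C ψ t = B ψ := by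
  induction t using BalancedTensor.induction with
  | zero => exact ⟨0, fun ψ => by simp⟩
  | add s t hs ht =>
    obtain ⟨B, hB⟩ := hs
    obtain ⟨B', hB'⟩ := ht
    exact ⟨B + B', fun ψ => by simp [hB, hB']⟩
  | mul η ω => exact ⟨uOp h η ∘L ω.1, fun ψ => rfl⟩

theorem IsIsometric.formU_continuous {C : CorrData T T'} (h : IsIsometric C)
    (t : FormTensor T C.X C.dom) : Continuous fun ψ => formU C ψ t := by
  obtain ⟨B, hB⟩ := h.exists_formU t
  simpa only [hB] using B.continuous

/-- Equality of forms can be tested on the domain of `D`. -/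
theorem FormsFaithful.ext_domain {C : CorrData T T'} (h : FormsFaithful C) (hU : IsIsometric C)
    (hD : Dense (T.D.domain : Set T.H)) {s t : FormTensor T C.X C.dom}
    (hst : ∀ ψ : T.D.domain, formU C ψ s = formU C ψ t) : s = t :=
  h.ext fun ψ => congrFun (Continuous.ext_on hD (hU.formU_continuous s) (hU.formU_continuous t)
    fun ψ hψ => hst ⟨ψ, hψ⟩) ψ

/-- `D' U = U (1 ⊗_∇ D)` on `E₁ ⊗ Dom D`. -/
def Intertwines (C : CorrData T T') : Prop :=
  ∀ (η : C.dom) (ψ : T.D.domain), ∃ h : C.U (hmul T C.X η ψ) ∈ T'.D.domain,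
    T'.D ⟨C.U (hmul T C.X η ψ), h⟩ = C.U (hmul T C.X η (T.D ψ)) + formU C ψ (C.conn η)

/-- The intertwining relation solved for the connection: every later statement about `∇` is derived
from this formula. The vector `φ` is kept free so that another expression for `U(η ⊗ ψ)` can be
inserted together with its own proof of membership in the domain. -/
theorem Intertwines.formU_conn {C : CorrData T T'} (h : Intertwines C) {η : C.dom} {φ : T'.H}
    (ψ : T.D.domain) (hφ : φ = C.U (hmul T C.X η ψ)) : ∃ hd : φ ∈ T'.D.domain,
    formU C ψ (C.conn η) = T'.D ⟨φ, hd⟩ - C.U (hmul T C.X η (T.D ψ)) := by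
  subst hφ
  obtain ⟨h₁, h₂⟩ := h η ψ
  exact ⟨h₁, by rw [h₂, add_sub_cancel_left]⟩

/-- The expression `D'U(η ⊗ ψ) - U(η ⊗ Dψ)` is additive in `η`, and `∇η` is determined by it. An
argument is required because the connections in question are defined by a choice. -/
theorem conn_add_of_intertwines {C : CorrData T T'} (hF : FormsFaithful C) (hU : IsIsometric C)
    (hD : Dense (T.D.domain : Set T.H)) (hI : Intertwines C) (η ξ : C.dom) :
    C.conn (η + ξ) = C.conn η + C.conn ξ := by
  refine hF.ext_domain hU hD fun ψ => ?_
  obtain ⟨_, h₁⟩ := hI.formU_conn (η := η) ψ rfl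
  obtain ⟨_, h₂⟩ := hI.formU_conn (η := ξ) ψ rfl
  obtain ⟨_, h₃⟩ := hI.formU_conn (η := η + ξ) ψ
    (φ := C.U (hmul T C.X η ψ) + C.U (hmul T C.X ξ ψ))
    (by rw [← map_add, ← hmul_add_left]; rfl)
  rw [map_add, h₁, h₂, h₃, Submodule.coe_add, hmul_add_left, map_add, ← AddMemClass.mk_add_mk,
    LinearPMap.map_add]
  exact add_sub_add_comm _ _ _ _

theorem conn_smul_of_intertwines {C : CorrData T T'} (hF : FormsFaithful C) (hU : IsIsometric C)
    (hD : Dense (T.D.domain : Set T.H)) (hI : Intertwines C) (c : ℂ) (η : C.dom) :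
    C.conn (c • η) = c • C.conn η := by
  refine hF.ext_domain hU hD fun ψ => ?_
  obtain ⟨hd, h₁⟩ := hI.formU_conn (η := η) ψ rfl
  obtain ⟨_, h₃⟩ := hI.formU_conn (η := c • η) ψ (φ := c • C.U (hmul T C.X η ψ))
    (by rw [← map_smul, ← hmul_smul_left]; rfl)
  rw [map_smul, h₁, h₃, Submodule.coe_smul, hmul_smul_left, map_smul, smul_sub,
    ← LinearPMap.map_smul]
  rfl

/-- The commutators `[D, a]` with `a ∈ 𝒜` are one-forms. -/
def CommutatorsMem (T : TripleData) : Prop :=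
  ∀ a ∈ T.smooth, ∀ K, IsCommutator T.D (T.rep a) K → K ∈ T.oneForms

/-- Since `U(ηa ⊗ ψ) = U(η ⊗ aψ)`, the form `∇(ηa)` acts on `ψ` as `D'U(η ⊗ aψ) - U(η ⊗ aDψ)`.
Inserting `U(η ⊗ Daψ)` splits this into the action of `∇η` on `aψ` and that of `η ⊗ [D, a]` on `ψ`.
-/
theorem leibniz_of_intertwines {C : CorrData T T'} (hT : IsSpectralTriple T)
    (hΩ : CommutatorsMem T) (hF : FormsFaithful C) (hU : IsIsometric C) (hI : Intertwines C)
    (a : T.A) (ha : a ∈ T.smooth) :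
    ∃ (ρ : T.oneForms →ₗ[ℂ] T.oneForms)
      (hρ : ∀ ω, (ρ ω : T.H →L[ℂ] T.H) = (ω : T.H →L[ℂ] T.H) ∘L T.rep a) (δ : T.oneForms),
      IsCommutator T.D (T.rep a) δ ∧
      ∀ η η' : C.dom, (η' : C.X.E) = C.X.ract η a →
        C.conn η' = formRight T C.X C.dom a ρ hρ (C.conn η) + fmul T C.X C.dom η δ := by
  obtain ⟨K, hK⟩ := hT.bounded_commutator a ha
  refine ⟨hT.mulRight ha, fun ω => rfl, ⟨K, hΩ a ha K hK⟩, hK, fun η η' h => ?_⟩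
  refine hF.ext_domain hU hT.dense_domain fun ψ => ?_
  have h1 : ∀ t, formU C ψ (formRight T C.X C.dom a (hT.mulRight ha) (fun ω => rfl) t) =
      formU C (T.rep a ψ) t := by
    intro t
    induction t using BalancedTensor.induction with
    | zero => simp
    | add s t hs ht => simp only [map_add, hs, ht]
    | mul η ω => rfl
  obtain ⟨hd, h2⟩ := hK ψ
  obtain ⟨_, h3⟩ := hI.formU_conn (η := η) ⟨T.rep a ψ, hd⟩ rfl
  obtain ⟨_, h4⟩ := hI.formU_conn (η := η') ψ (φ := C.U (hmul T C.X η (T.rep a ψ)))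
    (by rw [h, hmul_ract])
  rw [map_add, h1, h3, h4, formU_fmul, h2, hmul_sub_right, map_sub, h, hmul_ract]
  exact (sub_add_sub_cancel _ _ _).symm

/-- A bimodule with a faithful action of forms is a correspondence as soon as its connection
satisfies the intertwining relation. -/
theorem IsCorrespondence.of_intertwines {C : CorrData T T'} (hT : IsSpectralTriple T)
    (hΩ : CommutatorsMem T) (hF : FormsFaithful C) (hU : IsIsometric C) (hI : Intertwines C)
    (morita : C.X.IsMorita)
    (dom_dense : ∀ η, ∀ ε > 0, ∃ ξ ∈ C.dom, C.X.rnorm (η - ξ) < ε)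
    (dom_ract : ∀ η ∈ C.dom, ∀ a ∈ T.smooth, C.X.ract η a ∈ C.dom)
    (dom_lact : ∀ b ∈ T'.smooth, ∀ η ∈ C.dom, C.X.lact b η ∈ C.dom)
    (denseRange : DenseRange C.U)
    (U_lact : ∀ b η ψ, C.U (hmul T C.X (C.X.lact b η) ψ) = T'.rep b (C.U (hmul T C.X η ψ)))
    (core : T'.D.HasCore
      (Submodule.span ℂ {φ | ∃ (η : C.dom) (ψ : T.D.domain), φ = C.U (hmul T C.X η ψ)})) :
    IsCorrespondence C where
  morita := morita
  dom_dense := dom_dense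
  dom_ract := dom_ract
  dom_lact := dom_lact
  conn_add := conn_add_of_intertwines hF hU hT.dense_domain hI
  conn_smul := conn_smul_of_intertwines hF hU hT.dense_domain hI
  leibniz := leibniz_of_intertwines hT hΩ hF hU hI
  isometric := hU
  denseRange := denseRange
  U_lact := U_lact
  intertwine := fun η ψ => by
    obtain ⟨h, h'⟩ := hI η ψ
    exact ⟨h, by rw [h', map_add]; rfl⟩
  core := core

theorem IsCorrespondence.intertwines {C : CorrData T T'} (h : IsCorrespondence C) :
    Intertwines C := fun η ψ => by
  obtain ⟨h, h'⟩ := h.intertwine η ψ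
  exact ⟨h, by rw [h', map_add]; rfl⟩

end Corr

end MoritaCat

end

noncomputable section

namespace MoritaCat

open BimoduleData

/-! ## Composition of correspondences -/

section Composition

variable {T T' T'' : TripleData}

theorem formU_formMap {C : CorrData T T'} {C₂ : CorrData T T''} {f : C.dom →ₗ[ℂ] C₂.dom}
    (hf : IsRightLinear T C.X C₂.X f) (B : T'.H →ₗ[ℂ] T''.H)
    (hB : ∀ η ψ, C₂.U (hmul T C₂.X (f η) ψ) = B (C.U (hmul T C.X η ψ))) (ψ : T.H)
    (t : FormTensor T C.X C.dom) :
    formU C₂ ψ (formMap T C.X C₂.X f hf t) = B (formU C ψ t) := by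
  induction t using BalancedTensor.induction with
  | zero => simp
  | add s t hs ht => simp only [map_add, hs, ht]
  | mul η ω => exact hB η _

/-- Left multiplication on the domain of the connection. -/
def IsCorrespondence.mulLeft {C : CorrData T T'} (h : IsCorrespondence C) (b : T'.smooth) :
    C.dom →ₗ[ℂ] C.dom :=
  ((C.X.lact b.1).comp C.dom.subtype).codRestrict _ fun η => h.dom_lact b b.2 η η.2

theorem IsCorrespondence.mulLeft_rightLinear {C : CorrData T T'} (h : IsCorrespondence C)
    (b : T'.smooth) : IsRightLinear T C.X C.X (h.mulLeft b) := fun a _ η η' hη => by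
  change C.X.lact b η' = C.X.ract (C.X.lact b η) a
  rw [hη, h.morita.lact_ract]

theorem IsCorrespondence.formU_mulLeft {C : CorrData T T'} (h : IsCorrespondence C)
    (b : T'.smooth) (ψ : T.H) (t : FormTensor T C.X C.dom) :
    formU C ψ (formMap T C.X C.X (h.mulLeft b) (h.mulLeft_rightLinear b) t) =
      T'.rep b (formU C ψ t) :=
  formU_formMap _ (T'.rep b).toLinearMap (fun η ψ => h.U_lact b η ψ) ψ t

/-- For `ψ ∈ Dom D` the terms `abU(η ⊗ Dψ)` coming from `a∇(bη)` and from `ab∇η` cancel. What is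
left is `a(D'b - bD')U(η ⊗ ψ)`, so the formula for `σ` simply lets the one-form act on `U(η ⊗ ψ)`.
-/
theorem IsCorrespondence.formU_commutator {C : CorrData T T'} (h : IsCorrespondence C)
    (hT : IsSpectralTriple T) (a b : T'.smooth) {K : T'.H →L[ℂ] T'.H}
    (hK : IsCommutator T'.D (T'.rep b) K) (η : C.dom) (ψ : T.H) :
    formU C ψ (formMap T C.X C.X (h.mulLeft a) (h.mulLeft_rightLinear a)
        (C.conn (h.mulLeft b η)) -
      formMap T C.X C.X (h.mulLeft (a * b)) (h.mulLeft_rightLinear (a * b)) (C.conn η)) =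
      T'.rep a (K (C.U (hmul T C.X η ψ))) := by
  have hU : IsIsometric C := h.isometric
  refine congrFun (Continuous.ext_on hT.dense_domain (hU.formU_continuous _)
    ((T'.rep a ∘L K ∘L uOp hU η).continuous) fun ψ hψ => ?_) ψ
  lift ψ to T.D.domain using hψ
  obtain ⟨h₁, h₂⟩ := h.intertwines.formU_conn (η := η) ψ rfl
  obtain ⟨h₃, h₄⟩ := h.intertwines.formU_conn (η := h.mulLeft b η) ψ
    (h.U_lact b η ψ).symm
  obtain ⟨h₅, h₆⟩ := hK ⟨_, h₁⟩
  rw [map_sub, h.formU_mulLeft, h.formU_mulLeft, h₂, h₄]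
  change _ = T'.rep a (K (C.U (hmul T C.X η ψ)))
  rw [h₆]
  have h₇ : C.U (hmul T C.X (h.mulLeft b η) (T.D ψ)) =
    T'.rep b (C.U (hmul T C.X η (T.D ψ))) := h.U_lact _ _ _
  have h₈ : T'.rep ((a * b : T'.smooth) : T'.A) = T'.rep a * T'.rep b := map_mul T'.rep _ _
  rw [h₇, h₈]
  simp only [map_sub, mul_apply_eq_comp]
  exact sub_sub_sub_cancel_right _ _ _

theorem IsCorrespondence.exists_sigma {C : CorrData T T'} (h : IsCorrespondence C)
    (hT : IsSpectralTriple T) {ω : T'.H →L[ℂ] T'.H} (hω : ω ∈ T'.oneForms) (η : C.dom) :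
    ∃ t, ∀ ψ, formU C ψ t = ω (C.U (hmul T C.X η ψ)) := by
  induction hω using Submodule.span_induction with
  | mem ω hω =>
    obtain ⟨a, ha, b, hb, K, hK, rfl⟩ := hω
    exact ⟨_, h.formU_commutator hT ⟨a, ha⟩ ⟨b, hb⟩ hK η⟩
  | zero => exact ⟨0, fun ψ => by simp⟩
  | add ω ω' _ _ h₁ h₂ =>
    obtain ⟨t, ht⟩ := h₁
    obtain ⟨t', ht'⟩ := h₂
    exact ⟨t + t', fun ψ => by simp [ht, ht']⟩
  | smul c ω _ h₁ =>
    obtain ⟨t, ht⟩ := h₁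
    exact ⟨c • t, fun ψ => by simp [ht]⟩

/-- The map `σ` exists when forms act faithfully, and is given by `U(σ(ω ⊗ η)ψ) = ω U(η ⊗ ψ)`. -/
theorem IsCorrespondence.exists_isSigma {C : CorrData T T'} (h : IsCorrespondence C)
    (hT : IsSpectralTriple T) (hF : FormsFaithful C) :
    ∃ σ : SigmaTensor C →ₗ[ℂ] FormTensor T C.X C.dom, IsSigma C σ ∧
      ∀ (ω : T'.oneForms) (η : C.dom) (ψ : T.H),
        formU C ψ (σ (btmul _ _ ω η)) = (ω : T'.H →L[ℂ] T'.H) (C.U (hmul T C.X η ψ)) := by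
  choose s hs using fun (ω : T'.oneForms) (η : C.dom) => h.exists_sigma hT ω.2 η
  -- The forms `s ω η` were chosen separately for each `ω` and `η`. Bilinearity and balancedness
  -- follow because their action is bilinear and balanced, and forms act faithfully.
  let s₂ : T'.oneForms →ₗ[ℂ] C.dom →ₗ[ℂ] FormTensor T C.X C.dom :=
    LinearMap.mk₂ ℂ s
      (fun ω ω' η => hF.ext fun ψ => by simp [hs])
      (fun c ω η => hF.ext fun ψ => by simp [hs])
      (fun ω η η' => hF.ext fun ψ => by simp [hs, hmul_add_left])
      (fun c ω η => hF.ext fun ψ => by simp [hs, hmul_smul_left])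
  let σ : SigmaTensor C →ₗ[ℂ] FormTensor T C.X C.dom := btLift _ _ s₂ (by
    intro ω a ω' η η' h₁ h₂
    refine hF.ext fun ψ => ?_
    change formU C ψ (s ω' η) = formU C ψ (s ω η')
    rw [hs, hs, h₁, h₂, h.U_lact]
    rfl)
  refine ⟨σ, ⟨h.mulLeft, h.mulLeft_rightLinear, fun b η => rfl, ?_⟩, hs⟩
  intro a b K ω η hK hω
  refine hF.ext fun ψ => ?_
  rw [h.formU_commutator hT a b hK η ψ]
  change formU C ψ (s ω η) = _
  rw [hs, hω]
  rfl

/-- A correspondence with the bimodule and the unitary of the composition is the composition: its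
connection is automatically the right one. -/
theorem isComposition_of_completedTensor {C : CorrData T T'} {C' : CorrData T' T''}
    {C'' : CorrData T T''} (hT : IsSpectralTriple T)
    (h : IsCorrespondence C) (h' : IsCorrespondence C') (h'' : IsCorrespondence C'')
    (hF : FormsFaithful C) (hF'' : FormsFaithful C'')
    (j : Tensor C'.X C.X →ₗ[ℂ] C''.X.E) (hj : IsCompletedTensor C'.X C.X C''.X j)
    (hdom : C''.dom = Submodule.span ℂ {y | ∃ η' ∈ C'.dom, ∃ η ∈ C.dom, y = j (tmul C'.X C.X η' η)})
    (hU : ∀ η' η ψ, C''.U (hmul T C''.X (j (tmul C'.X C.X η' η)) ψ) =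
      C'.U (hmul T' C'.X η' (C.U (hmul T C.X η ψ)))) :
    IsComposition C' C C'' := by
  obtain ⟨σ, hσ, hσU⟩ := h.exists_isSigma hT hF
  let jl : C'.X.E → C.X.E →ₗ[ℂ] C''.X.E := fun ξ' => j ∘ₗ btmulₗ _ _ ξ'
  let J : C'.dom → C.dom →ₗ[ℂ] C''.dom := fun ξ' =>
    ((jl ξ').comp C.dom.subtype).codRestrict _ fun x => by
      rw [hdom]
      exact Submodule.subset_span ⟨ξ', ξ'.2, x, x.2, rfl⟩
  have hJ : ∀ ξ', IsRightLinear T C.X C''.X (J ξ') := fun ξ' a _ η η' hη => by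
    change j (tmul C'.X C.X ξ' η') = C''.X.ract (j (tmul C'.X C.X ξ' η)) a
    rw [hη, hj.map_ract]
  let B : C'.X.E → T'.H →ₗ[ℂ] T''.H := fun ξ' => C'.U ∘ₗ btmulₗ _ _ ξ'
  have hJU : ∀ ξ' ψ t, formU C'' ψ (formMap T C.X C''.X (J ξ') (hJ ξ') t) =
      C'.U (hmul T' C'.X ξ' (formU C ψ t)) := fun ξ' ψ t =>
    formU_formMap (hJ ξ') (B ξ') (fun η φ => hU ξ' η φ) ψ t
  refine ⟨j, hj, hdom, hU, J, hJ, σ, fun ξ' x => rfl, hσ, fun η => ?_⟩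
  have hg : ∀ (ξ' : C'.dom) (ω : T'.oneForms) (ψ : T.H),
      formU C'' ψ (formMap T C.X C''.X (J ξ') (hJ ξ') (σ (btmul _ _ ω η))) =
        C'.U (hmul T' C'.X ξ' ((ω : T'.H →L[ℂ] T'.H) (C.U (hmul T C.X η ψ)))) := by
    intro ξ' ω ψ
    rw [hJU, hσU]
  let g : C'.dom → T'.oneForms → FormTensor T C''.X C''.dom := fun ξ' ω =>
    formMap T C.X C''.X (J ξ') (hJ ξ') (σ (btmul _ _ ω η))
  let g₂ : C'.dom →ₗ[ℂ] T'.oneForms →ₗ[ℂ] FormTensor T C''.X C''.dom :=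
    LinearMap.mk₂ ℂ g
      (fun ξ ξ' ω => hF''.ext fun ψ => by simp [g, hg, hmul_add_left])
      (fun c ξ' ω => hF''.ext fun ψ => by simp [g, hg, hmul_smul_left])
      (fun ξ' ω ω' => hF''.ext fun ψ => by simp [g, hg, hmul_add_right])
      (fun c ξ' ω => hF''.ext fun ψ => by simp [g, hg, hmul_smul_right])
  let Λ : FormTensor T' C'.X C'.dom →ₗ[ℂ] FormTensor T C''.X C''.dom := btLift _ _ g₂ (by
    intro ξ a ξ' ω ω' h₁ h₂
    refine hF''.ext fun ψ => ?_
    change formU C'' ψ (g ξ' ω) = formU C'' ψ (g ξ ω')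
    simp only [g]
    rw [hg, hg, h₁, h₂, hmul_ract]
    rfl)
  -- Under the unitaries, `(id ⊗ σ)(t ⊗ η)` acts on `ψ` as `t` acts on the vector `U(η ⊗ ψ)`.
  have hΛ : ∀ ψ t, formU C'' ψ (Λ t) = formU C' (C.U (hmul T C.X η ψ)) t := by
    intro ψ t
    induction t using BalancedTensor.induction with
    | zero => simp
    | add s t hs ht => simp only [map_add, hs, ht]
    | mul ξ' ω => exact hg ξ' ω ψ
  refine ⟨Λ, fun ξ' ω => rfl, fun η' => ?_⟩
  -- Both sides act as `D''U''(η'' ⊗ ψ) - U''(η'' ⊗ Dψ)` with `η'' = η' ⊗ η`. The two terms on the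
  -- right telescope through `U'(η' ⊗ D'U(η ⊗ ψ))`.
  refine hF''.ext_domain h''.isometric hT.dense_domain fun ψ => ?_
  obtain ⟨d₁, h₁⟩ := h.intertwines.formU_conn (η := η) ψ rfl
  obtain ⟨d₂, h₂⟩ := h'.intertwines.formU_conn (η := η') ⟨_, d₁⟩ rfl
  obtain ⟨d₃, h₃⟩ := h''.intertwines.formU_conn (η := J η' η) ψ (hU η' η ψ).symm
  have h₄ : C''.U (hmul T C''.X (J η' η) (T.D ψ)) =
    C'.U (hmul T' C'.X η' (C.U (hmul T C.X η (T.D ψ)))) := hU _ _ _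
  rw [map_add, hΛ, hJU, h₃, h₂, h₁, hmul_sub_right, map_sub, h₄]
  exact (sub_add_sub_cancel _ _ _).symm

end Composition

/-! ## Restrictions of the identity correspondence -/

section Identity

variable {T : TripleData}

/-- The identity correspondence, with its connection restricted to a subspace `F` of `𝒜`. -/
def idCorrOn (T : TripleData) (F : Submodule ℂ T.A) : CorrData T T where
  X := selfBimodule T.A
  dom := F
  conn a := Classical.epsilon fun t => ∃ K, IsCommutator T.D (T.rep a.1) K ∧
    ∀ ψ, multMap T (formApply T (selfBimodule T.A) _ ψ t) = K ψ
  U := multMap T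

theorem inner_rep_rep (a b : T.A) (ψ φ : T.H) :
    ⟪T.rep a ψ, T.rep b φ⟫_ℂ = ⟪ψ, T.rep (star a * b) φ⟫_ℂ := by
  rw [map_mul, map_star, ContinuousLinearMap.star_eq_adjoint, mul_apply_eq_comp,
    ContinuousLinearMap.adjoint_inner_right]

theorem idCorrOn_isIsometric (F : Submodule ℂ T.A) : IsIsometric (idCorrOn T F) :=
  fun a ψ b φ => inner_rep_rep a b ψ φ

/-- Any two elements of `F` have a common left factor in `F` that can be cancelled. -/
def HasCommonFactors (T : TripleData) (F : Submodule ℂ T.A) : Prop :=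
  ∀ a₁ ∈ F, ∀ a₂ ∈ F, ∃ b ∈ F, ∃ c₁ ∈ T.smooth, ∃ c₂ ∈ T.smooth, a₁ = b * c₁ ∧ a₂ = b * c₂ ∧
    ∀ ψ₁ ψ₂, T.rep b (T.rep c₁ ψ₁ + T.rep c₂ ψ₂) = 0 → T.rep c₁ ψ₁ + T.rep c₂ ψ₂ = 0

/-- With `a₁ = bc₁` and `a₂ = bc₂`, balancing turns `a₁ ⊗ ω₁ + a₂ ⊗ ω₂` into the single tensor `b ⊗
(c₁ω₁ + c₂ω₂)`, and `b` can be cancelled on the values of the second factor. A form is thus `b ⊗ ω`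
with this cancellation property, and if it acts as zero then `ω = 0`. -/
theorem HasCommonFactors.formsFaithful {F : Submodule ℂ T.A} (hF : HasCommonFactors T F) :
    FormsFaithful (idCorrOn T F) := by
  have key : ∀ t : FormTensor T (idCorrOn T F).X (idCorrOn T F).dom, ∃ (b : (idCorrOn T F).dom) (ω : T.oneForms),
      t = fmul T (idCorrOn T F).X (idCorrOn T F).dom b ω ∧
      ∀ ψ, T.rep b.1 ((ω : T.H →L[ℂ] T.H) ψ) = 0 → (ω : T.H →L[ℂ] T.H) ψ = 0 := by
    have two : ∀ (a₁ a₂ : (idCorrOn T F).dom) (ω₁ ω₂ : T.oneForms), ∃ (b : (idCorrOn T F).dom) (ω : T.oneForms),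
        fmul T (idCorrOn T F).X (idCorrOn T F).dom a₁ ω₁ + fmul T (idCorrOn T F).X (idCorrOn T F).dom a₂ ω₂ =
          fmul T (idCorrOn T F).X (idCorrOn T F).dom b ω ∧
        ∀ ψ, T.rep b.1 ((ω : T.H →L[ℂ] T.H) ψ) = 0 → (ω : T.H →L[ℂ] T.H) ψ = 0 := by
      intro a₁ a₂ ω₁ ω₂
      obtain ⟨b, hb, c₁, hc₁, c₂, hc₂, h₁, h₂, h₃⟩ := hF a₁.1 a₁.2 a₂.1 a₂.2
      let ω₁' : T.oneForms := ⟨_, T.comp_mem_oneForms hc₁ ω₁.2⟩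
      let ω₂' : T.oneForms := ⟨_, T.comp_mem_oneForms hc₂ ω₂.2⟩
      refine ⟨⟨b, hb⟩, ω₁' + ω₂', ?_, fun ψ hψ => h₃ _ _ hψ⟩
      have e₁ : fmul T (idCorrOn T F).X (idCorrOn T F).dom a₁ ω₁ = fmul T (idCorrOn T F).X (idCorrOn T F).dom ⟨b, hb⟩ ω₁' :=
        btmul_balanced (a := (⟨c₁, hc₁⟩ : T.smooth)) h₁ rfl
      have e₂ : fmul T (idCorrOn T F).X (idCorrOn T F).dom a₂ ω₂ = fmul T (idCorrOn T F).X (idCorrOn T F).dom ⟨b, hb⟩ ω₂' :=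
        btmul_balanced (a := (⟨c₂, hc₂⟩ : T.smooth)) h₂ rfl
      rw [e₁, e₂]
      exact (btmul_add_right _ _ _).symm
    intro t
    induction t using BalancedTensor.induction with
    | zero => exact ⟨0, 0, (btmul_zero_right _).symm, fun ψ _ => rfl⟩
    | add s t hs ht =>
      obtain ⟨b, ω, rfl, _⟩ := hs
      obtain ⟨b', ω', rfl, _⟩ := ht
      exact two b b' ω ω'
    | mul a ω =>
      -- An arbitrary `a` need not be cancellable on the values of `ω`. Pairing `a ⊗ ω` with the
      -- zero tensor replaces `a` by a factor that is.
      obtain ⟨b, ω', h, h'⟩ := two a 0 ω 0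
      refine ⟨b, ω', ?_, h'⟩
      rw [← h]
      exact (add_eq_left.2 (btmul_zero_right _)).symm
  intro t ht
  obtain ⟨b, ω, rfl, h⟩ := key t
  have : ω = 0 := Subtype.ext (ContinuousLinearMap.ext fun ψ => h ψ (ht ψ))
  rw [this]
  exact btmul_zero_right _

/-- The commutators `[D, a]` with `a ∈ F` lie in the image of `F ⊗ Ω¹`. -/
def CommutatorsFactor (T : TripleData) (F : Submodule ℂ T.A) : Prop :=
  ∀ a ∈ F, ∀ K, IsCommutator T.D (T.rep a) K → ∃ b ∈ F, ∃ ω ∈ T.oneForms, K = T.rep b ∘L ω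

/-- The factorization `[D, a] = bω` provides the preimage `b ⊗ ω` of the commutator, so the choice
in the definition of the connection is not vacuous. Without a unit in the algebra such a preimage is
not automatic. -/
theorem idCorrOn_formU_conn (hT : IsSpectralTriple T) {F : Submodule ℂ T.A}
    (hK : CommutatorsFactor T F) (a : F) (K : T.H →L[ℂ] T.H)
    (haK : IsCommutator T.D (T.rep a.1) K) (ψ : T.H) :
    formU (idCorrOn T F) ψ ((idCorrOn T F).conn a) = K ψ := by
  obtain ⟨b, hb, ω, hω, hbω⟩ := hK a a.2 K haK
  have h := Classical.epsilon_spec (p := fun t : FormTensor T (selfBimodule T.A) F =>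
    ∃ K, IsCommutator T.D (T.rep a.1) K ∧
      ∀ ψ, multMap T (formApply T (selfBimodule T.A) _ ψ t) = K ψ)
    ⟨fmul T (selfBimodule T.A) F ⟨b, hb⟩ ⟨ω, hω⟩, K, haK, fun ψ => by rw [hbω]; rfl⟩
  obtain ⟨K', h₁, h₂⟩ := h
  rw [haK.unique hT.dense_domain h₁]
  exact h₂ ψ

theorem idCorrOn_intertwines (hT : IsSpectralTriple T) {F : Submodule ℂ T.A}
    (hFs : ∀ a ∈ F, a ∈ T.smooth) (hK : CommutatorsFactor T F) : Intertwines (idCorrOn T F) := by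
  intro (a : F) ψ
  obtain ⟨K, haK⟩ := hT.bounded_commutator a.1 (hFs a a.2)
  obtain ⟨hd, h⟩ := haK ψ
  refine ⟨hd, ?_⟩
  rw [idCorrOn_formU_conn hT hK a K haK, h]
  exact (add_sub_cancel _ _).symm

theorem idCorrOn_isCorrespondence (hT : IsSpectralTriple T) (hΩ : CommutatorsMem T)
    (hA : (selfBimodule T.A).IsMorita) {F : Submodule ℂ T.A}
    (hFs : ∀ a ∈ F, a ∈ T.smooth) (hFd : Dense (F : Set T.A))
    (hFr : ∀ a ∈ F, ∀ b ∈ T.smooth, a * b ∈ F) (hFl : ∀ b ∈ T.smooth, ∀ a ∈ F, b * a ∈ F)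
    (hFf : HasCommonFactors T F) (hK : CommutatorsFactor T F)
    (core : T.D.HasCore
      (Submodule.span ℂ {φ | ∃ (a : F) (ψ : T.D.domain), φ = T.rep a.1 ψ})) :
    IsCorrespondence (idCorrOn T F) := by
  refine IsCorrespondence.of_intertwines hT hΩ hFf.formsFaithful (idCorrOn_isIsometric F)
    (idCorrOn_intertwines hT hFs hK) hA ?_ hFr hFl ?_ ?_ core
  · intro (a : T.A) ε hε
    obtain ⟨b, hb, hab⟩ := Metric.mem_closure_iff.1 (hFd a) ε hε
    refine ⟨b, hb, ?_⟩
    change √‖star (a - b) * (a - b)‖ < ε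
    rw [CStarRing.norm_star_mul_self, Real.sqrt_mul_self (norm_nonneg _), ← dist_eq_norm]
    exact hab
  · have h : LinearMap.range (idCorrOn T F).U =
        Submodule.span ℂ {ψ : T.H | ∃ a φ, ψ = T.rep a φ} := by
      refine le_antisymm ?_ (Submodule.span_le.2 ?_)
      · rintro _ ⟨t, rfl⟩
        induction t using BalancedTensor.induction with
        | zero => simp
        | add s t hs ht => rw [map_add]; exact add_mem hs ht
        | mul a ψ => exact Submodule.subset_span ⟨a, ψ, rfl⟩
      · rintro _ ⟨a, φ, rfl⟩
        exact ⟨hmul T (selfBimodule T.A) a φ, rfl⟩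
    have h2 := hT.nondegenerate
    rw [← h, ← Submodule.dense_iff_topologicalClosure_eq_top] at h2
    exact h2
  · intro b (a : T.A) ψ
    change T.rep (b * a) ψ = T.rep b (T.rep a ψ)
    rw [map_mul]
    rfl

theorem idConnIsCommutator (hT : IsSpectralTriple T)
    (hFf : HasCommonFactors T T.smooth.toNonUnitalSubalgebra.toSubmodule)
    (hK : CommutatorsFactor T T.smooth.toNonUnitalSubalgebra.toSubmodule) :
    IdConnIsCommutator T := by
  choose K hK' using hT.bounded_commutator
  refine ⟨fun a => K a.1 a.2, fun a => hK' a.1 a.2, fun a t => ?_⟩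
  have h : ∀ ψ, formU (idCorr T) ψ ((idCorr T).conn a) = K a.1 a.2 ψ :=
    idCorrOn_formU_conn hT hK a _ (hK' a.1 a.2)
  refine ⟨fun ht ψ => ht ▸ h ψ, fun ht => ?_⟩
  exact hFf.formsFaithful.ext fun ψ => (ht ψ).trans (h ψ).symm

end Identity

end MoritaCat

end

noncomputable section

namespace MoritaCat

open BimoduleData

/-! ## Similarity with the identity correspondence -/

section Similarity

/-- By continuity `(x - y)z = 0` for all `z`; taking `z = (x - y)*` and using the `C*`-identity
replaces the missing unit. -/
theorem eq_of_mul_dense {A : Type} [NonUnitalCStarAlgebra A] {S : Set A}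
    (hS : (Submodule.span ℂ S).topologicalClosure = ⊤) {x y : A}
    (h : ∀ s ∈ S, x * s = y * s) : x = y := by
  have h₁ : ∀ z, x * z = y * z := by
    rw [← Submodule.dense_iff_topologicalClosure_eq_top] at hS
    refine congrFun (Continuous.ext_on hS (by fun_prop) (by fun_prop) fun z hz => ?_)
    induction hz using Submodule.span_induction with
    | mem z hz => exact h z hz
    | zero => simp
    | add z w _ _ hz hw => simp only [mul_add, hz, hw]
    | smul c z _ hz => simp only [mul_smul_comm, hz]
  rw [← sub_eq_zero, ← CStarRing.mul_star_self_eq_zero_iff, sub_mul, h₁, sub_self]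

variable {T T' : TripleData}

theorem IsSpectralTriple.norm_rep (hT : IsSpectralTriple T) (a : T.A) : ‖T.rep a‖ = ‖a‖ :=
  NonUnitalStarAlgHom.norm_map T.rep hT.faithful a

theorem IsSpectralTriple.isClosed_range (hT : IsSpectralTriple T) :
    IsClosed (Set.range T.rep) :=
  (NonUnitalStarAlgHom.isometry T.rep hT.faithful).isClosedEmbedding.isClosed_range

variable {C'' : CorrData T T}

theorem norm_uOp_le (hT : IsSpectralTriple T) (h : IsIsometric C'') (y : C''.X.E) :
    ‖uOp h y‖ ≤ C''.X.rnorm y := by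
  refine ContinuousLinearMap.opNorm_le_bound _ (Real.sqrt_nonneg _) fun ψ => ?_
  have := h.norm_le y ψ
  rwa [hT.norm_rep] at this

theorem uOp_sub (h : IsIsometric C'') (y z : C''.X.E) : uOp h (y - z) = uOp h y - uOp h z := by
  ext ψ
  simp [hmul_sub_left]

/-- The map `V : E → A` determined by `V(y) ψ = U(y ⊗ ψ)`, provided that enough of the operators on the
right-hand side lie in `A`. -/
theorem exists_similarity (hT : IsSpectralTriple T) (hC : IsCorrespondence C'') {S : Set C''.X.E}
    (hS : ∀ y, ∀ ε > 0, ∃ t ∈ Submodule.span ℂ S, C''.X.rnorm (y - t) < ε)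
    (p : C''.X.E → T.A) (hp : ∀ y ∈ S, ∀ ψ, T.rep (p y) ψ = C''.U (hmul T C''.X y ψ))
    (hd : (Submodule.span ℂ (p '' S)).topologicalClosure = ⊤) :
    ∃ V : C''.X.E ≃ₗ[ℂ] T.A, ∀ y ψ, T.rep (V y) ψ = C''.U (hmul T C''.X y ψ) := by
  have hU : IsIsometric C'' := hC.isometric
  have hsp : ∀ y ∈ Submodule.span ℂ S, uOp hU y ∈ Set.range T.rep := by
    intro y hy
    induction hy using Submodule.span_induction with
    | mem y hy => exact ⟨p y, ContinuousLinearMap.ext fun ψ => hp y hy ψ⟩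
    | zero => exact ⟨0, by ext ψ; simp [hmul, btmul_zero_left]⟩
    | add y z _ _ hy hz =>
      obtain ⟨a, ha⟩ := hy
      obtain ⟨b, hb⟩ := hz
      exact ⟨a + b, by ext ψ; simp [ha, hb, hmul_add_left]⟩
    | smul c y _ hy =>
      obtain ⟨a, ha⟩ := hy
      exact ⟨c • a, by ext ψ; simp [ha, hmul_smul_left]⟩
  -- The range of the faithful representation is closed, and `y ↦ U(y ⊗ ·)` is contractive for the
  -- module norm, so membership passes from the span of `S` to all of `E`.
  have hmem : ∀ y, ∃ a, T.rep a = uOp hU y := fun y => by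
    refine hT.isClosed_range.closure_subset (Metric.mem_closure_iff.2 fun ε hε => ?_)
    obtain ⟨t, ht, hyt⟩ := hS y ε hε
    refine ⟨_, hsp t ht, ?_⟩
    rw [dist_eq_norm, ← uOp_sub]
    exact (norm_uOp_le hT hU _).trans_lt hyt
  choose v hv using hmem
  have hvψ : ∀ y ψ, T.rep (v y) ψ = C''.U (hmul T C''.X y ψ) := fun y ψ => by rw [hv]; rfl
  let V : C''.X.E →ₗ[ℂ] T.A :=
    { toFun := v
      map_add' := fun y z => hT.faithful <| by ext ψ; simp [hvψ, hmul_add_left]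
      map_smul' := fun c y => hT.faithful <| by ext ψ; simp [hvψ, hmul_smul_left] }
  have hr : ∀ y z, star (v y) * v z = C''.X.rinner y z := fun y z => hT.faithful <| by
    ext φ
    refine ext_inner_left ℂ fun ψ => ?_
    rw [← inner_rep_rep, hvψ, hvψ]
    exact hU _ _ _ _
  have hn : ∀ y, ‖V y‖ = C''.X.rnorm y := fun y => by
    rw [rnorm, ← hr, CStarRing.norm_star_mul_self, Real.sqrt_mul_self (norm_nonneg _)]
    rfl
  have hinj : Function.Injective V := by
    refine (injective_iff_map_eq_zero V).2 fun y hy => hC.morita.rinner_definite _ ?_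
    rw [← hr]
    change star (V y) * V y = 0
    rw [hy, mul_zero]
  -- `V` is isometric and `E` is complete for its module norm. As `E` carries no topology,
  -- completeness enters through Cauchy sequences.
  have hcl : IsClosed (LinearMap.range V : Set T.A) := by
    refine IsSeqClosed.isClosed fun u a hu hua => ?_
    choose y hy using hu
    have hcau := hua.cauchySeq
    obtain ⟨x, hx⟩ := hC.morita.rcomplete y fun ε hε => by
      obtain ⟨N, hN⟩ := Metric.cauchySeq_iff.1 hcau ε hε
      refine ⟨N, fun p hp q hq => ?_⟩
      rw [← hn, map_sub, hy, hy, ← dist_eq_norm]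
      exact hN p hp q hq
    refine ⟨x, tendsto_nhds_unique (Metric.tendsto_atTop.2 fun ε hε => ?_) hua⟩
    obtain ⟨N, hN⟩ := hx ε hε
    refine ⟨N, fun q hq => ?_⟩
    rw [← hy, dist_eq_norm, ← map_sub, hn]
    exact hN q hq
  have hsurj : Function.Surjective V := by
    refine LinearMap.range_eq_top.1 (top_le_iff.1 ?_)
    rw [← hd]
    refine Submodule.topologicalClosure_minimal _ (Submodule.span_le.2 ?_) hcl
    rintro _ ⟨y, hy, rfl⟩
    exact ⟨y, hT.faithful (ContinuousLinearMap.ext fun ψ => (hvψ y ψ).trans (hp y hy ψ).symm)⟩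
  exact ⟨LinearEquiv.ofBijective V ⟨hinj, hsurj⟩, hvψ⟩

theorem isSimilarity_of_rep (hT : IsSpectralTriple T) (hC : IsCorrespondence C'')
    (V : C''.X.E ≃ₗ[ℂ] T.A)
    (hV : ∀ y ψ, T.rep (V y) ψ = C''.U (hmul T C''.X y ψ)) :
    IsSimilarity C'' (idCorr T) V where
  map_ract y a := hT.faithful <| by
    ext ψ
    change T.rep (V (C''.X.ract y a)) ψ = T.rep (V y * a) ψ
    rw [hV, hmul_ract, map_mul, mul_apply_eq_comp, hV]
  rinner y z := hT.faithful <| by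
    ext φ
    refine ext_inner_left ℂ fun ψ => ?_
    change ⟪ψ, T.rep (star (V y) * V z) φ⟫_ℂ = _
    rw [← inner_rep_rep, hV, hV, hC.isometric]
  U_eq y ψ := hV y ψ

/-- A similarity with the identity intertwines the connections as soon as it is compatible with the
domains. -/
theorem intertwinesConn_idCorr (hT : IsSpectralTriple T) (hId : IdConnIsCommutator T)
    (hC : IsCorrespondence C'') {V : C''.X.E ≃ₗ[ℂ] (idCorr T).X.E}
    (hV : IsSimilarity C'' (idCorr T) V) (hdom : ∀ y ∈ C''.dom, V y ∈ (idCorr T).dom) :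
    IntertwinesConn C'' (idCorr T) V := by
  obtain ⟨K, hK, hconn⟩ := hId
  let f : C''.dom →ₗ[ℂ] (idCorr T).dom :=
    (V.toLinearMap.comp C''.dom.subtype).codRestrict _ fun y => hdom y y.2
  have hf : IsRightLinear T C''.X (idCorr T).X f := fun a _ η η' h => by
    change V η' = (idCorr T).X.ract (V η) a
    rw [h, hV.map_ract]
  refine ⟨f, hf, fun η => rfl, fun η => (hconn _ _).2 fun ψ => ?_⟩
  have h₁ : formU (idCorr T) ψ (formMap T C''.X (idCorr T).X f hf (C''.conn η)) =
      formU C'' ψ (C''.conn η) :=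
    formU_formMap hf LinearMap.id (fun η ψ => hV.U_eq η ψ) ψ _
  change formU (idCorr T) ψ _ = _
  rw [h₁]
  -- On `Dom D` both connections act as `D V(η)ψ - V(η)Dψ`: one by the definition of the commutator,
  -- the other by the intertwining relation and `U(y ⊗ ψ) = V(y)ψ`.
  refine congrFun (Continuous.ext_on hT.dense_domain
    (IsIsometric.formU_continuous hC.isometric (C''.conn η)) (K (f η)).continuous fun ψ hψ => ?_) ψ
  lift ψ to T.D.domain using hψ
  obtain ⟨h₂, h₃⟩ := hK (f η) ψ
  obtain ⟨_, h₄⟩ := hC.intertwines.formU_conn (η := η) ψ (hV.U_eq η ψ)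
  rw [h₃, h₄, ← hV.U_eq]
  rfl

end Similarity

/-! ## Mutually inverse correspondences -/

section Inverse

variable {T T' : TripleData} {C : CorrData T T'} {C' : CorrData T' T}

/-- The pairing `p : E' × E → A` that identifies `E' ⊗ E` with `A`. -/
def IsPairing (C' : CorrData T' T) (C : CorrData T T')
    (p : C'.X.E →ₗ[ℂ] C.X.E →ₗ[ℂ] T.A) : Prop :=
  ∀ η' η ψ, T.rep (p η' η) ψ = C'.U (hmul T' C'.X η' (C.U (hmul T C.X η ψ)))

/-- As for the other algebraic properties of a pairing, it suffices to compare the represented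
operators, because the representation is faithful; there the identity is a property of `U` and `U'`.
-/
theorem IsPairing.map_lact {p : C'.X.E →ₗ[ℂ] C.X.E →ₗ[ℂ] T.A} (hp : IsPairing C' C p)
    (hT : IsSpectralTriple T) (h' : IsCorrespondence C') (a : T.A) (η' : C'.X.E) (η : C.X.E) :
    p (C'.X.lact a η') η = a * p η' η := hT.faithful <| by
  ext ψ
  rw [hp, h'.U_lact, map_mul, mul_apply_eq_comp, hp]

theorem IsPairing.map_ract {p : C'.X.E →ₗ[ℂ] C.X.E →ₗ[ℂ] T.A} (hp : IsPairing C' C p)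
    (hT : IsSpectralTriple T) (η' : C'.X.E) (η : C.X.E) (a : T.A) :
    p η' (C.X.ract η a) = p η' η * a := hT.faithful <| by
  ext ψ
  rw [hp, hmul_ract, map_mul, mul_apply_eq_comp, hp]

theorem IsPairing.balanced {p : C'.X.E →ₗ[ℂ] C.X.E →ₗ[ℂ] T.A} (hp : IsPairing C' C p)
    (hT : IsSpectralTriple T) (h : IsCorrespondence C) (η' : C'.X.E) (b : T'.A) (η : C.X.E) :
    p (C'.X.ract η' b) η = p η' (C.X.lact b η) := hT.faithful <| by
  ext ψ
  rw [hp, hp, hmul_ract, h.U_lact]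

theorem IsPairing.rinner {p : C'.X.E →ₗ[ℂ] C.X.E →ₗ[ℂ] T.A} (hp : IsPairing C' C p)
    (hT : IsSpectralTriple T) (h : IsCorrespondence C) (h' : IsCorrespondence C')
    (η₁' : C'.X.E) (η₁ : C.X.E) (η₂' : C'.X.E) (η₂ : C.X.E) :
    star (p η₁' η₁) * p η₂' η₂ = C.X.rinner η₁ (C.X.lact (C'.X.rinner η₁' η₂') η₂) :=
  hT.faithful <| by
    ext φ
    refine ext_inner_left ℂ fun ψ => ?_
    rw [← inner_rep_rep, hp, hp, h'.isometric, ← h.U_lact, h.isometric]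

/-- The isomorphism `E' ⊗ E → A` induced by a pairing. -/
def IsPairing.lift {p : C'.X.E →ₗ[ℂ] C.X.E →ₗ[ℂ] T.A} (hp : IsPairing C' C p)
    (hT : IsSpectralTriple T) (h : IsCorrespondence C) :
    Tensor C'.X C.X →ₗ[ℂ] (selfBimodule T.A).E :=
  btLift (P := T.A) _ _ p (by
    rintro η' b _ η _ rfl rfl
    exact hp.balanced hT h η' b η)

/-- The right inner product is preserved because `U` and `U'` are isometric. The left one is forced
by the right one and the relations `η(ξ, ζ)_A = (η, ξ)_B ζ` in both bimodules. -/
theorem IsPairing.isCompletedTensor {p : C'.X.E →ₗ[ℂ] C.X.E →ₗ[ℂ] T.A} (hp : IsPairing C' C p)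
    (hT : IsSpectralTriple T) (h : IsCorrespondence C) (h' : IsCorrespondence C')
    (hd : (Submodule.span ℂ {x | ∃ η' η, x = p η' η}).topologicalClosure = ⊤) :
    IsCompletedTensor C'.X C.X (selfBimodule T.A) (hp.lift hT h) where
  map_lact a η' η := hp.map_lact hT h' a η' η
  map_ract η' η a := hp.map_ract hT η' η a
  rinner η₁' η₁ η₂' η₂ := hp.rinner hT h h' η₁' η₁ η₂' η₂
  linner η₁' η₁ η₂' η₂ := by
    -- Two elements of `A` agree if they have the same products with all values of `p`. On such a
    -- value the right inner product can be moved through both bimodules by compatibility.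
    refine eq_of_mul_dense hd ?_
    rintro _ ⟨η₃', η₃, rfl⟩
    change p η₁' η₁ * star (p η₂' η₂) * p η₃' η₃ = _
    rw [mul_assoc, hp.rinner hT h h', ← hp.map_ract hT, h.morita.compatible, ← hp.map_lact hT h',
      ← h'.morita.compatible, hp.balanced hT h, hp.balanced hT h]
  dense (a : T.A) ε hε := by
    rw [← Submodule.dense_iff_topologicalClosure_eq_top] at hd
    obtain ⟨b, hb, hab⟩ := Metric.mem_closure_iff.1 (hd a) ε hε
    let j : Tensor C'.X C.X →ₗ[ℂ] T.A := hp.lift hT h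
    have hb' : b ∈ LinearMap.range j := by
      refine Submodule.span_le.2 ?_ hb
      rintro _ ⟨η', η, rfl⟩
      exact ⟨tmul C'.X C.X η' η, rfl⟩
    obtain ⟨t, rfl⟩ := hb'
    refine ⟨t, ?_⟩
    change √‖star (a - j t) * (a - j t)‖ < ε
    rw [CStarRing.norm_star_mul_self, Real.sqrt_mul_self (norm_nonneg _), ← dist_eq_norm]
    exact hab

/-- The image in `A` of the product of the domains of two connections. -/
def pairDom (C' : CorrData T' T) (C : CorrData T T') (p : C'.X.E →ₗ[ℂ] C.X.E →ₗ[ℂ] T.A) :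
    Submodule ℂ T.A :=
  Submodule.span ℂ {x | ∃ η' ∈ C'.dom, ∃ η ∈ C.dom, x = p η' η}

/-- The identity correspondence restricted to `pairDom` is a representative of the composition, its
connection being correct by `isComposition_of_completedTensor`. An arbitrary representative has only
its bimodule and unitary prescribed up to the map `j`, and these already yield the similarity. -/
theorem composesToId_of_pairing {p : C'.X.E →ₗ[ℂ] C.X.E →ₗ[ℂ] T.A} (hp : IsPairing C' C p)
    (hT : IsSpectralTriple T) (hId : IdConnIsCommutator T)
    (h : IsCorrespondence C) (h' : IsCorrespondence C') (hF : FormsFaithful C)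
    (hd : Dense (pairDom C' C p : Set T.A))
    (hs : pairDom C' C p ≤ T.smooth.toNonUnitalSubalgebra.toSubmodule)
    (h'' : IsCorrespondence (idCorrOn T (pairDom C' C p)))
    (hF'' : FormsFaithful (idCorrOn T (pairDom C' C p))) :
    ComposesToId C' C := by
  have hd' : (Submodule.span ℂ {x | ∃ η' η, x = p η' η}).topologicalClosure = ⊤ := by
    refine top_le_iff.1 ?_
    rw [← Submodule.dense_iff_topologicalClosure_eq_top.1 hd]
    refine Submodule.topologicalClosure_mono (Submodule.span_mono ?_)
    rintro _ ⟨η', _, η, _, rfl⟩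
    exact ⟨η', η, rfl⟩
  refine ⟨⟨_, h'', isComposition_of_completedTensor hT h h' h'' hF hF'' (hp.lift hT h)
    (hp.isCompletedTensor hT h h' hd') rfl hp⟩, ?_⟩
  rintro C'' hC ⟨j, hj, hdom, hU, -⟩
  have hsp : ∀ t, j t ∈ Submodule.span ℂ {y | ∃ η' η, y = j (tmul C'.X C.X η' η)} := by
    intro t
    induction t using BalancedTensor.induction with
    | zero => simp
    | add s t hs ht => rw [map_add]; exact add_mem hs ht
    | mul η' η => exact Submodule.subset_span ⟨η', η, rfl⟩
  have hjp : ∀ y ∈ {y | ∃ η' η, y = j (tmul C'.X C.X η' η)},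
      ∃ a, (∃ η' η, a = p η' η ∧ y = j (tmul C'.X C.X η' η)) ∧
        ∀ ψ, T.rep a ψ = C''.U (hmul T C''.X y ψ) := by
    rintro _ ⟨η', η, rfl⟩
    exact ⟨p η' η, ⟨η', η, rfl, rfl⟩, fun ψ => by rw [hp, hU]⟩
  classical
  -- On an elementary tensor `j(η' ⊗ η)` the unitary acts as `p(η', η)`, so `q` is its prescribed
  -- image in `A`. The values of `q` off the elementary tensors are arbitrary and play no role.
  choose! q hq using hjp
  obtain ⟨V, hV⟩ := exists_similarity hT hC (S := {y | ∃ η' η, y = j (tmul C'.X C.X η' η)})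
    (fun y ε hε => by
      obtain ⟨t, ht⟩ := hj.dense y ε hε
      exact ⟨j t, hsp t, ht⟩) q (fun y hy => (hq y hy).2) (by
      refine top_le_iff.1 ?_
      rw [← hd']
      refine Submodule.topologicalClosure_mono (Submodule.span_mono ?_)
      rintro _ ⟨η', η, rfl⟩
      refine ⟨j (tmul C'.X C.X η' η), ⟨η', η, rfl⟩, hT.faithful ?_⟩
      ext ψ
      rw [(hq _ ⟨η', η, rfl⟩).2, hU, hp])
  have hVs := isSimilarity_of_rep hT hC V hV
  refine ⟨V, hVs, intertwinesConn_idCorr hT hId hC hVs fun y hy => ?_⟩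
  have hVj : ∀ η' η, V (j (tmul C'.X C.X η' η)) = p η' η := fun η' η => hT.faithful <| by
    ext ψ
    rw [hV, hU, hp]
  have hle : C''.dom ≤ (pairDom C' C p).comap V.toLinearMap := by
    rw [hdom]
    refine Submodule.span_le.2 ?_
    rintro _ ⟨η', hη', η, hη, rfl⟩
    exact Submodule.subset_span ⟨η', hη', η, hη, hVj η' η⟩
  exact hs (hle hy)

end Inverse

end MoritaCat

end

noncomputable section

namespace MoritaCat

open BimoduleData

/-! ## Positivity in `C*`-algebras -/

section Positivity

variable {A : Type} [NonUnitalCStarAlgebra A]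

/-- The order is introduced locally, from the spectrum, to make sums and conjugates of positive
elements available. -/
theorem isPos_iff_nonneg (x : A) :
    letI := CStarAlgebra.spectralOrder A
    IsPos x ↔ 0 ≤ x := by
  let _ := CStarAlgebra.spectralOrder A
  let _ := CStarAlgebra.spectralOrderedRing A
  exact CStarAlgebra.nonneg_iff_eq_star_mul_self.symm

theorem isPos_star_mul_self (c : A) : IsPos (star c * c) := ⟨c, rfl⟩

theorem isPos_mul_star_self (c : A) : IsPos (c * star c) := ⟨star c, by rw [star_star]⟩

theorem isPos_sum {ι : Type} (s : Finset ι) (f : ι → A) (h : ∀ i ∈ s, IsPos (f i)) :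
    IsPos (∑ i ∈ s, f i) := by
  let _ := CStarAlgebra.spectralOrder A
  let _ := CStarAlgebra.spectralOrderedRing A
  exact (isPos_iff_nonneg _).2 (Finset.sum_nonneg fun i hi => (isPos_iff_nonneg _).1 (h i hi))

/-- Formally this element is `a*(‖b‖² - b*b)a`; the conjugate form makes sense without a unit. -/
theorem isPos_norm_sq_smul_sub (a b : A) :
    IsPos (((‖b‖ ^ 2 : ℝ) : ℂ) • (star a * a) - star (b * a) * (b * a)) := by
  let _ := CStarAlgebra.spectralOrder A
  let _ := CStarAlgebra.spectralOrderedRing A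
  refine (isPos_iff_nonneg _).2 (sub_nonneg.2 ?_)
  have h := CStarAlgebra.star_left_conjugate_le_norm_smul (a := a) (b := star b * b)
    (IsSelfAdjoint.star_mul_self b)
  rw [CStarRing.norm_star_mul_self, ← pow_two] at h
  rw [Complex.coe_smul]
  simpa only [star_mul, mul_assoc] using h

/-- The previous inequality with `a = 1`. The element `d` turns the boundedness inequalities of a
bimodule into identities `‖b‖²(η, η) - (bη, bη) = (dη, dη)`. -/
theorem exists_norm_sq_sub_eq {A : Type} [CStarAlgebra A] (b : A) :
    ∃ d : A, algebraMap ℂ A ((‖b‖ ^ 2 : ℝ) : ℂ) - star b * b = star d * d := by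
  have h := isPos_norm_sq_smul_sub 1 b
  obtain ⟨d, hd⟩ := h
  refine ⟨d, ?_⟩
  rw [← hd, Algebra.algebraMap_eq_smul_one]
  simp

end Positivity

/-! ## Morita equivalence bimodules -/

section Morita

variable {A B : Type} [NonUnitalCStarAlgebra A] [NonUnitalCStarAlgebra B]

theorem selfBimodule_rnorm (a : A) : (selfBimodule A).rnorm a = ‖a‖ := by
  change √‖star a * a‖ = ‖a‖
  rw [CStarRing.norm_star_mul_self, Real.sqrt_mul_self (norm_nonneg _)]

theorem selfBimodule_lnorm (a : A) : (selfBimodule A).lnorm a = ‖a‖ := by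
  change √‖a * star a‖ = ‖a‖
  rw [CStarRing.norm_self_mul_star, Real.sqrt_mul_self (norm_nonneg _)]

theorem exists_limit_of_cauchy {E : Type} [NormedAddCommGroup E] [CompleteSpace E] (u : ℕ → E)
    (h : ∀ ε > 0, ∃ N, ∀ p ≥ N, ∀ q ≥ N, ‖u p - u q‖ < ε) :
    ∃ x, ∀ ε > 0, ∃ N, ∀ p ≥ N, ‖u p - x‖ < ε := by
  obtain ⟨x, hx⟩ := cauchySeq_tendsto_of_complete (Metric.cauchySeq_iff.2 fun ε hε => by
    obtain ⟨N, hN⟩ := h ε hε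
    exact ⟨N, fun p hp q hq => (dist_eq_norm _ _).trans_lt (hN p hp q hq)⟩)
  refine ⟨x, fun ε hε => ?_⟩
  obtain ⟨N, hN⟩ := Metric.tendsto_atTop.1 hx ε hε
  exact ⟨N, fun p hp => (dist_eq_norm _ _).symm.trans_lt (hN p hp)⟩

/-- An approximate unit `x` gives `ax → a` along products, which makes a non-unital algebra full
over itself. -/
theorem span_mul_dense {S : Set A} (hS : ∀ a b, a * b ∈ S) :
    (Submodule.span ℂ S).topologicalClosure = ⊤ := by
  let _ := CStarAlgebra.spectralOrder A
  let _ := CStarAlgebra.spectralOrderedRing A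
  refine top_le_iff.1 fun a _ => ?_
  have h := (CStarAlgebra.increasingApproximateUnit A).tendsto_mul_right a
  refine mem_closure_of_tendsto h (Filter.Eventually.of_forall fun x => ?_)
  exact Submodule.subset_span (hS _ _)

theorem selfBimodule_isMorita (A : Type) [NonUnitalCStarAlgebra A] :
    (selfBimodule A).IsMorita where
  ract_mul (η a b : A) := (mul_assoc η a b).symm
  lact_mul (a b η : A) := mul_assoc a b η
  lact_ract (b η a : A) := (mul_assoc b η a).symm
  rinner_add (η ξ ζ : A) := mul_add (star η) ξ ζ
  rinner_smul (η : A) c (ξ : A) := mul_smul_comm c (star η) ξ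
  rinner_star (η ξ : A) := by
    change star (star η * ξ) = star ξ * η
    rw [star_mul, star_star]
  rinner_ract (η a ξ b : A) := by
    change star (η * a) * (ξ * b) = star a * (star η * ξ) * b
    simp only [star_mul, mul_assoc]
  rinner_pos (η : A) := isPos_star_mul_self η
  rinner_definite (η : A) h := (CStarRing.star_mul_self_eq_zero_iff η).1 h
  linner_add (η ξ ζ : A) := add_mul η ξ (star ζ)
  linner_smul c (η ξ : A) := smul_mul_assoc c η (star ξ)
  linner_star (η ξ : A) := by
    change star (η * star ξ) = ξ * star η
    rw [star_mul, star_star]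
  linner_lact (a η b ξ : A) := by
    change a * η * star (b * ξ) = a * (η * star ξ) * star b
    simp only [star_mul, mul_assoc]
  linner_pos (η : A) := isPos_mul_star_self η
  linner_definite (η : A) h := (CStarRing.mul_star_self_eq_zero_iff η).1 h
  rcomplete (u : ℕ → A) h := by
    obtain ⟨x, hx⟩ := exists_limit_of_cauchy u fun ε hε => (h ε hε).imp fun N hN p hp q hq =>
      (selfBimodule_rnorm (u p - u q)).symm.trans_lt (hN p hp q hq)
    exact ⟨x, fun ε hε => (hx ε hε).imp fun N hN p hp =>
      (selfBimodule_rnorm (u p - x)).trans_lt (hN p hp)⟩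
  lcomplete (u : ℕ → A) h := by
    obtain ⟨x, hx⟩ := exists_limit_of_cauchy u fun ε hε => (h ε hε).imp fun N hN p hp q hq =>
      (selfBimodule_lnorm (u p - u q)).symm.trans_lt (hN p hp q hq)
    exact ⟨x, fun ε hε => (hx ε hε).imp fun N hN p hp =>
      (selfBimodule_lnorm (u p - x)).trans_lt (hN p hp)⟩
  compatible (η ξ ζ : A) := (mul_assoc η (star ξ) ζ).symm
  rfull := span_mul_dense fun a b => ⟨(star a : A), (b : A),
    show a * b = star (star a) * b by rw [star_star]⟩
  lfull := span_mul_dense fun a b => ⟨(a : A), (star b : A),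
    show a * b = a * star (star b) by rw [star_star]⟩
  linner_ract_le (η a : A) := by
    -- The inequality for the left inner product is that for the right one applied to the adjoints.
    have h := isPos_norm_sq_smul_sub (star η) (star a)
    have e : star (star a * star η) = η * a := by simp
    rw [e, star_star, norm_star, ← star_mul] at h
    exact h
  rinner_lact_le (b η : A) := isPos_norm_sq_smul_sub η b

/-- The conjugate of a Morita equivalence bimodule is a Morita equivalence bimodule. -/
theorem BimoduleData.IsMorita.conjugate {X : BimoduleData B A} (hX : X.IsMorita)
    {Y : BimoduleData A B} (s : Y.E ≃ X.E) (s_add : ∀ η ξ, s (η + ξ) = s η + s ξ)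
    (s_smul : ∀ (c : ℂ) η, s (c • η) = star c • s η)
    (s_ract : ∀ η b, s (Y.ract η b) = X.lact (star b) (s η))
    (s_lact : ∀ a η, s (Y.lact a η) = X.ract (s η) (star a))
    (rinner_eq : ∀ η ξ, Y.rinner η ξ = X.linner (s η) (s ξ))
    (linner_eq : ∀ η ξ, Y.linner η ξ = X.rinner (s η) (s ξ)) : Y.IsMorita := by
  have s_zero : s 0 = 0 := by simpa using s_add 0 0
  have s_sub : ∀ η ξ, s (η - ξ) = s η - s ξ := fun η ξ => by
    rw [eq_sub_iff_add_eq, ← s_add, sub_add_cancel]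
  have hr : ∀ η, Y.rnorm η = X.lnorm (s η) := fun η => by rw [rnorm, lnorm, rinner_eq]
  have hl : ∀ η, Y.lnorm η = X.rnorm (s η) := fun η => by rw [rnorm, lnorm, linner_eq]
  constructor
  case ract_mul => exact fun η a b => s.injective <| by simp [s_ract, hX.lact_mul]
  case lact_mul => exact fun a b η => s.injective <| by simp [s_lact, hX.ract_mul]
  case lact_ract => exact fun b η a => s.injective <| by simp [s_lact, s_ract, hX.lact_ract]
  case rinner_add =>
    intro η ξ ζ
    rw [rinner_eq, rinner_eq, rinner_eq, s_add, ← hX.linner_star, hX.linner_add, star_add,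
      hX.linner_star, hX.linner_star]
  case rinner_smul =>
    intro η c ξ
    rw [rinner_eq, rinner_eq, s_smul, ← hX.linner_star, hX.linner_smul, star_smul,
      hX.linner_star, star_star]
  case rinner_star => exact fun η ξ => by rw [rinner_eq, rinner_eq, hX.linner_star]
  case rinner_ract =>
    intro η a ξ b
    rw [rinner_eq, rinner_eq, s_ract, s_ract, hX.linner_lact, star_star]
  case rinner_pos => exact fun η => by rw [rinner_eq]; exact hX.linner_pos _
  case rinner_definite =>
    intro η h
    rw [rinner_eq] at h
    exact s.injective ((hX.linner_definite _ h).trans s_zero.symm)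
  case linner_add =>
    intro η ξ ζ
    rw [linner_eq, linner_eq, linner_eq, s_add, ← hX.rinner_star, hX.rinner_add, star_add,
      hX.rinner_star, hX.rinner_star]
  case linner_smul =>
    intro c η ξ
    rw [linner_eq, linner_eq, s_smul, ← hX.rinner_star, hX.rinner_smul, star_smul,
      hX.rinner_star, star_star]
  case linner_star => exact fun η ξ => by rw [linner_eq, linner_eq, hX.rinner_star]
  case linner_lact =>
    intro a η b ξ
    rw [linner_eq, linner_eq, s_lact, s_lact, hX.rinner_ract, star_star]
  case linner_pos => exact fun η => by rw [linner_eq]; exact hX.rinner_pos _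
  case linner_definite =>
    intro η h
    rw [linner_eq] at h
    exact s.injective ((hX.rinner_definite _ h).trans s_zero.symm)
  case rcomplete =>
    intro u h
    simp only [hr, s_sub] at h ⊢
    obtain ⟨x, hx⟩ := hX.lcomplete (fun p => s (u p)) h
    exact ⟨s.symm x, by simpa using hx⟩
  case lcomplete =>
    intro u h
    simp only [hl, s_sub] at h ⊢
    obtain ⟨x, hx⟩ := hX.rcomplete (fun p => s (u p)) h
    exact ⟨s.symm x, by simpa using hx⟩
  case compatible =>
    intro η ξ ζ
    refine s.injective ?_
    rw [s_ract, s_lact, rinner_eq, linner_eq, hX.linner_star, hX.rinner_star, hX.compatible]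
  case rfull =>
    rw [← hX.lfull]
    congr 2
    ext x
    simp only [Set.mem_ofPred_eq, rinner_eq]
    exact ⟨fun ⟨η, ξ, h⟩ => ⟨_, _, h⟩, fun ⟨η, ξ, h⟩ => ⟨s.symm η, s.symm ξ, by simpa using h⟩⟩
  case lfull =>
    rw [← hX.rfull]
    congr 2
    ext x
    simp only [Set.mem_ofPred_eq, linner_eq]
    exact ⟨fun ⟨η, ξ, h⟩ => ⟨_, _, h⟩, fun ⟨η, ξ, h⟩ => ⟨s.symm η, s.symm ξ, by simpa using h⟩⟩
  case linner_ract_le =>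
    intro η a
    rw [linner_eq, linner_eq, s_ract, ← norm_star a]
    exact hX.rinner_lact_le _ _
  case rinner_lact_le =>
    intro b η
    rw [rinner_eq, rinner_eq, s_lact, ← norm_star b]
    exact hX.linner_ract_le _ _

end Morita

end MoritaCat

end

noncomputable section

namespace MoritaCat

open BimoduleData

/-! ## The Hilbert space `ℓ²(ℕ)` -/

section SequenceSpace

/-- The basis vector `|k⟩`. -/
def ket (k : ℕ) : L2 := lp.single 2 k 1

theorem ket_apply (k j : ℕ) : ket k j = if j = k then 1 else 0 := by
  change (Pi.single k (1 : ℂ) : ℕ → ℂ) j = _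
  rw [Pi.single_apply]

@[simp] theorem inner_ket_left (k : ℕ) (v : L2) : ⟪ket k, v⟫_ℂ = v k := by
  rw [ket, lp.inner_single_left]
  simp

@[simp] theorem inner_ket_right (k : ℕ) (v : L2) : ⟪v, ket k⟫_ℂ = star (v k) := by
  rw [ket, lp.inner_single_right]
  simp

@[simp] theorem norm_ket (k : ℕ) : ‖ket k‖ = 1 := by
  rw [ket, lp.norm_single (by norm_num)]
  simp

@[simp] theorem star_ket (k : ℕ) : star (ket k) = ket k := by
  ext j
  rw [lp.star_apply, ket_apply]
  split_ifs <;> simp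

theorem hasSum_ket (v : L2) : HasSum (fun k => v k • ket k) v := by
  refine (lp.hasSum_single (by norm_num) v).congr_fun ?_
  intro k
  rw [ket, ← lp.single_smul]
  simp

theorem dense_span_ket : (Submodule.span ℂ (Set.range ket)).topologicalClosure = ⊤ := by
  refine top_le_iff.1 fun v _ => ?_
  exact mem_closure_of_tendsto (hasSum_ket v) (Filter.Eventually.of_forall fun s =>
    sum_mem fun k _ => Submodule.smul_mem _ _ (Submodule.subset_span ⟨k, rfl⟩))

theorem ext_ket {F : Type} [NormedAddCommGroup F] [NormedSpace ℂ F] {S T : L2 →L[ℂ] F}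
    (h : ∀ k, S (ket k) = T (ket k)) : S = T := by
  ext v
  have h₁ := (hasSum_ket v).mapL S
  have h₂ := (hasSum_ket v).mapL T
  simp only [map_smul, h] at h₁ h₂
  exact h₁.unique h₂

theorem hasSum_coord (T : L2 →L[ℂ] L2) (v : L2) (j : ℕ) :
    HasSum (fun k => T (ket k) j * v k) (T v j) := by
  have h := ((hasSum_ket v).mapL T).mapL (innerSL ℂ (ket j))
  simpa [mul_comm] using h

theorem hasSum_inner_coord (v w : L2) : HasSum (fun k => star (v k) * w k) ⟪v, w⟫_ℂ := by
  have h := lp.hasSum_inner (𝕜 := ℂ) v w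
  simpa [mul_comm] using h

/-- The `n`-th partial sum `∑_{k < n} v_k |k⟩`. -/
theorem norm_sub_partial_le (v : L2) (n : ℕ) :
    ‖v - ∑ k ∈ Finset.range n, v k • ket k‖ ≤ ‖v‖ := by
  refine lp.norm_mono (by norm_num) fun j => ?_
  have h : (v - ∑ k ∈ Finset.range n, v k • ket k : L2) j =
      v j - ∑ k ∈ Finset.range n, v k * ket k j := by
    rw [lp.coeFn_sub, Pi.sub_apply, lp.coeFn_sum, Finset.sum_apply]
    rfl
  rw [h]
  simp only [ket_apply, mul_ite, mul_one, mul_zero]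
  rw [Finset.sum_ite_eq]
  split_ifs <;> simp

end SequenceSpace

/-! ## Compact operators -/

section Compacts

@[simp] theorem ketBra_coe (η ξ : L2) :
    (ketBra η ξ : L2 →L[ℂ] L2) = InnerProductSpace.rankOne ℂ η ξ := rfl

theorem ketBra_apply (η ξ v : L2) : (ketBra η ξ : L2 →L[ℂ] L2) v = ⟪ξ, v⟫_ℂ • η := rfl

theorem ketBra_add_left (η η' ξ : L2) : ketBra (η + η') ξ = ketBra η ξ + ketBra η' ξ :=
  Subtype.ext (by simp)

theorem ketBra_smul_left (c : ℂ) (η ξ : L2) : ketBra (c • η) ξ = c • ketBra η ξ :=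
  Subtype.ext (by simp)

theorem ketBra_add_right (η ξ ξ' : L2) : ketBra η (ξ + ξ') = ketBra η ξ + ketBra η ξ' :=
  Subtype.ext (by simp)

theorem ketBra_smul_right (c : ℂ) (η ξ : L2) : ketBra η (c • ξ) = star c • ketBra η ξ :=
  Subtype.ext (by simp)

theorem star_ketBra (η ξ : L2) : star (ketBra η ξ) = ketBra ξ η :=
  Subtype.ext (by
    change ContinuousLinearMap.adjoint _ = _
    simp [InnerProductSpace.adjoint_rankOne])

theorem mul_ketBra (T : compacts) (η ξ : L2) :
    T * ketBra η ξ = ketBra ((T : L2 →L[ℂ] L2) η) ξ :=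
  Subtype.ext (by
    ext v
    simp)

theorem ketBra_mul (T : compacts) (η ξ : L2) :
    ketBra η ξ * T = ketBra η ((star T : compacts) |>.1 ξ) := by
  rw [← star_star (ketBra η ξ * T), star_mul, star_ketBra, mul_ketBra, star_ketBra]

theorem continuous_ketBra_right (η : L2) : Continuous fun ξ => ketBra η ξ :=
  Continuous.subtype_mk (InnerProductSpace.rankOne ℂ η).continuous _

theorem ketBra_mem_closure (j : ℕ) (ξ : L2) :
    ketBra (ket j) ξ ∈
      closure (Submodule.span ℂ {x | ∃ j k, x = ketBra (ket j) (ket k)} : Set compacts) := by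
  have h := ((continuous_ketBra_right (ket j)).tendsto ξ).comp (hasSum_ket ξ)
  refine mem_closure_of_tendsto h (Filter.Eventually.of_forall fun s => ?_)
  change ketBra (ket j) (∑ k ∈ s, ξ k • ket k) ∈ Submodule.span ℂ _
  induction s using Finset.induction_on with
  | empty =>
    rw [Finset.sum_empty, show ketBra (ket j) 0 = 0 from Subtype.ext (by simp)]
    exact zero_mem _
  | insert k s hk ih =>
    rw [Finset.sum_insert hk, ketBra_add_right, ketBra_smul_right]
    exact add_mem (Submodule.smul_mem _ _ (Submodule.subset_span ⟨j, k, rfl⟩)) ih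

/-- Here `Z = PT` with `P` the projection onto the first `n` basis vectors. If `y` is a point of the
net near `Tx`, then `(1 - P)Tx = (1 - P)(Tx - y) + (1 - P)y`; the first term is small because `1 -
P` is a contraction, the second by the choice of `n`. -/
theorem norm_sub_le_of_totallyBounded {T Z : L2 →L[ℂ] L2} {t : Set L2} {ε : ℝ} (hε : 0 < ε)
    (ht : T '' Metric.closedBall 0 1 ⊆ ⋃ y ∈ t, Metric.ball y ε) {n : ℕ}
    (hn : ∀ y ∈ t, ‖y - ∑ k ∈ Finset.range n, y k • ket k‖ < ε)
    (hZ : ∀ x, Z x = ∑ k ∈ Finset.range n, (T x) k • ket k) : ‖T - Z‖ ≤ ε + ε := by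
  refine ContinuousLinearMap.opNorm_le_of_unit_norm (by positivity) fun x hx => ?_
  rw [sub_apply, hZ]
  obtain ⟨y, hy, hxy⟩ := Set.mem_iUnion₂.1 (ht ⟨x, by simp [hx], rfl⟩)
  have h₃ : ‖T x - y‖ < ε := by
    rw [← dist_eq_norm]
    exact hxy
  have h₄ : T x - ∑ k ∈ Finset.range n, (T x) k • ket k =
      ((T x - y) - ∑ k ∈ Finset.range n, (T x - y : L2) k • ket k) +
      (y - ∑ k ∈ Finset.range n, y k • ket k) := by
    have : ∀ k, (T x - y : L2) k = (T x) k - y k := fun k => rfl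
    simp only [this, sub_smul, Finset.sum_sub_distrib]
    abel
  rw [h₄]
  refine (norm_add_le _ _).trans (add_le_add ?_ (hn y hy).le)
  exact (norm_sub_partial_le _ _).trans h₃.le

/-- The truncation of `T` to its first `n` rows is `∑_{k<n} |k⟩⟨T*k|`. The vectors `T*k` need not be
finite combinations of the basis, hence the closure. -/
theorem exists_partial (T : compacts) (n : ℕ) :
    ∃ Z ∈ (Submodule.span ℂ {x | ∃ j k, x = ketBra (ket j) (ket k)}).topologicalClosure,
      ∀ x, (Z : L2 →L[ℂ] L2) x = ∑ k ∈ Finset.range n, ((T : L2 →L[ℂ] L2) x) k • ket k := by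
  induction n with
  | zero => exact ⟨0, zero_mem _, fun x => by simp⟩
  | succ n ih =>
    obtain ⟨Z, hZ, h⟩ := ih
    refine ⟨Z + ketBra (ket n) ((star T : compacts).1 (ket n)),
      add_mem hZ (ketBra_mem_closure _ _), fun x => ?_⟩
    rw [Finset.sum_range_succ, ← h, ← inner_ket_left n,
      ← ContinuousLinearMap.adjoint_inner_left]
    rfl

/-- The operators of finite rank are dense in the compact operators. -/
theorem dense_span_ketBra :
    (Submodule.span ℂ {x | ∃ j k, x = ketBra (ket j) (ket k)}).topologicalClosure = ⊤ := by
  refine top_le_iff.1 fun T _ => ?_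
  refine (Submodule.isClosed_topologicalClosure _).closure_subset
    (Metric.mem_closure_iff.2 fun ε hε => ?_)
  have hc := IsCompactOperator.isCompact_closure_image_closedBall
    (f := ((T : L2 →L[ℂ] L2) : L2 →ₗ[ℂ] L2)) T.2 1
  obtain ⟨t, htf, ht⟩ := Metric.totallyBounded_iff.1 hc.totallyBounded (ε / 4) (by positivity)
  have hN : ∀ᶠ n in Filter.atTop, ∀ y ∈ t, ‖y - ∑ k ∈ Finset.range n, y k • ket k‖ < ε / 4 := by
    refine (Filter.eventually_all_finite htf).2 fun y _ => ?_
    have h := (hasSum_ket y).tendsto_sum_nat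
    filter_upwards [Metric.tendsto_nhds.1 h (ε / 4) (by positivity)] with n hn
    rwa [dist_comm, dist_eq_norm] at hn
  obtain ⟨n, hn⟩ := hN.exists
  obtain ⟨Z, hZ, h⟩ := exists_partial T n
  refine ⟨Z, hZ, lt_of_le_of_lt (b := ε / 4 + ε / 4) ?_ (by linarith)⟩
  rw [dist_eq_norm]
  exact norm_sub_le_of_totallyBounded (by positivity) (subset_closure.trans ht) hn h

end Compacts

end MoritaCat

end

noncomputable section

namespace MoritaCat

open BimoduleData

/-! ## Rapid decay -/

section Kernels

/-- Rapid decay of a matrix. -/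
def RapidKernel (m : ℕ → ℕ → ℂ) : Prop :=
  ∀ p : ℕ, ∃ c : ℝ, ∀ j k : ℕ, ((j : ℝ) + 1) ^ p * ((k : ℝ) + 1) ^ p * ‖m j k‖ ≤ c

theorem rapidKernel_of_mem (T : rapid) : RapidKernel fun j k => (T : L2 →L[ℂ] L2) (ket k) j :=
  T.2

theorem RapidKernel.add {m m' : ℕ → ℕ → ℂ} (h : RapidKernel m) (h' : RapidKernel m') :
    RapidKernel fun j k => m j k + m' j k := by
  intro p
  obtain ⟨c, hc⟩ := h p
  obtain ⟨d, hd⟩ := h' p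
  refine ⟨c + d, fun j k => ?_⟩
  calc _ ≤ _ := mul_le_mul_of_nonneg_left (norm_add_le _ _) (by positivity)
    _ ≤ c + d := by rw [mul_add]; exact add_le_add (hc j k) (hd j k)

/-- A matrix is of rapid decay if its entries are dominated, up to a polynomial, by those of a matrix
of rapid decay, possibly at slightly shifted places. -/
theorem RapidKernel.of_le {m m' : ℕ → ℕ → ℂ} (h : RapidKernel m) (f g : ℕ → ℕ)
    (hf : ∀ j, j ≤ 2 * f j + 1) (hg : ∀ k, k ≤ 2 * g k + 1) (C : ℝ) (a : ℕ)
    (hm : ∀ j k, ‖m' j k‖ ≤ C * ((j : ℝ) + 1) ^ a * ((k : ℝ) + 1) ^ a * ‖m (f j) (g k)‖) :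
    RapidKernel m' := by
  intro p
  -- The exponent `p + a` absorbs the polynomial factor. The powers of 2 in the constant come from
  -- `j + 1 ≤ 2(f j + 1)` and `k + 1 ≤ 2(g k + 1)`.
  obtain ⟨c, hc⟩ := h (p + a)
  refine ⟨|C| * (2 ^ (p + a) * 2 ^ (p + a) * c), fun j k => ?_⟩
  have hj : ((j : ℝ) + 1) ≤ 2 * ((f j : ℝ) + 1) := by
    have : ((j : ℕ) : ℝ) ≤ ((2 * f j + 1 : ℕ) : ℝ) := Nat.cast_le.2 (hf j)
    push_cast at this
    linarith
  have hk : ((k : ℝ) + 1) ≤ 2 * ((g k : ℝ) + 1) := by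
    have : ((k : ℕ) : ℝ) ≤ ((2 * g k + 1 : ℕ) : ℝ) := Nat.cast_le.2 (hg k)
    push_cast at this
    linarith
  calc ((j : ℝ) + 1) ^ p * ((k : ℝ) + 1) ^ p * ‖m' j k‖
      ≤ ((j : ℝ) + 1) ^ p * ((k : ℝ) + 1) ^ p *
        (|C| * ((j : ℝ) + 1) ^ a * ((k : ℝ) + 1) ^ a * ‖m (f j) (g k)‖) := by
        refine mul_le_mul_of_nonneg_left ((hm j k).trans ?_) (by positivity)
        gcongr
        exact le_abs_self C
    _ = |C| * (((j : ℝ) + 1) ^ (p + a) * ((k : ℝ) + 1) ^ (p + a) * ‖m (f j) (g k)‖) := by ring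
    _ ≤ |C| * ((2 * ((f j : ℝ) + 1)) ^ (p + a) * (2 * ((g k : ℝ) + 1)) ^ (p + a) *
        ‖m (f j) (g k)‖) := by gcongr
    _ = |C| * (2 ^ (p + a) * 2 ^ (p + a) *
        (((f j : ℝ) + 1) ^ (p + a) * ((g k : ℝ) + 1) ^ (p + a) * ‖m (f j) (g k)‖)) := by
        rw [mul_pow, mul_pow]; ring
    _ ≤ _ := by gcongr; exact hc _ _

theorem RapidKernel.neg {m : ℕ → ℕ → ℂ} (h : RapidKernel m) : RapidKernel fun j k => -m j k :=
  h.of_le id id (fun j => by simp; omega) (fun j => by simp; omega) 1 0 fun j k => by simp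

theorem RapidKernel.sub {m m' : ℕ → ℕ → ℂ} (h : RapidKernel m) (h' : RapidKernel m') :
    RapidKernel fun j k => m j k - m' j k := by
  simpa only [sub_eq_add_neg] using h.add h'.neg

/-- The square roots of the entries of a matrix of rapid decay are of rapid decay. -/
theorem RapidKernel.sqrt {m m' : ℕ → ℕ → ℂ} (h : RapidKernel m)
    (hm : ∀ j k, ‖m' j k‖ ≤ √‖m j k‖) : RapidKernel m' := by
  intro p
  obtain ⟨c, hc⟩ := h (2 * p)
  refine ⟨√c, fun j k => ?_⟩
  refine (mul_le_mul_of_nonneg_left (hm j k) (by positivity)).trans ?_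
  refine Real.le_sqrt_of_sq_le ?_
  rw [mul_pow, Real.sq_sqrt (norm_nonneg _), mul_pow, ← pow_mul, ← pow_mul, mul_comm p]
  exact hc j k

theorem RapidKernel.transpose {m : ℕ → ℕ → ℂ} (h : RapidKernel m) :
    RapidKernel fun j k => m k j := by
  intro p
  obtain ⟨c, hc⟩ := h p
  exact ⟨c, fun j k => by rw [mul_comm (((j : ℝ) + 1) ^ p)]; exact hc k j⟩

/-! ### Stability of rapid decay under `𝔞` and `𝔞†`. -/

theorem sqrt_le_add_one (k : ℕ) : √((k : ℝ) + 1) ≤ (k : ℝ) + 1 :=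
  Real.sqrt_le_iff.2 ⟨by positivity, by nlinarith [k.cast_nonneg (α := ℝ)]⟩

@[simp] theorem annSeq_apply (v : ℕ → ℂ) (k : ℕ) :
    annSeq v k = ((√(k + 1 : ℝ) : ℝ) : ℂ) * v (k + 1) := rfl

@[simp] theorem creSeq_zero (v : ℕ → ℂ) : creSeq v 0 = 0 := by simp [creSeq]

@[simp] theorem creSeq_succ (v : ℕ → ℂ) (k : ℕ) :
    creSeq v (k + 1) = ((√(k + 1 : ℝ) : ℝ) : ℂ) * v k := by simp [creSeq]

theorem norm_annSeq_le (v : ℕ → ℂ) (k : ℕ) : ‖annSeq v k‖ ≤ ((k : ℝ) + 1) * ‖v (k + 1)‖ := by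
  rw [annSeq_apply, norm_mul, Complex.norm_real, Real.norm_of_nonneg (Real.sqrt_nonneg _)]
  exact mul_le_mul_of_nonneg_right (sqrt_le_add_one k) (norm_nonneg _)

theorem norm_creSeq_le (v : ℕ → ℂ) (k : ℕ) : ‖creSeq v k‖ ≤ ((k : ℝ) + 1) * ‖v (k - 1)‖ := by
  rcases k with _ | k
  · simp
  · rw [creSeq_succ, norm_mul, Complex.norm_real, Real.norm_of_nonneg (Real.sqrt_nonneg _)]
    refine mul_le_mul_of_nonneg_right ((sqrt_le_add_one k).trans ?_) (norm_nonneg _)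
    push_cast
    linarith

theorem RapidKernel.ann_left {m : ℕ → ℕ → ℂ} (h : RapidKernel m) :
    RapidKernel fun j k => annSeq (fun i => m i k) j :=
  h.of_le (· + 1) id (fun j => by omega) (fun j => by simp; omega) 1 1 fun j k => by
    refine (norm_annSeq_le _ _).trans ?_
    have : (1 : ℝ) ≤ (k : ℝ) + 1 := by linarith [k.cast_nonneg (α := ℝ)]
    simp only [one_mul, pow_one, id]
    exact mul_le_mul_of_nonneg_right (le_mul_of_one_le_right (by positivity) this) (norm_nonneg _)

theorem RapidKernel.cre_left {m : ℕ → ℕ → ℂ} (h : RapidKernel m) :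
    RapidKernel fun j k => creSeq (fun i => m i k) j :=
  h.of_le (· - 1) id (fun j => by omega) (fun j => by simp; omega) 1 1 fun j k => by
    refine (norm_creSeq_le _ _).trans ?_
    have : (1 : ℝ) ≤ (k : ℝ) + 1 := by linarith [k.cast_nonneg (α := ℝ)]
    simp only [one_mul, pow_one, id]
    exact mul_le_mul_of_nonneg_right (le_mul_of_one_le_right (by positivity) this) (norm_nonneg _)

theorem RapidKernel.ann_right {m : ℕ → ℕ → ℂ} (h : RapidKernel m) :
    RapidKernel fun j k => annSeq (m j) k := h.transpose.ann_left.transpose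

theorem RapidKernel.cre_right {m : ℕ → ℕ → ℂ} (h : RapidKernel m) :
    RapidKernel fun j k => creSeq (m j) k := h.transpose.cre_left.transpose

theorem RapidKernel.prod {v w : ℕ → ℂ} (hv : RapidSeq v) (hw : RapidSeq w) :
    RapidKernel fun j k => v j * w k := by
  intro p
  obtain ⟨c, hc⟩ := hv p
  obtain ⟨d, hd⟩ := hw p
  refine ⟨c * d, fun j k => ?_⟩
  calc _ = (((j : ℝ) + 1) ^ p * ‖v j‖) * (((k : ℝ) + 1) ^ p * ‖w k‖) := by
        rw [norm_mul]; ring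
    _ ≤ c * d := mul_le_mul (hc j) (hd k) (by positivity) (le_trans (by positivity) (hc 0))

/-- Diagonal matrices with rapidly decreasing entries. -/
theorem RapidKernel.diag {v : ℕ → ℂ} (hv : RapidSeq v) :
    RapidKernel fun j k => if j = k then v k else 0 := by
  intro p
  obtain ⟨c, hc⟩ := hv (p + p)
  refine ⟨c, fun j k => ?_⟩
  beta_reduce
  rcases eq_or_ne j k with rfl | h
  · rw [if_pos rfl, ← pow_add]
    exact hc j
  · rw [if_neg h, norm_zero, mul_zero]
    exact le_trans (by positivity) (hc 0)

theorem RapidSeq.sqrt {v w : ℕ → ℂ} (h : RapidSeq v) (hw : ∀ k, ‖w k‖ ≤ √‖v k‖) :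
    RapidSeq w := by
  intro p
  obtain ⟨c, hc⟩ := h (2 * p)
  refine ⟨√c, fun k => (mul_le_mul_of_nonneg_left (hw k) (by positivity)).trans ?_⟩
  refine Real.le_sqrt_of_sq_le ?_
  rw [mul_pow, Real.sq_sqrt (norm_nonneg _), ← pow_mul, mul_comm p]
  exact hc k

theorem rapidSeq_ann {v : ℕ → ℂ} (h : RapidSeq v) : RapidSeq (annSeq v) := by
  intro p
  obtain ⟨c, hc⟩ := h (p + 1)
  refine ⟨c, fun k => le_trans ?_ (hc (k + 1))⟩
  calc _ ≤ ((k : ℝ) + 1) ^ p * (((k : ℝ) + 1) * ‖v (k + 1)‖) :=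
        mul_le_mul_of_nonneg_left (norm_annSeq_le v k) (by positivity)
    _ = ((k : ℝ) + 1) ^ (p + 1) * ‖v (k + 1)‖ := by ring
    _ ≤ _ := by gcongr; linarith

theorem rapidSeq_cre {v : ℕ → ℂ} (h : RapidSeq v) : RapidSeq (creSeq v) := by
  intro p
  obtain ⟨c, hc⟩ := h (p + 1)
  have hc0 : 0 ≤ c := le_trans (by positivity) (hc 0)
  -- The shift of the index costs `k + 2 ≤ 2(k + 1)`, raised to the power `p + 1`.
  refine ⟨2 ^ (p + 1) * c, fun k => ?_⟩
  rcases k with _ | k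
  · simpa using hc0
  · calc _ ≤ (((k + 1 : ℕ) : ℝ) + 1) ^ p * ((((k + 1 : ℕ) : ℝ) + 1) * ‖v k‖) :=
        mul_le_mul_of_nonneg_left (norm_creSeq_le v (k + 1)) (by positivity)
      _ = (((k + 1 : ℕ) : ℝ) + 1) ^ (p + 1) * ‖v k‖ := by ring
      _ ≤ (2 * ((k : ℝ) + 1)) ^ (p + 1) * ‖v k‖ := by
        gcongr
        push_cast
        linarith [k.cast_nonneg (α := ℝ)]
      _ = 2 ^ (p + 1) * (((k : ℝ) + 1) ^ (p + 1) * ‖v k‖) := by rw [mul_pow]; ring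
      _ ≤ _ := by gcongr; exact hc k

theorem ket_mem_rapidSeq (k : ℕ) : ket k ∈ rapidSeq := by
  intro p
  refine ⟨((k : ℝ) + 1) ^ p, fun j => ?_⟩
  rw [ket_apply]
  split_ifs with h
  · simp [h]
  · simp only [norm_zero, mul_zero]
    positivity

theorem star_mem_rapidSeq {v : L2} (hv : v ∈ rapidSeq) : star v ∈ rapidSeq := by
  intro p
  obtain ⟨c, hc⟩ := hv p
  refine ⟨c, fun k => ?_⟩
  rw [lp.star_apply, norm_star]
  exact hc k

end Kernels

/-! ## Operators with matrices of rapid decay -/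

section Operators

/-- The bound serves twice: the decay in `j` makes each column square summable, and the factor `(k +
1)^{-2}` makes the norms of the columns summable, so the operator is a norm-convergent sum of
rank-one operators. -/
theorem RapidKernel.column_le {m : ℕ → ℕ → ℂ} (h : RapidKernel m) :
    ∃ c : ℝ, ∀ j k : ℕ, ((j : ℝ) + 1) * ‖m j k‖ ≤ c * (((k : ℝ) + 1) ^ 2)⁻¹ := by
  obtain ⟨c, hc⟩ := h 2
  refine ⟨c, fun j k => ?_⟩
  rw [← div_eq_mul_inv, le_div_iff₀ (by positivity)]
  refine le_trans ?_ (hc j k)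
  have : ((j : ℝ) + 1) ≤ ((j : ℝ) + 1) ^ 2 := by nlinarith [j.cast_nonneg (α := ℝ)]
  calc _ = ((j : ℝ) + 1) * ((k : ℝ) + 1) ^ 2 * ‖m j k‖ := by ring
    _ ≤ _ := by gcongr

/-- A column of a matrix of rapid decay. -/
def RapidKernel.col {m : ℕ → ℕ → ℂ} (h : RapidKernel m) (k : ℕ) : L2 :=
  ⟨fun j => m j k, memLp_of_le _ _ fun j => h.column_le.choose_spec j k⟩

theorem RapidKernel.norm_col_le {m : ℕ → ℕ → ℂ} (h : RapidKernel m) :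
    ∃ c : ℝ, ∀ k : ℕ, ‖h.col k‖ ≤ c * (((k : ℝ) + 1) ^ 2)⁻¹ := by
  obtain ⟨c, hc⟩ := h.column_le
  refine ⟨c * ‖invSeq‖, fun k => (norm_le_invSeq (h.col k) _ fun j => hc j k).trans ?_⟩
  rw [mul_right_comm]

theorem RapidKernel.summable {m : ℕ → ℕ → ℂ} (h : RapidKernel m) :
    Summable fun k => ketBra (h.col k) (ket k) := by
  obtain ⟨c, hc⟩ := h.norm_col_le
  have h₁ : Summable fun k : ℕ => c * (((k : ℝ) + 1) ^ 2)⁻¹ := by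
    refine Summable.mul_left c ?_
    have h₂ := (summable_nat_add_iff 1).2 (Real.summable_nat_pow_inv.2 one_lt_two)
    exact_mod_cast h₂
  refine Summable.of_norm_bounded h₁ fun k => ?_
  change ‖InnerProductSpace.rankOne ℂ (h.col k) (ket k)‖ ≤ _
  rw [InnerProductSpace.norm_rankOne, norm_ket, mul_one]
  exact hc k

/-- The compact operator with a given matrix of rapid decay. -/
def ofKernel {m : ℕ → ℕ → ℂ} (h : RapidKernel m) : compacts :=
  ∑' k, ketBra (h.col k) (ket k)

theorem ofKernel_ket {m : ℕ → ℕ → ℂ} (h : RapidKernel m) (k : ℕ) :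
    (ofKernel h : L2 →L[ℂ] L2) (ket k) = h.col k := by
  let ev : compacts →L[ℂ] L2 :=
    { toFun := fun T => (T : L2 →L[ℂ] L2) (ket k)
      map_add' := fun _ _ => rfl
      map_smul' := fun _ _ => rfl
      cont := (ContinuousLinearMap.apply ℂ L2 (ket k)).continuous.comp continuous_subtype_val }
  have h₁ := h.summable.hasSum.mapL ev
  refine h₁.unique ((hasSum_ite_eq k (h.col k)).congr_fun fun i => ?_)
  change (ketBra (h.col i) (ket i) : L2 →L[ℂ] L2) (ket k) = if i = k then h.col k else 0
  rw [ketBra_apply, inner_ket_left, ket_apply]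
  rcases eq_or_ne i k with rfl | hik
  · simp
  · simp [hik]

@[simp] theorem ofKernel_ket_apply {m : ℕ → ℕ → ℂ} (h : RapidKernel m) (j k : ℕ) :
    (ofKernel h : L2 →L[ℂ] L2) (ket k) j = m j k := by
  rw [ofKernel_ket]
  rfl

theorem ofKernel_mem {m : ℕ → ℕ → ℂ} (h : RapidKernel m) : ofKernel h ∈ rapid := by
  change RapidKernel fun j k => (ofKernel h : L2 →L[ℂ] L2) (ket k) j
  simpa only [ofKernel_ket_apply] using h

theorem ext_entries {S T : L2 →L[ℂ] L2} (h : ∀ j k, S (ket k) j = T (ket k) j) : S = T :=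
  ext_ket fun k => lp.ext (funext fun j => h j k)

theorem compacts_ext {S T : compacts}
    (h : ∀ j k, (S : L2 →L[ℂ] L2) (ket k) j = (T : L2 →L[ℂ] L2) (ket k) j) : S = T :=
  Subtype.ext (ext_entries h)

/-- The operators of rapid decay map into the sequences of rapid decay. -/
theorem apply_mem_rapidSeq {T : compacts} (hT : T ∈ rapid) (v : L2) :
    (T : L2 →L[ℂ] L2) v ∈ rapidSeq := by
  intro p
  obtain ⟨c, hc0, hc⟩ := (rapidMatrix_star (T := T) hT).column p
  refine ⟨c * ‖v‖, fun k => ?_⟩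
  have h₁ : ‖(T : L2 →L[ℂ] L2) v k‖ ≤ ‖star (T : L2 →L[ℂ] L2) (ket k)‖ * ‖v‖ := by
    rw [← inner_ket_left, ← ContinuousLinearMap.adjoint_inner_left]
    exact norm_inner_le_norm _ _
  calc _ ≤ ((k : ℝ) + 1) ^ p * (‖star (T : L2 →L[ℂ] L2) (ket k)‖ * ‖v‖) := by gcongr
    _ = (((k : ℝ) + 1) ^ p * ‖star (T : L2 →L[ℂ] L2) (ket k)‖) * ‖v‖ := by ring
    _ ≤ c * ‖v‖ := mul_le_mul_of_nonneg_right (hc k) (norm_nonneg _)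

theorem ketBra_ket_apply (η ξ : L2) (j k : ℕ) :
    (ketBra η ξ : L2 →L[ℂ] L2) (ket k) j = η j * star (ξ k) := by
  rw [ketBra_apply, inner_ket_right, mul_comm]
  rfl

theorem ketBra_mem_rapid {η ξ : L2} (hη : η ∈ rapidSeq) (hξ : ξ ∈ rapidSeq) :
    ketBra η ξ ∈ rapid := by
  change RapidKernel fun j k => (ketBra η ξ : L2 →L[ℂ] L2) (ket k) j
  simp only [ketBra_ket_apply]
  exact RapidKernel.prod hη (star_mem_rapidSeq hξ)

/-- `∑ u_k (𝔞v)_k = ∑ (𝔞†u)_k v_k`. -/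
theorem hasSum_mul_annSeq_iff (u v : ℕ → ℂ) (s : ℂ) :
    HasSum (fun k => u k * annSeq v k) s ↔ HasSum (fun k => creSeq u k * v k) s := by
  -- The two series differ by a shift of the index, and the term that it drops vanishes as `creSeq u
  -- 0 = 0`.
  have h := hasSum_nat_add_iff (f := fun k => creSeq u k * v k) (g := s) 1
  simp only [Finset.sum_range_one, creSeq_zero, zero_mul, add_zero] at h
  rw [← h]
  simp only [creSeq_succ, annSeq_apply, mul_assoc, mul_left_comm]

theorem hasSum_mul_creSeq_iff (u v : ℕ → ℂ) (s : ℂ) :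
    HasSum (fun k => u k * creSeq v k) s ↔ HasSum (fun k => annSeq u k * v k) s := by
  have h := hasSum_mul_annSeq_iff v u s
  simp only [mul_comm (v _), mul_comm _ (u _)] at h
  exact h.symm

/-! ### Commutators of rapid decay matrices with `𝔞` and `𝔞†`. -/

theorem ann_apply (v : ann.domain) (k : ℕ) : (ann v : L2) k = annSeq v k := rfl

theorem cre_apply (v : cre.domain) (k : ℕ) : (cre v : L2) k = creSeq v k := rfl

/-- The matrix of `[𝔞, T]`. -/
def annKernel (m : ℕ → ℕ → ℂ) (j k : ℕ) : ℂ := annSeq (fun i => m i k) j - creSeq (m j) k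

/-- The matrix of `[𝔞†, T]`. -/
def creKernel (m : ℕ → ℕ → ℂ) (j k : ℕ) : ℂ := creSeq (fun i => m i k) j - annSeq (m j) k

theorem RapidKernel.annKernel {m : ℕ → ℕ → ℂ} (h : RapidKernel m) :
    RapidKernel (annKernel m) := h.ann_left.sub h.cre_right

theorem RapidKernel.creKernel {m : ℕ → ℕ → ℂ} (h : RapidKernel m) :
    RapidKernel (creKernel m) := h.cre_left.sub h.ann_right

/-- The operator `[𝔞, T]`. -/
def annComm (T : rapid) : rapid :=
  ⟨ofKernel (rapidKernel_of_mem T).annKernel, ofKernel_mem _⟩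

/-- The operator `[𝔞†, T]`. -/
def creComm (T : rapid) : rapid :=
  ⟨ofKernel (rapidKernel_of_mem T).creKernel, ofKernel_mem _⟩

theorem annComm_ket (T : rapid) (j k : ℕ) : (annComm T : L2 →L[ℂ] L2) (ket k) j =
    annSeq (fun i => (T : L2 →L[ℂ] L2) (ket k) i) j -
      creSeq (fun i => (T : L2 →L[ℂ] L2) (ket i) j) k :=
  ofKernel_ket_apply _ j k

theorem creComm_ket (T : rapid) (j k : ℕ) : (creComm T : L2 →L[ℂ] L2) (ket k) j =
    creSeq (fun i => (T : L2 →L[ℂ] L2) (ket k) i) j -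
      annSeq (fun i => (T : L2 →L[ℂ] L2) (ket i) j) k :=
  ofKernel_ket_apply _ j k

/-- Coordinatewise, `T𝔞v` is the series of the `j`-th row of `T` against `𝔞v`. The transposition of
`𝔞` onto the row is a reindexing of the same series, so no convergence beyond that for `T(𝔞v)` is
required. -/
theorem annComm_apply (T : rapid) (v : ann.domain) :
    (annComm T : L2 →L[ℂ] L2) v =
      ann ⟨(T : L2 →L[ℂ] L2) v, rapidSeq_le_ann (apply_mem_rapidSeq T.2 v)⟩ -
        (T : L2 →L[ℂ] L2) (ann v) := by
  ext j
  have h₁ := hasSum_coord (annComm T : L2 →L[ℂ] L2) v j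
  have h₂ := (hasSum_coord (T : L2 →L[ℂ] L2) v (j + 1)).mul_left (((√(j + 1 : ℝ) : ℝ) : ℂ))
  have h₃ := hasSum_coord (T : L2 →L[ℂ] L2) (ann v) j
  have h₄ := (hasSum_mul_annSeq_iff (fun k => (T : L2 →L[ℂ] L2) (ket k) j) v.1 _).1 h₃
  refine h₁.unique ((h₂.sub h₄).congr_fun fun k => ?_)
  rw [annComm_ket, sub_mul, annSeq_apply, mul_assoc]

theorem creComm_apply (T : rapid) (v : cre.domain) :
    (creComm T : L2 →L[ℂ] L2) v =
      cre ⟨(T : L2 →L[ℂ] L2) v, rapidSeq_le_cre (apply_mem_rapidSeq T.2 v)⟩ -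
        (T : L2 →L[ℂ] L2) (cre v) := by
  ext j
  have h₁ := hasSum_coord (creComm T : L2 →L[ℂ] L2) v j
  have h₃ := hasSum_coord (T : L2 →L[ℂ] L2) (cre v) j
  have h₄ := (hasSum_mul_creSeq_iff (fun k => (T : L2 →L[ℂ] L2) (ket k) j) v.1 _).1 h₃
  have h₂ : HasSum (fun k => creSeq (fun i => (T : L2 →L[ℂ] L2) (ket k) i) j * v.1 k)
      (creSeq ((T : L2 →L[ℂ] L2) v) j) := by
    rcases j with _ | j
    · simp
    · simpa only [creSeq_succ, mul_assoc] using
        (hasSum_coord (T : L2 →L[ℂ] L2) v j).mul_left (((√(j + 1 : ℝ) : ℝ) : ℂ))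
  refine h₁.unique ((h₂.sub h₄).congr_fun fun k => ?_)
  rw [creComm_ket, sub_mul]

end Operators

end MoritaCat

end

noncomputable section

namespace MoritaCat

open BimoduleData

/-! ## Self-adjointness and cores -/

section Unbounded

variable {H : Type} [NormedAddCommGroup H] [InnerProductSpace ℂ H]

/-- A symmetric operator `D` for which `1 + D²` is onto is self-adjoint. -/
theorem IsInvSqrt.isSelfAdjoint [CompleteSpace H] {D : H →ₗ.[ℂ] H} {R : H →L[ℂ] H}
    (hR : IsInvSqrt D R) (hd : Dense (D.domain : Set H))
    (hs : ∀ x y : D.domain, ⟪D x, (y : H)⟫_ℂ = ⟪(x : H), D y⟫_ℂ) : IsSelfAdjoint D := by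
  have hle : D ≤ D.adjoint := LinearPMap.IsFormalAdjoint.le_adjoint hd fun x y => hs x y
  -- As `1 + D² = (D + i)(D - i)`, surjectivity of `1 + D²` gives that of `D + i`, with preimage `(D
  -- - i)R²ψ`; for `D - i` the roles are exchanged.
  have hp : ∀ ψ : H, ∃ x : D.domain, D x + Complex.I • (x : H) = ψ := fun ψ => by
    obtain ⟨h₁, h₂, h₃⟩ := hR.2 ψ
    refine ⟨⟨_, h₂⟩ - Complex.I • ⟨_, h₁⟩, ?_⟩
    simp only [LinearPMap.map_sub, LinearPMap.map_smul, Submodule.coe_sub, Submodule.coe_smul,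
      smul_sub, smul_smul, Complex.I_mul_I, neg_one_smul]
    refine Eq.trans ?_ h₃
    abel
  have hm : ∀ ψ : H, ∃ x : D.domain, D x - Complex.I • (x : H) = ψ := fun ψ => by
    obtain ⟨h₁, h₂, h₃⟩ := hR.2 ψ
    refine ⟨⟨_, h₂⟩ + Complex.I • ⟨_, h₁⟩, ?_⟩
    simp only [LinearPMap.map_add, LinearPMap.map_smul, Submodule.coe_add, Submodule.coe_smul,
      smul_add, smul_smul, Complex.I_mul_I, neg_one_smul]
    refine Eq.trans ?_ h₃
    abel
  refine (LinearPMap.eq_of_le_of_domain_eq hle (le_antisymm hle.1 fun w hw => ?_)).symm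
  -- If `(D + i)x = (D* + i)w`, then `w - x` lies in the kernel of `D* + i` and is orthogonal to the
  -- range of `D - i`, which is everything. Hence `w = x` belongs to `Dom D`.
  obtain ⟨x, hx⟩ := hp (D.adjoint ⟨w, hw⟩ + Complex.I • w)
  obtain ⟨y, hy⟩ := hm (w - x)
  have h₁ : ⟪w, D y⟫_ℂ = ⟪D.adjoint ⟨w, hw⟩, (y : H)⟫_ℂ :=
    (LinearPMap.adjoint_isFormalAdjoint hd ⟨w, hw⟩ y).symm
  have h₂ : D.adjoint ⟨w, hw⟩ - D x = -(Complex.I • (w - (x : H))) := by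
    rw [smul_sub, neg_sub, sub_eq_sub_iff_add_eq_add, ← hx]
    abel
  have h₃ : ⟪w - (x : H), w - (x : H)⟫_ℂ = 0 := by
    calc ⟪w - (x : H), w - (x : H)⟫_ℂ = ⟪w - (x : H), D y - Complex.I • (y : H)⟫_ℂ := by rw [hy]
      _ = ⟪D.adjoint ⟨w, hw⟩ - D x, (y : H)⟫_ℂ - Complex.I * ⟪w - (x : H), (y : H)⟫_ℂ := by
        rw [inner_sub_right, inner_smul_right, inner_sub_left _ _ (D y), h₁, ← hs,
          inner_sub_left (D.adjoint ⟨w, hw⟩)]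
      _ = 0 := by
        rw [h₂, inner_neg_left, inner_smul_left, Complex.conj_I]
        ring
  rw [inner_self_eq_zero, sub_eq_zero] at h₃
  rw [h₃]
  exact x.2

/-- A subspace is a core exactly when the part of the graph above it is dense in the graph. This
form lets cores be found by approximating in `H × H`. -/
theorem hasCore_of_graph {D : H →ₗ.[ℂ] H} (hD : D.IsClosed) {S : Submodule ℂ H}
    (hS : S ≤ D.domain)
    (h : ∀ v : D.domain, ((v : H), D v) ∈
      closure {x : H × H | ∃ s : D.domain, (s : H) ∈ S ∧ x = (↑s, D s)}) : D.HasCore S := by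
  refine ⟨hS, ?_⟩
  have hr : D.domRestrict S ≤ D := LinearPMap.domRestrict_le
  have hc : (D.domRestrict S).IsClosable := hD.isClosable.leIsClosable hr
  refine LinearPMap.eq_of_eq_graph ?_
  rw [← hc.graph_closure_eq_closure_graph]
  refine le_antisymm
    (Submodule.topologicalClosure_minimal _ (LinearPMap.le_graph_of_le hr) hD) fun x hx => ?_
  obtain ⟨v, h₁, h₂⟩ := (LinearPMap.mem_graph_iff D).1 hx
  have hv := h v
  rw [h₁, h₂] at hv
  refine closure_mono ?_ hv
  rintro _ ⟨s, hs, rfl⟩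
  exact (LinearPMap.mem_graph_iff _).2 ⟨⟨s, hs, s.2⟩, rfl, LinearPMap.domRestrict_apply rfl⟩

theorem hasCore_domain {D : H →ₗ.[ℂ] H} (hD : D.IsClosed) : D.HasCore D.domain :=
  hasCore_of_graph hD le_rfl fun v => subset_closure ⟨v, v.2, rfl⟩

/-- For a bounded self-adjoint `B`, the operator `(1 + B²)^{-1/2}`. -/
theorem exists_isInvSqrt_of_bounded [CompleteSpace H] {B : H →L[ℂ] H} (hB : IsSelfAdjoint B) :
    ∃ R : H →L[ℂ] H, R.IsPositive ∧ (1 + B * B) * (R * R) = 1 := by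
  have hBB : 0 ≤ B * B := by
    have := star_mul_self_nonneg B
    rwa [hB.star_eq] at this
  have h₁ : (1 : H →L[ℂ] H) ≤ 1 + B * B := le_add_of_nonneg_right hBB
  have h₀ : (0 : H →L[ℂ] H) ≤ 1 + B * B := add_nonneg zero_le_one hBB
  have hu : IsUnit (1 + B * B) := CStarAlgebra.isUnit_of_le 1 h₁
  refine ⟨(1 + B * B) ^ (-(1 / 2) : ℝ), ?_, ?_⟩
  · rw [← ContinuousLinearMap.nonneg_iff_isPositive]
    exact CFC.rpow_nonneg
  · rw [← CFC.rpow_add hu]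
    nth_rw 1 [← CFC.rpow_one (1 + B * B) h₀]
    rw [← CFC.rpow_add hu]
    norm_num
    exact CFC.rpow_zero _ h₀

end Unbounded

/-! ## Spinors -/

section Spinors

variable {H₀ K₀ : Type} [NormedAddCommGroup H₀] [InnerProductSpace ℂ H₀]
  [NormedAddCommGroup K₀] [InnerProductSpace ℂ K₀]

/-- The spinor with the single nonzero entry `v` in place `i`. -/
def spin (i : Fin 2) : H₀ →L[ℂ] Spinor H₀ where
  toFun v := WithLp.toLp 2 (Pi.single i v)
  map_add' v w := by rw [Pi.single_add]; rfl
  map_smul' c v := by rw [Pi.single_smul]; rfl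
  cont := (PiLp.continuous_toLp 2 _).comp (continuous_single (A := fun _ => H₀) i)

theorem spin_apply (i j : Fin 2) (v : H₀) : spin i v j = if j = i then v else 0 := by
  change (Pi.single i v : Fin 2 → H₀) j = _
  rw [Pi.single_apply]

@[simp] theorem spin_zero_zero (v : H₀) : spin 0 v 0 = v := by simp [spin_apply]
@[simp] theorem spin_zero_one (v : H₀) : spin 0 v 1 = 0 := by simp [spin_apply]
@[simp] theorem spin_one_zero (v : H₀) : spin 1 v 0 = 0 := by simp [spin_apply]
@[simp] theorem spin_one_one (v : H₀) : spin 1 v 1 = v := by simp [spin_apply]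

theorem spinor_ext {v w : Spinor H₀} (h₀ : v 0 = w 0) (h₁ : v 1 = w 1) : v = w := by
  ext i
  fin_cases i
  · exact h₀
  · exact h₁

theorem spinor_eq_add (v : Spinor H₀) : v = spin 0 (v 0) + spin 1 (v 1) :=
  spinor_ext (by simp) (by simp)

theorem inner_spinor (v w : Spinor H₀) :
    ⟪v, w⟫_ℂ = ⟪v 0, w 0⟫_ℂ + ⟪v 1, w 1⟫_ℂ := by
  rw [PiLp.inner_apply, Fin.sum_univ_two]

/-- The even operator `(R₀ 0; 0 R₁)`. -/
def evenMap (R₀ R₁ : H₀ →L[ℂ] H₀) : Spinor H₀ →L[ℂ] Spinor H₀ :=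
  spin 0 ∘L R₀ ∘L PiLp.proj 2 (fun _ => H₀) 0 + spin 1 ∘L R₁ ∘L PiLp.proj 2 (fun _ => H₀) 1

@[simp] theorem evenMap_zero (R₀ R₁ : H₀ →L[ℂ] H₀) (v : Spinor H₀) :
    evenMap R₀ R₁ v 0 = R₀ (v 0) := by simp [evenMap]

@[simp] theorem evenMap_one (R₀ R₁ : H₀ →L[ℂ] H₀) (v : Spinor H₀) :
    evenMap R₀ R₁ v 1 = R₁ (v 1) := by simp [evenMap]

open ComplexOrder in
theorem evenMap_isPositive {R₀ R₁ : H₀ →L[ℂ] H₀} (h₀ : R₀.IsPositive) (h₁ : R₁.IsPositive) :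
    (evenMap R₀ R₁).IsPositive := by
  rw [ContinuousLinearMap.isPositive_iff] at *
  refine ⟨fun v w => ?_, fun v => ?_⟩
  · have e₀ := h₀.1 (v 0) (w 0)
    have e₁ := h₁.1 (v 1) (w 1)
    change ⟪evenMap R₀ R₁ v, w⟫_ℂ = ⟪v, evenMap R₀ R₁ w⟫_ℂ
    simp only [inner_spinor, evenMap_zero, evenMap_one]
    exact congrArg₂ _ e₀ e₁
  · simp only [inner_spinor, evenMap_zero, evenMap_one]
    exact add_nonneg (h₀.2 _) (h₁.2 _)

/-- The odd operator `(0 P; Q 0)`. -/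
def oddCLM (P Q : H₀ →L[ℂ] H₀) : Spinor H₀ →L[ℂ] Spinor H₀ :=
  spin 0 ∘L P ∘L PiLp.proj 2 (fun _ => H₀) 1 + spin 1 ∘L Q ∘L PiLp.proj 2 (fun _ => H₀) 0

@[simp] theorem oddCLM_zero (P Q : H₀ →L[ℂ] H₀) (v : Spinor H₀) :
    oddCLM P Q v 0 = P (v 1) := by simp [oddCLM]

@[simp] theorem oddCLM_one (P Q : H₀ →L[ℂ] H₀) (v : Spinor H₀) :
    oddCLM P Q v 1 = Q (v 0) := by simp [oddCLM]

theorem oddCLM_add (P P' Q Q' : H₀ →L[ℂ] H₀) :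
    oddCLM (P + P') (Q + Q') = oddCLM P Q + oddCLM P' Q' :=
  ContinuousLinearMap.ext fun v => spinor_ext (by simp) (by simp)

theorem oddCLM_smul (c : ℂ) (P Q : H₀ →L[ℂ] H₀) :
    oddCLM (c • P) (c • Q) = c • oddCLM P Q :=
  ContinuousLinearMap.ext fun v => spinor_ext (by simp) (by simp)

theorem amp_comp_oddCLM (a P Q : H₀ →L[ℂ] H₀) :
    amp a ∘L oddCLM P Q = oddCLM (a * P) (a * Q) :=
  ContinuousLinearMap.ext fun v => spinor_ext (by simp) (by simp)

theorem oddCLM_comp_amp (a P Q : H₀ →L[ℂ] H₀) :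
    oddCLM P Q ∘L amp a = oddCLM (P * a) (Q * a) :=
  ContinuousLinearMap.ext fun v => spinor_ext (by simp) (by simp)

@[simp] theorem oddMap_zero (c : ℂ) (P Q : H₀ →ₗ[ℂ] K₀) (v : Spinor H₀) :
    oddMap c P Q v 0 = c • P (v 1) := rfl

@[simp] theorem oddMap_one (c : ℂ) (P Q : H₀ →ₗ[ℂ] K₀) (v : Spinor H₀) :
    oddMap c P Q v 1 = c • Q (v 0) := rfl

theorem oddOp_zero (c : ℂ) (P Q : H₀ →ₗ.[ℂ] H₀) (v : (oddOp c P Q).domain) :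
    oddOp c P Q v 0 = c • P ⟨v.1 1, (v.2 1).1⟩ := rfl

theorem oddOp_one (c : ℂ) (P Q : H₀ →ₗ.[ℂ] H₀) (v : (oddOp c P Q).domain) :
    oddOp c P Q v 1 = c • Q ⟨v.1 0, (v.2 0).2⟩ := rfl

theorem oddOp_symmetric {c : ℂ} (hc : star c = c) {P Q : H₀ →ₗ.[ℂ] H₀}
    (h : ∀ (v : P.domain) (w : Q.domain), ⟪P v, (w : H₀)⟫_ℂ = ⟪(v : H₀), Q w⟫_ℂ)
    (v w : (oddOp c P Q).domain) :
    ⟪oddOp c P Q v, (w : Spinor H₀)⟫_ℂ = ⟪(v : Spinor H₀), oddOp c P Q w⟫_ℂ := by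
  have h' : ∀ (v : Q.domain) (w : P.domain), ⟪Q v, (w : H₀)⟫_ℂ = ⟪(v : H₀), P w⟫_ℂ := fun v w => by
    rw [← inner_conj_symm, ← h, inner_conj_symm]
  have hc' : (starRingEnd ℂ) c = c := hc
  rw [inner_spinor, inner_spinor, oddOp_zero, oddOp_one, oddOp_zero, oddOp_one,
    inner_smul_left, inner_smul_left, inner_smul_right, inner_smul_right, hc']
  have e₁ := h ⟨v.1 1, (v.2 1).1⟩ ⟨w.1 0, (w.2 0).2⟩
  have e₂ := h' ⟨v.1 0, (v.2 0).2⟩ ⟨w.1 1, (w.2 1).1⟩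
  simp only at e₁ e₂
  rw [e₁, e₂, add_comm]

end Spinors

end MoritaCat

end

noncomputable section

namespace MoritaCat

open BimoduleData

/-! ## The Schrödinger spectral triple -/

section Moyal

/-! ### The domains of `𝔞` and `𝔞†`, and diagonal operators. -/

theorem memLp_two_iff (v : ℕ → ℂ) : Memℓp v 2 ↔ Summable fun k => ‖v k‖ ^ 2 := by
  rw [memℓp_gen_iff (by norm_num)]
  simp

theorem memLp_of_norm_le (v : L2) (w : ℕ → ℂ) (C : ℝ) (h : ∀ k, ‖w k‖ ≤ C * ‖v k‖) :
    Memℓp w 2 := by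
  refine (memLp_two_iff w).2 ?_
  refine Summable.of_nonneg_of_le (fun k => by positivity) (fun k => ?_)
    (((memLp_two_iff v).1 (lp.memℓp v)).mul_left (C ^ 2))
  rw [← mul_pow]
  exact pow_le_pow_left₀ (norm_nonneg _) (h k) 2

/-- Together with the same criterion for `𝔞†`, this shows that both maximal domains are the domain
of `N^{1/2}`, where `N` is the number operator: the square norms of `𝔞v` and `𝔞†v` have weights `k`
and `k + 1`. -/
theorem mem_ann_domain_iff (v : L2) : v ∈ ann.domain ↔ Summable fun k : ℕ => (k : ℝ) * ‖v k‖ ^ 2 := by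
  change Memℓp (annSeq v) 2 ↔ _
  rw [memLp_two_iff, ← summable_nat_add_iff (f := fun k : ℕ => (k : ℝ) * ‖v k‖ ^ 2) 1]
  refine summable_congr fun k => ?_
  rw [annSeq_apply, norm_mul, mul_pow, Complex.norm_real, Real.norm_of_nonneg (Real.sqrt_nonneg _),
    Real.sq_sqrt (by positivity)]
  push_cast
  rfl

theorem mem_cre_domain_iff (v : L2) : v ∈ cre.domain ↔ Summable fun k : ℕ => (k : ℝ) * ‖v k‖ ^ 2 := by
  change Memℓp (creSeq v) 2 ↔ _
  have hv := (memLp_two_iff v).1 (lp.memℓp v)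
  have h : (fun k => ‖creSeq v (k + 1)‖ ^ 2) = fun k : ℕ => (k : ℝ) * ‖v k‖ ^ 2 + ‖v k‖ ^ 2 := by
    ext k
    rw [creSeq_succ, norm_mul, mul_pow, Complex.norm_real,
      Real.norm_of_nonneg (Real.sqrt_nonneg _), Real.sq_sqrt (by positivity)]
    ring
  rw [memLp_two_iff, ← summable_nat_add_iff 1, h]
  exact ⟨fun h => by simpa using h.sub hv, fun h => h.add hv⟩

theorem ann_domain_eq : ann.domain = cre.domain := by
  ext v
  rw [mem_ann_domain_iff, mem_cre_domain_iff]

theorem inner_ann (v : ann.domain) (w : cre.domain) : ⟪ann v, (w : L2)⟫_ℂ = ⟪(v : L2), cre w⟫_ℂ := by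
  have h₁ := hasSum_inner_coord (ann v) w
  have h₂ := hasSum_inner_coord (v : L2) (cre w)
  have h₃ := (hasSum_mul_creSeq_iff (fun k => star (v.1 k)) w.1 _).1 h₂
  refine h₁.unique (h₃.congr_fun fun k => ?_)
  rw [ann_apply]
  simp

theorem inner_cre (v : cre.domain) (w : ann.domain) : ⟪cre v, (w : L2)⟫_ℂ = ⟪(v : L2), ann w⟫_ℂ := by
  rw [← inner_conj_symm, ← inner_ann, inner_conj_symm]

/-- The bounded diagonal operator with entries `d`. -/
def diagCLM (d : ℕ → ℝ) (hd : ∀ k, |d k| ≤ 1) : L2 →L[ℂ] L2 :=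
  have hle : ∀ (v : L2) (k : ℕ), ‖(d k : ℂ) * v k‖ ≤ 1 * ‖v k‖ := fun v k => by
    rw [norm_mul, Complex.norm_real]
    exact mul_le_mul_of_nonneg_right (hd k) (norm_nonneg _)
  LinearMap.mkContinuous
    { toFun := fun v => ⟨fun k => (d k : ℂ) * v k, memLp_of_norm_le v _ 1 (hle v)⟩
      map_add' := fun v w => lp.ext (funext fun k => mul_add _ _ _)
      map_smul' := fun c v => lp.ext (funext fun k => mul_left_comm _ _ _) }
    1 fun v => by
      rw [one_mul]
      exact lp.norm_mono (by norm_num) fun k => (hle v k).trans_eq (one_mul _)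

@[simp] theorem diagCLM_apply (d : ℕ → ℝ) (hd : ∀ k, |d k| ≤ 1) (v : L2) (k : ℕ) :
    diagCLM d hd v k = (d k : ℂ) * v k := rfl

theorem diagCLM_symmetric (d : ℕ → ℝ) (hd : ∀ k, |d k| ≤ 1) (v w : L2) :
    ⟪diagCLM d hd v, w⟫_ℂ = ⟪v, diagCLM d hd w⟫_ℂ := by
  refine (hasSum_inner_coord _ w).unique ((hasSum_inner_coord v _).congr_fun fun k => ?_)
  rw [diagCLM_apply, diagCLM_apply]
  simp
  ring

open ComplexOrder in
theorem diagCLM_isPositive (d : ℕ → ℝ) (hd : ∀ k, |d k| ≤ 1) (h0 : ∀ k, 0 ≤ d k) :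
    (diagCLM d hd).IsPositive := by
  have he : ∀ k, |√(d k)| ≤ 1 := fun k => by
    rw [abs_of_nonneg (Real.sqrt_nonneg _)]
    exact Real.sqrt_le_iff.2 ⟨zero_le_one, by simpa using (le_abs_self _).trans (hd k)⟩
  rw [ContinuousLinearMap.isPositive_iff]
  refine ⟨diagCLM_symmetric d hd, fun v => ?_⟩
  have h : diagCLM d hd v = diagCLM _ he (diagCLM _ he v) := by
    ext k
    rw [diagCLM_apply, diagCLM_apply, diagCLM_apply, ← mul_assoc, ← Complex.ofReal_mul,
      Real.mul_self_sqrt (h0 k)]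
  rw [h, diagCLM_symmetric, inner_self_eq_norm_sq_to_K]
  exact le_of_le_of_eq (Complex.zero_le_real.2 (sq_nonneg ‖diagCLM _ he v‖))
    (Complex.ofReal_pow _ _)

/-- The inverse square root of an odd operator whose square is known. -/
theorem isInvSqrt_oddOp {H₀ : Type} [NormedAddCommGroup H₀] [InnerProductSpace ℂ H₀] {c : ℂ}
    {P Q : H₀ →ₗ.[ℂ] H₀} (hdom : P.domain = Q.domain) {R₀ R₁ : H₀ →L[ℂ] H₀}
    (hp₀ : R₀.IsPositive) (hp₁ : R₁.IsPositive)
    (h₀ : ∀ v, ∃ (h : R₀ (R₀ v) ∈ Q.domain) (h' : Q ⟨_, h⟩ ∈ P.domain),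
      R₀ (R₀ v) + c • c • P ⟨_, h'⟩ = v)
    (h₁ : ∀ v, ∃ (h : R₁ (R₁ v) ∈ P.domain) (h' : P ⟨_, h⟩ ∈ Q.domain),
      R₁ (R₁ v) + c • c • Q ⟨_, h'⟩ = v) :
    IsInvSqrt (oddOp c P Q) (evenMap R₀ R₁) := by
  refine ⟨evenMap_isPositive hp₀ hp₁, fun ψ => ?_⟩
  obtain ⟨a, a', ha⟩ := h₀ (ψ 0)
  obtain ⟨b, b', hb⟩ := h₁ (ψ 1)
  have hPQ : ∀ {x}, x ∈ P.domain → x ∈ P.domain ∧ x ∈ Q.domain := fun hx => ⟨hx, hdom ▸ hx⟩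
  have hQP : ∀ {x}, x ∈ Q.domain → x ∈ P.domain ∧ x ∈ Q.domain := fun hx => ⟨hdom ▸ hx, hx⟩
  have e₁ : evenMap R₀ R₁ (evenMap R₀ R₁ ψ) ∈ (oddOp c P Q).domain := by
    intro i
    fin_cases i
    · simpa using hQP a
    · simpa using hPQ b
  have e₂ : oddOp c P Q ⟨_, e₁⟩ ∈ (oddOp c P Q).domain := by
    intro i
    fin_cases i
    · exact hQP (Q.domain.smul_mem c (by simpa using b'))
    · exact hPQ (P.domain.smul_mem c (by simpa using a'))
  refine ⟨e₁, e₂, spinor_ext ?_ ?_⟩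
  · have : oddOp c P Q ⟨_, e₂⟩ 0 = c • P (c • ⟨Q ⟨R₀ (R₀ (ψ 0)), a⟩, a'⟩) := by
      rw [oddOp_zero]
      congr 2
      refine Subtype.ext ?_
      simp only [oddOp_one, evenMap_zero]
      rfl
    rw [LinearPMap.map_smul] at this
    rw [PiLp.add_apply, this, evenMap_zero, evenMap_zero, ha]
  · have : oddOp c P Q ⟨_, e₂⟩ 1 = c • Q (c • ⟨P ⟨R₁ (R₁ (ψ 1)), b⟩, b'⟩) := by
      rw [oddOp_one]
      congr 2
      refine Subtype.ext ?_
      simp only [oddOp_zero, evenMap_one]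
      rfl
    rw [LinearPMap.map_smul] at this
    rw [PiLp.add_apply, this, evenMap_one, evenMap_one, hb]

/-! ### The operator `(1 + D²)^{-1/2}` in the number basis. -/

theorem scale_mul_self {θ : ℝ} (hθ : 0 < θ) : scale θ * scale θ = ((2 / θ : ℝ) : ℂ) := by
  rw [scale, ← Complex.ofReal_mul, Real.mul_self_sqrt (by positivity)]

theorem scale_ne_zero {θ : ℝ} (hθ : 0 < θ) : scale θ ≠ 0 := fun h => by
  have := scale_mul_self hθ
  rw [h, mul_zero, eq_comm, Complex.ofReal_eq_zero] at this
  have h₂ : 0 < 2 / θ := by positivity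
  exact h₂.ne' this

theorem star_scale (θ : ℝ) : star (scale θ) = scale θ := Complex.conj_ofReal _

/-- The entries of `(1 + s (N + i))^{-1/2}`. -/
def invSqrtEntry (s : ℝ) (i k : ℕ) : ℝ := (√(1 + s * (k + i)))⁻¹

theorem invSqrtEntry_le {s : ℝ} (hs : 0 < s) (i k : ℕ) : |invSqrtEntry s i k| ≤ 1 := by
  rw [invSqrtEntry, abs_of_nonneg (by positivity)]
  refine inv_le_one_of_one_le₀ (Real.one_le_sqrt.2 ?_)
  have : 0 ≤ s * ((k : ℝ) + i) := by positivity
  linarith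

theorem invSqrtEntry_mul_self {s : ℝ} (hs : 0 < s) (i k : ℕ) :
    invSqrtEntry s i k * invSqrtEntry s i k = (1 + s * (k + i))⁻¹ := by
  rw [invSqrtEntry, ← mul_inv, Real.mul_self_sqrt (by positivity)]

/-- The operator `(1 + s (N + i))^{-1/2}`, where `N` is the number operator. -/
def invSqrtNum {s : ℝ} (hs : 0 < s) (i : ℕ) : L2 →L[ℂ] L2 :=
  diagCLM (invSqrtEntry s i) (invSqrtEntry_le hs i)

theorem invSqrtNum_apply {s : ℝ} (hs : 0 < s) (i : ℕ) (v : L2) (k : ℕ) :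
    invSqrtNum hs i (invSqrtNum hs i v) k = (((1 + s * (k + i))⁻¹ : ℝ) : ℂ) * v k := by
  rw [invSqrtNum, diagCLM_apply, diagCLM_apply, ← mul_assoc, ← Complex.ofReal_mul,
    invSqrtEntry_mul_self hs]

/-- This is `x/(1 + sx) ≤ 1/s` for `x = k + i ≥ 0`: the number operator is bounded after `(1 + s(N +
i))⁻¹`, which is what puts these vectors in the domain of `D²`. -/
theorem norm_invSqrtNum_le {s : ℝ} (hs : 0 < s) (i : ℕ) (v : L2) (k : ℕ) :
    ((k : ℝ) + i) * ‖invSqrtNum hs i (invSqrtNum hs i v) k‖ ≤ s⁻¹ * ‖v k‖ := by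
  rw [invSqrtNum_apply, norm_mul, Complex.norm_real, Real.norm_of_nonneg (by positivity),
    ← mul_assoc]
  refine mul_le_mul_of_nonneg_right ?_ (norm_nonneg _)
  rw [← div_eq_mul_inv, div_le_iff₀ (by positivity), mul_add, ← mul_assoc,
    inv_mul_cancel₀ hs.ne', one_mul]
  have : 0 < s⁻¹ := by positivity
  linarith

theorem invSqrtNum_mem {s : ℝ} (hs : 0 < s) (i : ℕ) (v : L2) :
    invSqrtNum hs i (invSqrtNum hs i v) ∈ ann.domain := by
  rw [mem_ann_domain_iff]
  refine Summable.of_nonneg_of_le (fun k => by positivity) (fun k => ?_)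
    (((memLp_two_iff v).1 (lp.memℓp v)).mul_left s⁻¹)
  have h₁ := norm_invSqrtNum_le hs i v k
  have h₂ : ‖invSqrtNum hs i (invSqrtNum hs i v) k‖ ≤ ‖v k‖ := by
    rw [invSqrtNum_apply, norm_mul, Complex.norm_real, Real.norm_of_nonneg (by positivity)]
    refine mul_le_of_le_one_left (norm_nonneg _) (inv_le_one_of_one_le₀ ?_)
    have : 0 ≤ s * ((k : ℝ) + i) := by positivity
    linarith
  have h₃ : (k : ℝ) * ‖invSqrtNum hs i (invSqrtNum hs i v) k‖ ≤ s⁻¹ * ‖v k‖ :=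
    (mul_le_mul_of_nonneg_right (by simp) (norm_nonneg _)).trans h₁
  -- With `w` the image of `v`, the term `k‖w k‖²` is split as `(k‖w k‖)·‖w k‖`; the factors are
  -- bounded by `s⁻¹‖v k‖` and `‖v k‖`.
  rw [pow_two, pow_two, ← mul_assoc, ← mul_assoc]
  exact mul_le_mul h₃ h₂ (norm_nonneg _) (by positivity)

theorem ann_cre_seq (v : ℕ → ℂ) (k : ℕ) : annSeq (creSeq v) k = ((k : ℂ) + 1) * v k := by
  rw [annSeq_apply, creSeq_succ, ← mul_assoc, ← Complex.ofReal_mul,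
    Real.mul_self_sqrt (by positivity)]
  push_cast
  rfl

theorem cre_ann_seq (v : ℕ → ℂ) (k : ℕ) : creSeq (annSeq v) k = (k : ℂ) * v k := by
  rcases k with _ | k
  · simp
  · rw [creSeq_succ, annSeq_apply, ← mul_assoc, ← Complex.ofReal_mul,
      Real.mul_self_sqrt (by positivity)]
    push_cast
    rfl

/-- Since `𝔞𝔞† = N + 1` and `𝔞†𝔞 = N`, the square of `D` is `(2/θ)` times the diagonal matrix with
entries `N + 1` and `N`. This accounts for the shifts 1 and 0 in the two components. -/
theorem isInvSqrt_moyal {θ : ℝ} (hθ : 0 < θ) :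
    IsInvSqrt (moyal θ).D (evenMap (invSqrtNum (s := 2 / θ) (by positivity) 1)
      (invSqrtNum (s := 2 / θ) (by positivity) 0)) := by
  have hs : 0 < 2 / θ := by positivity
  have key : ∀ (i k : ℕ) (v : L2), invSqrtNum hs i (invSqrtNum hs i v) k + scale θ * (scale θ *
      (((k : ℂ) + i) * invSqrtNum hs i (invSqrtNum hs i v) k)) = v k := by
    intro i k v
    rw [← mul_assoc (scale θ), scale_mul_self hθ, invSqrtNum_apply]
    have h : ((1 + 2 / θ * (k + i) : ℝ) : ℂ) ≠ 0 := Complex.ofReal_ne_zero.2 (by positivity)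
    have e : ((1 + 2 / θ * (k + i) : ℝ) : ℂ) * (((1 + 2 / θ * (k + i))⁻¹ : ℝ) : ℂ) = 1 := by
      rw [Complex.ofReal_inv, mul_inv_cancel₀ h]
    calc _ = ((1 + 2 / θ * (k + i) : ℝ) : ℂ) * (((1 + 2 / θ * (k + i))⁻¹ : ℝ) : ℂ) * v k := by
          push_cast; ring
      _ = v k := by rw [e, one_mul]
  have hpos : ∀ i, (invSqrtNum hs i).IsPositive := fun i =>
    diagCLM_isPositive _ _ fun k => by rw [invSqrtEntry]; positivity
  refine isInvSqrt_oddOp ann_domain_eq (hpos 1) (hpos 0) (fun v => ?_) fun v => ?_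
  · have hc := ann_domain_eq ▸ invSqrtNum_mem hs 1 v
    have hm : Memℓp (annSeq (creSeq (invSqrtNum hs 1 (invSqrtNum hs 1 v)))) 2 := by
      refine memLp_of_norm_le v _ (2 / θ)⁻¹ fun k => ?_
      refine le_trans (le_of_eq ?_) (norm_invSqrtNum_le hs 1 v k)
      rw [ann_cre_seq, norm_mul, show (k : ℂ) + 1 = ((k + 1 : ℕ) : ℂ) by push_cast; rfl,
        Complex.norm_natCast]
      push_cast
      rfl
    refine ⟨hc, hm, ?_⟩
    ext k
    refine Eq.trans ?_ (key 1 k v)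
    refine congrArg (fun z => invSqrtNum hs 1 (invSqrtNum hs 1 v) k + scale θ * (scale θ * z)) ?_
    rw [Nat.cast_one]
    exact ann_cre_seq _ k
  · have hm : Memℓp (creSeq (annSeq (invSqrtNum hs 0 (invSqrtNum hs 0 v)))) 2 := by
      refine memLp_of_norm_le v _ (2 / θ)⁻¹ fun k => ?_
      refine le_trans (le_of_eq ?_) (norm_invSqrtNum_le hs 0 v k)
      rw [cre_ann_seq, norm_mul, Complex.norm_natCast]
      simp
    refine ⟨invSqrtNum_mem hs 0 v, hm, ?_⟩
    ext k
    refine Eq.trans ?_ (key 0 k v)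
    refine congrArg (fun z => invSqrtNum hs 0 (invSqrtNum hs 0 v) k + scale θ * (scale θ * z)) ?_
    rw [Nat.cast_zero, add_zero]
    exact cre_ann_seq _ k

/-! ### The axioms of a spectral triple for the Moyal plane. -/

theorem isCompactOperator_amp {T : L2 →L[ℂ] L2} (hT : IsCompactOperator T) :
    IsCompactOperator (amp T) := by
  have h : amp T = evenMap T T := ContinuousLinearMap.ext fun v => spinor_ext (by simp) (by simp)
  rw [h]
  exact ((hT.comp_clm (PiLp.proj 2 (fun _ => L2) 0)).clm_comp (spin 0)).add
    ((hT.comp_clm (PiLp.proj 2 (fun _ => L2) 1)).clm_comp (spin 1))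

theorem dense_of_ket {S : Submodule ℂ (Spinor L2)} (hS : ∀ i k, spin i (ket k) ∈ S) :
    Dense (S : Set (Spinor L2)) := by
  rw [Submodule.dense_iff_topologicalClosure_eq_top]
  have h : ∀ i v, spin i v ∈ S.topologicalClosure := fun i v => by
    have h₁ : (Submodule.span ℂ (Set.range ket)).topologicalClosure ≤
        S.topologicalClosure.comap (spin i : L2 →L[ℂ] Spinor L2).toLinearMap := by
      refine Submodule.topologicalClosure_minimal _ (Submodule.span_le.2 ?_)
        (S.isClosed_topologicalClosure.preimage (spin i).continuous)
      rintro _ ⟨k, rfl⟩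
      exact S.le_topologicalClosure (hS i k)
    rw [dense_span_ket] at h₁
    exact h₁ (x := v) trivial
  refine top_le_iff.1 fun v _ => ?_
  rw [spinor_eq_add v]
  exact add_mem (h 0 _) (h 1 _)

theorem ket_mem_ann (k : ℕ) : ket k ∈ ann.domain := rapidSeq_le_ann (ket_mem_rapidSeq k)

theorem ket_mem_cre (k : ℕ) : ket k ∈ cre.domain := rapidSeq_le_cre (ket_mem_rapidSeq k)

theorem spin_mem_domain {θ : ℝ} {v : L2} (hv : v ∈ ann.domain) (i : Fin 2) :
    spin i v ∈ (moyal θ).D.domain := by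
  have hv' : v ∈ cre.domain := ann_domain_eq ▸ hv
  intro j
  rw [spin_apply]
  split_ifs
  · exact ⟨hv, hv'⟩
  · exact ⟨zero_mem _, zero_mem _⟩

theorem isCommutator_oddOp (θ : ℝ) (T : rapid) :
    IsCommutator (oddOp (scale θ) ann cre) (amp (T : L2 →L[ℂ] L2))
      (scale θ • oddCLM (annComm T : L2 →L[ℂ] L2) (creComm T : L2 →L[ℂ] L2)) := by
  intro ψ
  have hd : ∀ i, (T : L2 →L[ℂ] L2) (ψ.1 i) ∈ rapidSeq := fun i => apply_mem_rapidSeq T.2 _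
  refine ⟨fun i => ⟨rapidSeq_le_ann (hd i), rapidSeq_le_cre (hd i)⟩, spinor_ext ?_ ?_⟩
  · have h := annComm_apply T ⟨ψ.1 1, (ψ.2 1).1⟩
    change scale θ • oddCLM (annComm T : L2 →L[ℂ] L2) (creComm T : L2 →L[ℂ] L2) ψ.1 0 = _
    rw [oddCLM_zero, h, smul_sub, ← map_smul]
    rfl
  · have h := creComm_apply T ⟨ψ.1 0, (ψ.2 0).2⟩
    change scale θ • oddCLM (annComm T : L2 →L[ℂ] L2) (creComm T : L2 →L[ℂ] L2) ψ.1 1 = _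
    rw [oddCLM_one, h, smul_sub, ← map_smul]
    rfl

theorem isCommutator_moyal (θ : ℝ) (T : rapid) :
    IsCommutator (moyal θ).D ((moyal θ).rep T.1)
      (scale θ • oddCLM (annComm T : L2 →L[ℂ] L2) (creComm T : L2 →L[ℂ] L2)) :=
  isCommutator_oddOp θ T

theorem separableSpace_of_dense_span {M : Type} [NormedAddCommGroup M] [InnerProductSpace ℂ M]
    {s : Set M} (hs : s.Countable) (hd : Dense (Submodule.span ℂ s : Set M)) :
    TopologicalSpace.SeparableSpace M := by
  have hc := (hs.isSeparable.span (R := ℂ)).closure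
  rw [hd.closure_eq] at hc
  exact TopologicalSpace.isSeparable_univ_iff.1 hc

theorem separableSpace_spinor : TopologicalSpace.SeparableSpace (Spinor L2) :=
  separableSpace_of_dense_span (s := Set.range fun p : Fin 2 × ℕ => spin p.1 (ket p.2))
    (Set.countable_range _) (dense_of_ket fun i k => Submodule.subset_span ⟨(i, k), rfl⟩)

theorem dense_rapid : Dense (rapid : Set compacts) := by
  have h := dense_span_ketBra
  rw [← Submodule.dense_iff_topologicalClosure_eq_top] at h
  refine h.mono ?_
  have h' : Submodule.span ℂ {x | ∃ j k, x = ketBra (ket j) (ket k)} ≤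
      rapid.toNonUnitalSubalgebra.toSubmodule := by
    refine Submodule.span_le.2 ?_
    rintro _ ⟨j, k, rfl⟩
    exact ketBra_mem_rapid (ket_mem_rapidSeq j) (ket_mem_rapidSeq k)
  exact h'

theorem amp_injective {H₀ : Type} [NormedAddCommGroup H₀] [InnerProductSpace ℂ H₀]
    {S T : H₀ →L[ℂ] H₀} (h : amp S = amp T) : S = T := by
  ext v
  have := congrArg (fun R => R (spin 0 v) 0) h
  simpa using this

theorem amp_ketBra_spin (i : Fin 2) (j k : ℕ) :
    amp (ketBra (ket j) (ket k) : L2 →L[ℂ] L2) (spin i (ket k)) = spin i (ket j) := by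
  ext1 l
  rw [amp_apply, spin_apply, spin_apply]
  split_ifs
  · rw [ketBra_apply, inner_ket_left, ket_apply, if_pos rfl, one_smul]
  · simp

theorem dense_span_amp : Dense (Submodule.span ℂ
    {ψ : Spinor L2 | ∃ (a : compacts) (φ : Spinor L2), ψ = amp (a : L2 →L[ℂ] L2) φ} :
      Set (Spinor L2)) :=
  dense_of_ket fun i k =>
    Submodule.subset_span ⟨ketBra (ket k) (ket k), spin i (ket k), (amp_ketBra_spin i k k).symm⟩

theorem isSpectralTriple_moyal {θ : ℝ} (hθ : 0 < θ) : IsSpectralTriple (moyal θ) where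
  separable := separableSpace_spinor
  smooth_dense := dense_rapid
  faithful := fun S T h => Subtype.ext (amp_injective h)
  nondegenerate := Submodule.dense_iff_topologicalClosure_eq_top.1 dense_span_amp
  selfAdjoint := by
    refine (isInvSqrt_moyal hθ).isSelfAdjoint
      (dense_of_ket fun i k => spin_mem_domain (ket_mem_ann k) i) ?_
    exact oddOp_symmetric (star_scale θ) inner_ann
  bounded_commutator := fun T hT => ⟨_, isCommutator_moyal θ ⟨T, hT⟩⟩
  -- The elements of the algebra are already compact, so no compactness of the resolvent itself has
  -- to be proved.
  compact_resolvent := ⟨_, isInvSqrt_moyal hθ, fun T _ =>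
    (isCompactOperator_amp T.2).comp_clm _⟩

end Moyal

end MoritaCat

end

noncomputable section

namespace MoritaCat

open BimoduleData

/-! ## Cores of the Dirac operator of the Moyal plane -/

section MoyalCore

theorem ann_ket_zero (h : ket 0 ∈ ann.domain) : ann ⟨ket 0, h⟩ = 0 := by
  ext k
  rw [ann_apply, annSeq_apply, ket_apply, if_neg (by omega), mul_zero]
  rfl

theorem ann_ket_succ (k : ℕ) (h : ket (k + 1) ∈ ann.domain) :
    ann ⟨ket (k + 1), h⟩ = ((√(k + 1 : ℝ) : ℝ) : ℂ) • ket k := by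
  ext j
  rw [ann_apply, annSeq_apply, ket_apply]
  change _ = ((√(k + 1 : ℝ) : ℝ) : ℂ) * ket k j
  rw [ket_apply]
  by_cases hj : j = k
  · simp [hj]
  · rw [if_neg (by omega), if_neg hj, mul_zero, mul_zero]

theorem cre_ket (k : ℕ) (h : ket k ∈ cre.domain) :
    cre ⟨ket k, h⟩ = ((√(k + 1 : ℝ) : ℝ) : ℂ) • ket (k + 1) := by
  ext j
  rw [cre_apply]
  change _ = ((√(k + 1 : ℝ) : ℝ) : ℂ) * ket (k + 1) j
  rw [ket_apply]
  rcases j with _ | j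
  · simp
  · rw [creSeq_succ, ket_apply]
    by_cases hj : j = k
    · simp [hj]
    · rw [if_neg hj, if_neg (by omega), mul_zero, mul_zero]

/-- The basis expansion of `w` is carried by `𝔞` to the basis expansion of `𝔞w`, shifted by one
place. Hence it converges in the graph norm. -/
theorem hasSum_ann (w : ann.domain) :
    HasSum (fun k => w.1 k • ann ⟨ket k, ket_mem_ann k⟩) (ann w) := by
  rw [← hasSum_nat_add_iff' 1, Finset.sum_range_one, ann_ket_zero, smul_zero, sub_zero]
  refine (hasSum_ket (ann w)).congr_fun fun k => ?_
  rw [ann_ket_succ, ann_apply, annSeq_apply, smul_smul, mul_comm]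

theorem hasSum_cre (w : cre.domain) :
    HasSum (fun k => w.1 k • cre ⟨ket k, ket_mem_cre k⟩) (cre w) := by
  have h := (hasSum_nat_add_iff' 1).2 (hasSum_ket (cre w))
  rw [Finset.sum_range_one, cre_apply, creSeq_zero, zero_smul, sub_zero] at h
  refine h.congr_fun fun k => ?_
  rw [cre_ket, cre_apply, creSeq_succ, smul_smul, mul_comm]

theorem oddOp_spin_zero (c : ℂ) {v : L2} (h : spin 0 v ∈ (oddOp c ann cre).domain)
    (h' : v ∈ cre.domain) : oddOp c ann cre ⟨spin 0 v, h⟩ = c • spin 1 (cre ⟨v, h'⟩) := by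
  have h₀ : ann ⟨spin 0 v 1, (h 1).1⟩ = 0 :=
    (congrArg ann (Subtype.ext (by simp : spin 0 v 1 = 0))).trans ann.map_zero
  have h₁ : cre ⟨spin 0 v 0, (h 0).2⟩ = cre ⟨v, h'⟩ :=
    congrArg cre (Subtype.ext (by simp : spin 0 v 0 = v))
  refine spinor_ext ?_ ?_
  · exact (congrArg (c • ·) h₀).trans (by simp)
  · exact (congrArg (c • ·) h₁).trans (by simp)

theorem oddOp_spin_one (c : ℂ) {v : L2} (h : spin 1 v ∈ (oddOp c ann cre).domain)
    (h' : v ∈ ann.domain) : oddOp c ann cre ⟨spin 1 v, h⟩ = c • spin 0 (ann ⟨v, h'⟩) := by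
  have h₀ : ann ⟨spin 1 v 1, (h 1).1⟩ = ann ⟨v, h'⟩ :=
    congrArg ann (Subtype.ext (by simp : spin 1 v 1 = v))
  have h₁ : cre ⟨spin 1 v 0, (h 0).2⟩ = 0 :=
    (congrArg cre (Subtype.ext (by simp : spin 1 v 0 = 0))).trans cre.map_zero
  refine spinor_ext ?_ ?_
  · exact (congrArg (c • ·) h₀).trans (by simp)
  · exact (congrArg (c • ·) h₁).trans (by simp)

theorem hasSum_oddOp_spin (c : ℂ) (i : Fin 2) {w : L2} (hw : w ∈ ann.domain)
    (hd : ∀ v ∈ ann.domain, spin i v ∈ (oddOp c ann cre).domain) :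
    HasSum (fun k => w k • oddOp c ann cre ⟨spin i (ket k), hd _ (ket_mem_ann k)⟩)
      (oddOp c ann cre ⟨spin i w, hd w hw⟩) := by
  fin_cases i
  · have hw' : w ∈ cre.domain := ann_domain_eq ▸ hw
    have h := ((spin 1).hasSum (hasSum_cre ⟨w, hw'⟩)).const_smul c
    refine (oddOp_spin_zero c (hd w hw) hw').symm ▸ h.congr_fun fun k => ?_
    exact (congrArg (w k • ·) (oddOp_spin_zero c (hd _ (ket_mem_ann k)) (ket_mem_cre k))).trans
      (by rw [map_smul, smul_comm])
  · have h := ((spin 0).hasSum (hasSum_ann ⟨w, hw⟩)).const_smul c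
    refine (oddOp_spin_one c (hd w hw) hw).symm ▸ h.congr_fun fun k => ?_
    exact (congrArg (w k • ·) (oddOp_spin_one c (hd _ (ket_mem_ann k)) (ket_mem_ann k))).trans
      (by rw [map_smul, smul_comm])

/-- A subspace of the domain that contains the basis vectors is a core. -/
theorem hasCore_oddOp {c : ℂ} (hD : (oddOp c ann cre).IsClosed) {S : Submodule ℂ (Spinor L2)}
    (hS : S ≤ (oddOp c ann cre).domain) (h : ∀ i k, spin i (ket k) ∈ S) :
    (oddOp c ann cre).HasCore S := by
  have hd : ∀ i, ∀ v ∈ ann.domain, spin i v ∈ (oddOp c ann cre).domain := by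
    intro i v hv j
    have hv' : v ∈ cre.domain := ann_domain_eq ▸ hv
    rw [spin_apply]
    split_ifs
    · exact ⟨hv, hv'⟩
    · exact ⟨zero_mem _, zero_mem _⟩
  -- The part of the graph above `S`. As its closure is a subspace, the two spinor components can be
  -- approximated separately and then added.
  let G : Submodule ℂ (Spinor L2 × Spinor L2) :=
    (oddOp c ann cre).graph ⊓ S.comap (LinearMap.fst ℂ _ _)
  have hG : (G : Set (Spinor L2 × Spinor L2)) = {x : Spinor L2 × Spinor L2 |
      ∃ s : (oddOp c ann cre).domain, (s : Spinor L2) ∈ S ∧ x = (↑s, oddOp c ann cre s)} := by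
    ext x
    constructor
    · rintro ⟨h₁, h₂⟩
      obtain ⟨s, hs, hs'⟩ := (LinearPMap.mem_graph_iff _).1 h₁
      refine ⟨s, ?_, Prod.ext hs.symm hs'.symm⟩
      rw [hs]
      exact h₂
    · rintro ⟨s, hs, rfl⟩
      exact ⟨(LinearPMap.mem_graph_iff _).2 ⟨s, rfl, rfl⟩, hs⟩
  have key : ∀ (i : Fin 2) (w : L2) (hw : w ∈ ann.domain),
      (spin i w, oddOp c ann cre ⟨spin i w, hd i w hw⟩) ∈ G.topologicalClosure := by
    intro i w hw
    have h₁ := (spin i).hasSum (hasSum_ket w)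
    have h₂ := hasSum_oddOp_spin c i hw (hd i)
    refine mem_closure_of_tendsto (h₁.prodMk h₂) (Filter.Eventually.of_forall fun s => ?_)
    refine sum_mem fun k _ => ?_
    have e : ((spin i) (w k • ket k),
        w k • oddOp c ann cre ⟨spin i (ket k), hd i _ (ket_mem_ann k)⟩) = w k •
        (spin i (ket k), oddOp c ann cre ⟨spin i (ket k), hd i _ (ket_mem_ann k)⟩) := by
      rw [map_smul, Prod.smul_mk]
    change _ ∈ G
    rw [e]
    exact G.smul_mem _ ⟨(LinearPMap.mem_graph_iff _).2 ⟨_, rfl, rfl⟩, h i k⟩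
  refine hasCore_of_graph hD hS fun v => ?_
  rw [← hG]
  have h₀ := key 0 (v.1 0) (v.2 0).1
  have h₁ := key 1 (v.1 1) (v.2 1).1
  have h₂ := G.topologicalClosure.add_mem h₀ h₁
  have e : v = (⟨spin 0 (v.1 0), hd 0 _ (v.2 0).1⟩ + ⟨spin 1 (v.1 1), hd 1 _ (v.2 1).1⟩ :
      (oddOp c ann cre).domain) := Subtype.ext (spinor_eq_add v.1)
  have e₂ : ((v : Spinor L2), oddOp c ann cre v) =
      (spin 0 (v.1 0), oddOp c ann cre ⟨spin 0 (v.1 0), hd 0 _ (v.2 0).1⟩) +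
      (spin 1 (v.1 1), oddOp c ann cre ⟨spin 1 (v.1 1), hd 1 _ (v.2 1).1⟩) := by
    rw [Prod.mk_add_mk, ← spinor_eq_add, ← LinearPMap.map_add, ← e]
  rw [e₂]
  exact h₂

theorem hasCore_moyal {θ : ℝ} (hθ : 0 < θ) {S : Submodule ℂ (Spinor L2)}
    (hS : S ≤ (oddOp (scale θ) ann cre).domain) (h : ∀ i k, spin i (ket k) ∈ S) :
    (moyal θ).D.HasCore S :=
  hasCore_oddOp (isSpectralTriple_moyal hθ).selfAdjoint.isClosed hS h

end MoyalCore

/-! ## The truncations -/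

section Truncation

variable {n : ℕ}

/-- A matrix as a bounded operator on `ℂⁿ`. -/
def matCLM : Matrix (Fin n) (Fin n) ℂ →⋆ₙₐ[ℂ]
    (EuclideanSpace ℂ (Fin n) →L[ℂ] EuclideanSpace ℂ (Fin n)) :=
  (Matrix.toEuclideanCLM (n := Fin n) (𝕜 := ℂ) : Matrix (Fin n) (Fin n) ℂ →⋆ₙₐ[ℂ] _)

theorem matCLM_apply (M : Matrix (Fin n) (Fin n) ℂ) (v : EuclideanSpace ℂ (Fin n)) :
    matCLM M v = WithLp.toLp 2 (M.mulVec v.ofLp) := rfl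

theorem matCLM_injective : Function.Injective (matCLM (n := n)) :=
  (Matrix.toEuclideanCLM (n := Fin n) (𝕜 := ℂ)).injective

theorem matCLM_one : matCLM (1 : Matrix (Fin n) (Fin n) ℂ) = 1 :=
  map_one (Matrix.toEuclideanCLM (n := Fin n) (𝕜 := ℂ))

theorem rep_truncation (θ : ℝ) (a : Matrix (Fin n) (Fin n) ℂ) :
    (truncation n θ).rep a = amp (matCLM a) := rfl

/-- The Dirac operator of the truncation, as a bounded operator. -/
def truncD (n : ℕ) (θ : ℝ) :
    Spinor (EuclideanSpace ℂ (Fin n)) →L[ℂ] Spinor (EuclideanSpace ℂ (Fin n)) :=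
  scale θ • oddCLM (matCLM (Xmat n).conjTranspose) (matCLM (Xmat n))

theorem truncD_zero (θ : ℝ) (ψ : Spinor (EuclideanSpace ℂ (Fin n))) :
    truncD n θ ψ 0 = scale θ • matCLM (Xmat n).conjTranspose (ψ 1) := by
  simp [truncD]

theorem truncD_one (θ : ℝ) (ψ : Spinor (EuclideanSpace ℂ (Fin n))) :
    truncD n θ ψ 1 = scale θ • matCLM (Xmat n) (ψ 0) := by
  simp [truncD]

theorem truncation_mem_domain (θ : ℝ) (ψ : Spinor (EuclideanSpace ℂ (Fin n))) :
    ψ ∈ (truncation n θ).D.domain := fun _ => ⟨trivial, trivial⟩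

theorem truncation_D_apply (θ : ℝ) (ψ : (truncation n θ).D.domain) :
    (truncation n θ).D ψ = truncD n θ ψ.1 := by
  exact spinor_ext (truncD_zero θ ψ.1).symm (truncD_one θ ψ.1).symm

theorem truncation_domain (θ : ℝ) : (truncation n θ).D.domain = ⊤ :=
  top_le_iff.1 fun ψ _ => truncation_mem_domain θ ψ

theorem truncD_isSelfAdjoint (n : ℕ) (θ : ℝ) : IsSelfAdjoint (truncD n θ) := by
  rw [ContinuousLinearMap.isSelfAdjoint_iff_isSymmetric]
  intro v w
  have h := oddOp_symmetric (star_scale θ) (P := matOp (Xmat n).conjTranspose)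
    (Q := matOp (Xmat n)) (fun v w => ?_) ⟨v, truncation_mem_domain θ v⟩
    ⟨w, truncation_mem_domain θ w⟩
  · have h₁ := truncation_D_apply θ ⟨v, truncation_mem_domain θ v⟩
    have h₂ := truncation_D_apply θ ⟨w, truncation_mem_domain θ w⟩
    exact ((congrArg (fun x : Spinor (EuclideanSpace ℂ (Fin n)) => ⟪x, w⟫_ℂ) h₁).symm.trans h).trans
      (congrArg (fun x : Spinor (EuclideanSpace ℂ (Fin n)) => ⟪v, x⟫_ℂ) h₂)
  · change ⟪matCLM (Xmat n).conjTranspose v.1, w.1⟫_ℂ = ⟪v.1, matCLM (Xmat n) w.1⟫_ℂ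
    rw [← Matrix.star_eq_conjTranspose, map_star, ContinuousLinearMap.star_eq_adjoint,
      ContinuousLinearMap.adjoint_inner_left]

theorem truncation_isCommutator_iff (θ : ℝ) (a : Matrix (Fin n) (Fin n) ℂ)
    (K : Spinor (EuclideanSpace ℂ (Fin n)) →L[ℂ] Spinor (EuclideanSpace ℂ (Fin n))) :
    IsCommutator (truncation n θ).D ((truncation n θ).rep a) K ↔
      K = truncD n θ * amp (matCLM a) - amp (matCLM a) * truncD n θ := by
  constructor
  · intro h
    ext1 ψ
    obtain ⟨h₁, h₂⟩ := h ⟨ψ, truncation_mem_domain θ ψ⟩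
    rw [truncation_D_apply, truncation_D_apply] at h₂
    exact h₂
  · rintro rfl ψ
    refine ⟨truncation_mem_domain θ _, ?_⟩
    rw [truncation_D_apply, truncation_D_apply]
    rfl

theorem isInvSqrt_truncation (n : ℕ) (θ : ℝ) : ∃ R, IsInvSqrt (truncation n θ).D R := by
  obtain ⟨R, h₁, h₂⟩ := exists_isInvSqrt_of_bounded (truncD_isSelfAdjoint n θ)
  refine ⟨R, h₁, fun ψ => ⟨truncation_mem_domain θ _, truncation_mem_domain θ _, ?_⟩⟩
  rw [truncation_D_apply, truncation_D_apply]
  exact congrArg (fun S => S ψ) h₂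

theorem isSpectralTriple_truncation (n : ℕ) (θ : ℝ) : IsSpectralTriple (truncation n θ) where
  separable := by
    change TopologicalSpace.SeparableSpace (Spinor (EuclideanSpace ℂ (Fin n)))
    infer_instance
  smooth_dense := dense_univ
  faithful := fun a b h => matCLM_injective (amp_injective h)
  nondegenerate := by
    refine top_le_iff.1 ((top_le_iff.2 ?_).trans (Submodule.le_topologicalClosure _))
    refine top_le_iff.1 fun ψ _ => Submodule.subset_span
      ⟨(1 : Matrix (Fin n) (Fin n) ℂ), ψ, ?_⟩
    rw [rep_truncation, matCLM_one]
    rfl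
  selfAdjoint := by
    obtain ⟨R, hR⟩ := isInvSqrt_truncation n θ
    refine hR.isSelfAdjoint (by rw [truncation_domain]; exact dense_univ) fun x y => ?_
    rw [truncation_D_apply, truncation_D_apply]
    exact (ContinuousLinearMap.isSelfAdjoint_iff_isSymmetric.1 (truncD_isSelfAdjoint n θ)) x.1 y.1
  bounded_commutator := fun a _ => ⟨_, (truncation_isCommutator_iff θ a _).2 rfl⟩
  compact_resolvent := by
    obtain ⟨R, hR⟩ := isInvSqrt_truncation n θ
    refine ⟨R, hR, fun a _ => ?_⟩
    let S : Spinor (EuclideanSpace ℂ (Fin n)) →L[ℂ] Spinor (EuclideanSpace ℂ (Fin n)) :=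
      (truncation n θ).rep a ∘L R
    exact isCompactOperator_of_locallyCompactSpace_rng S

theorem hasCore_truncation (n : ℕ) (θ : ℝ) {S : Submodule ℂ (truncation n θ).H} (hS : S = ⊤) :
    (truncation n θ).D.HasCore S := by
  rw [hS, ← truncation_domain]
  exact hasCore_domain (isSpectralTriple_truncation n θ).selfAdjoint.isClosed

end Truncation

end MoritaCat

end

noncomputable section

namespace MoritaCat

open BimoduleData

/-! ## One-forms of the Moyal plane -/

section MoyalForms

/-- The diagonal operator with entries `v`. -/
def diagOp {v : ℕ → ℂ} (hv : RapidSeq v) : rapid :=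
  ⟨ofKernel (RapidKernel.diag hv), ofKernel_mem _⟩

theorem diagOp_ket_apply {v : ℕ → ℂ} (hv : RapidSeq v) (j k : ℕ) :
    (diagOp hv : L2 →L[ℂ] L2) (ket k) j = if j = k then v k else 0 :=
  ofKernel_ket_apply _ j k

theorem diagOp_apply {v : ℕ → ℂ} (hv : RapidSeq v) (w : L2) (j : ℕ) :
    (diagOp hv : L2 →L[ℂ] L2) w j = v j * w j := by
  refine (hasSum_coord _ w j).unique ((hasSum_ite_eq j (v j * w j)).congr_fun fun k => ?_)
  rw [diagOp_ket_apply]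
  by_cases h : j = k
  · simp [h]
  · rw [if_neg h, if_neg (Ne.symm h), zero_mul]

/-- Commutators with diagonal operators are weighted shifts by differences of neighbouring entries.
The two halves of `[D, v]` shift in opposite directions, which makes it possible to isolate each. -/
theorem annComm_diagOp_ket {v : ℕ → ℂ} (hv : RapidSeq v) (k : ℕ) :
    (annComm (diagOp hv) : L2 →L[ℂ] L2) (ket k) =
      (((√(k : ℝ) : ℝ) : ℂ) * (v k - v (k - 1))) • ket (k - 1) := by
  ext j
  change _ = _ * ket (k - 1) j
  rw [annComm_ket, annSeq_apply, diagOp_ket_apply, ket_apply]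
  rcases k with _ | k
  · simp
  · rw [creSeq_succ, diagOp_ket_apply]
    by_cases h : j = k
    · simp [h, mul_sub]
    · rw [if_neg (by omega), if_neg h, if_neg (by omega)]
      simp

theorem creComm_diagOp_ket {v : ℕ → ℂ} (hv : RapidSeq v) (k : ℕ) :
    (creComm (diagOp hv) : L2 →L[ℂ] L2) (ket k) =
      (((√(k + 1 : ℝ) : ℝ) : ℂ) * (v k - v (k + 1))) • ket (k + 1) := by
  ext j
  change _ = _ * ket (k + 1) j
  rw [creComm_ket, annSeq_apply, diagOp_ket_apply, ket_apply]
  rcases j with _ | j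
  · simp
  · rw [creSeq_succ, diagOp_ket_apply]
    by_cases h : j = k
    · simp [h, mul_sub]
    · rw [if_neg h, if_neg (by omega), if_neg (by omega)]
      simp

/-- The two hypotheses say in coordinates that `P = x[𝔞, v]` and `Q = x[𝔞†, v]` for the diagonal
operator `v`, so that the matrix is a multiple of the one-form `x[D, v]`. -/
theorem oddCLM_mem_of_entries {θ : ℝ} (hθ : 0 < θ) {v : ℕ → ℂ} (hv : RapidSeq v) (x P Q : rapid)
    (hP : ∀ j k, (P : L2 →L[ℂ] L2) (ket k) j =
      ((√(k : ℝ) : ℝ) : ℂ) * (v k - v (k - 1)) * (x : L2 →L[ℂ] L2) (ket (k - 1)) j)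
    (hQ : ∀ j k, (Q : L2 →L[ℂ] L2) (ket k) j =
      ((√(k + 1 : ℝ) : ℝ) : ℂ) * (v k - v (k + 1)) * (x : L2 →L[ℂ] L2) (ket (k + 1)) j) :
    oddCLM (P : L2 →L[ℂ] L2) Q ∈ (moyal θ).oneForms := by
  have h₁ : (P : L2 →L[ℂ] L2) = (x : L2 →L[ℂ] L2) * (annComm (diagOp hv) : L2 →L[ℂ] L2) :=
    ext_entries fun j k => by
      rw [hP, mul_apply_eq_comp, annComm_diagOp_ket, map_smul]
      rfl
  have h₂ : (Q : L2 →L[ℂ] L2) = (x : L2 →L[ℂ] L2) * (creComm (diagOp hv) : L2 →L[ℂ] L2) :=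
    ext_entries fun j k => by
      rw [hQ, mul_apply_eq_comp, creComm_diagOp_ket, map_smul]
      rfl
  have h₃ : oddCLM (P : L2 →L[ℂ] L2) Q = (scale θ)⁻¹ • (amp (x : L2 →L[ℂ] L2) ∘L
      (scale θ • oddCLM (annComm (diagOp hv) : L2 →L[ℂ] L2) (creComm (diagOp hv) : L2 →L[ℂ] L2))) := by
    rw [ContinuousLinearMap.comp_smul, smul_smul, inv_mul_cancel₀ (scale_ne_zero hθ), one_smul,
      amp_comp_oddCLM, h₁, h₂]
  rw [h₃]
  exact (moyal θ).oneForms.smul_mem _ (Submodule.subset_span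
    ⟨x.1, x.2, (diagOp hv).1, (diagOp hv).2, _, isCommutator_moyal θ _, rfl⟩)

/-- The square roots of the norms of the columns of an operator. -/
def colSqrt (Q : rapid) (k : ℕ) : ℂ := ((√‖(Q : L2 →L[ℂ] L2) (ket k)‖ : ℝ) : ℂ)

theorem rapidSeq_norm_col (Q : rapid) :
    RapidSeq fun k => ((‖(Q : L2 →L[ℂ] L2) (ket k)‖ : ℝ) : ℂ) := by
  intro p
  obtain ⟨c, -, hc⟩ := RapidMatrix.column Q.2 p
  refine ⟨c, fun k => ?_⟩
  rw [Complex.norm_real, norm_norm]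
  exact hc k

theorem rapidSeq_colSqrt (Q : rapid) : RapidSeq (colSqrt Q) :=
  (rapidSeq_norm_col Q).sqrt fun k => by
    rw [colSqrt, Complex.norm_real, Complex.norm_real, norm_norm,
      Real.norm_of_nonneg (Real.sqrt_nonneg _)]

theorem colSqrt_eq_zero {Q : rapid} {k : ℕ} (h : ∀ j, (Q : L2 →L[ℂ] L2) (ket k) j = 0) :
    colSqrt Q k = 0 := by
  have : (Q : L2 →L[ℂ] L2) (ket k) = 0 := lp.ext (funext h)
  simp [colSqrt, this]

theorem apply_ket_eq_zero {Q : rapid} {k : ℕ} (h : colSqrt Q k = 0) (j : ℕ) :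
    (Q : L2 →L[ℂ] L2) (ket k) j = 0 := by
  rw [colSqrt, Complex.ofReal_eq_zero, Real.sqrt_eq_zero (norm_nonneg _), norm_eq_zero] at h
  rw [h]
  rfl

/-- From `‖z‖ ≤ a` follows `‖z‖/√a ≤ √‖z‖`. Entries divided by the square root of the norm of their
column or row therefore still decay rapidly, and where that norm vanishes the convention `z/0 = 0`
is harmless. -/
theorem norm_le_sqrt_mul {z : ℂ} {a b : ℝ} (h : ‖z‖ ≤ a) (hb : 1 ≤ b) :
    ‖z / ((b : ℂ) * ((√a : ℝ) : ℂ))‖ ≤ √‖z‖ := by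
  have ha : 0 ≤ a := (norm_nonneg z).trans h
  rw [norm_div, norm_mul, Complex.norm_real, Complex.norm_real,
    Real.norm_of_nonneg (zero_le_one.trans hb), Real.norm_of_nonneg (Real.sqrt_nonneg _)]
  rcases ha.eq_or_lt with rfl | ha
  · simp
  rw [div_le_iff₀ (by positivity)]
  have h₁ : √‖z‖ * √‖z‖ = ‖z‖ := Real.mul_self_sqrt (norm_nonneg z)
  have h₂ : √‖z‖ ≤ √a := Real.sqrt_le_sqrt h
  calc ‖z‖ = √‖z‖ * √‖z‖ := h₁.symm
    _ ≤ √‖z‖ * √a := by gcongr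
    _ ≤ √‖z‖ * (b * √a) := by gcongr; exact le_mul_of_one_le_left (Real.sqrt_nonneg _) hb

theorem norm_apply_ket_le (Q : L2 →L[ℂ] L2) (j k : ℕ) : ‖Q (ket k) j‖ ≤ ‖Q (ket k)‖ :=
  lp.norm_apply_le_norm (by norm_num) _ j

/-- Take `v` to be the square roots of the column norms of `Q`, so `v` lives on indices `k ≡ r`
modulo 3. There `v_k - v_{k+1} = v_k`, and `x` is found by division. The unwanted half `x[𝔞, v]`
could only be nonzero at `k ≡ r + 2`, where both `v_k` and `v_{k-1}` vanish; spacing 2 would not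
suffice for this. -/
theorem oddCLM_zero_mem_of_support {θ : ℝ} (hθ : 0 < θ) (r : ℕ) (Q : rapid)
    (hr : ∀ k, k % 3 ≠ r → ∀ j, (Q : L2 →L[ℂ] L2) (ket k) j = 0) :
    oddCLM 0 (Q : L2 →L[ℂ] L2) ∈ (moyal θ).oneForms := by
  -- Column `l` of the factor solves `Q_{l-1} = √l · v_{l-1} · y_l`. Column 0 has no predecessor and
  -- is set to zero.
  let y : ℕ → ℕ → ℂ := fun j l => if l = 0 then 0 else
    (Q : L2 →L[ℂ] L2) (ket (l - 1)) j / (((√(l : ℝ) : ℝ) : ℂ) * colSqrt Q (l - 1))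
  have hy : RapidKernel y := by
    have h₁ : RapidKernel fun j k => ((√‖(Q : L2 →L[ℂ] L2) (ket k) j‖ : ℝ) : ℂ) :=
      (rapidKernel_of_mem Q).sqrt fun j k => by
        rw [Complex.norm_real, Real.norm_of_nonneg (Real.sqrt_nonneg _)]
    refine h₁.of_le id (fun l => l - 1) (fun j => by simp; omega) (fun j => by omega) 1 0
      fun j l => ?_
    rw [Complex.norm_real, Real.norm_of_nonneg (Real.sqrt_nonneg _), pow_zero, pow_zero, mul_one,
      mul_one, one_mul]
    by_cases hl : l = 0
    · simp [y, hl]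
    · simp only [y, if_neg hl]
      refine norm_le_sqrt_mul (norm_apply_ket_le _ _ _) (Real.one_le_sqrt.2 ?_)
      exact Nat.one_le_cast.2 (Nat.one_le_iff_ne_zero.2 hl)
  refine oddCLM_mem_of_entries hθ (rapidSeq_colSqrt Q) ⟨ofKernel hy, ofKernel_mem hy⟩ 0 Q
    (fun j k => ?_) fun j k => ?_
  · rw [ofKernel_ket_apply]
    refine Eq.symm (mul_eq_zero.2 ?_)
    -- The bound `2 ≤ k` guards the truncated subtraction. For `k ≤ 1` the factor is evaluated in
    -- column 0, which is zero.
    by_cases hk : 2 ≤ k ∧ (k - 2) % 3 = r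
    · left
      rw [colSqrt_eq_zero (hr k (by omega)), colSqrt_eq_zero (hr (k - 1) (by omega)), sub_zero,
        mul_zero]
    · right
      by_cases h : k - 1 = 0
      · simp [y, h]
      · have := hr (k - 1 - 1) (by omega) j
        simp [y, this]
  · rw [ofKernel_ket_apply]
    by_cases hk : colSqrt Q k = 0
    · simp [y, apply_ket_eq_zero hk]
    · have hk' : k % 3 = r := by
        by_contra h
        exact hk (colSqrt_eq_zero (hr k h))
      have h₁ : ((√((k : ℝ) + 1) : ℝ) : ℂ) ≠ 0 := Complex.ofReal_ne_zero.2 (by positivity)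
      rw [colSqrt_eq_zero (hr (k + 1) (by omega)), sub_zero]
      simp only [y, if_neg k.succ_ne_zero, Nat.add_sub_cancel, Nat.cast_succ]
      field_simp

/-- The mirror image with the shift reversed: column `l` of the factor is made from column `l + 1`
of `P`. Column 0 of `P` cannot be reached in this way because `𝔞|0⟩ = 0`, so it is assumed to
vanish. -/
theorem oddCLM_zero_mem_of_support' {θ : ℝ} (hθ : 0 < θ) (r : ℕ) (P : rapid)
    (hr : ∀ k, k % 3 ≠ r → ∀ j, (P : L2 →L[ℂ] L2) (ket k) j = 0)
    (h₀ : ∀ j, (P : L2 →L[ℂ] L2) (ket 0) j = 0) :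
    oddCLM (P : L2 →L[ℂ] L2) 0 ∈ (moyal θ).oneForms := by
  let y : ℕ → ℕ → ℂ := fun j l =>
    (P : L2 →L[ℂ] L2) (ket (l + 1)) j / (((√(l + 1 : ℝ) : ℝ) : ℂ) * colSqrt P (l + 1))
  have hy : RapidKernel y := by
    have h₁ : RapidKernel fun j k => ((√‖(P : L2 →L[ℂ] L2) (ket k) j‖ : ℝ) : ℂ) :=
      (rapidKernel_of_mem P).sqrt fun j k => by
        rw [Complex.norm_real, Real.norm_of_nonneg (Real.sqrt_nonneg _)]
    refine h₁.of_le id (fun l => l + 1) (fun j => by simp; omega) (fun j => by omega) 1 0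
      fun j l => ?_
    rw [Complex.norm_real, Real.norm_of_nonneg (Real.sqrt_nonneg _), pow_zero, pow_zero, mul_one,
      mul_one, one_mul]
    exact norm_le_sqrt_mul (norm_apply_ket_le _ _ _) (Real.one_le_sqrt.2 (by simp))
  refine oddCLM_mem_of_entries hθ (rapidSeq_colSqrt P) ⟨ofKernel hy, ofKernel_mem hy⟩ P 0
    (fun j k => ?_) fun j k => ?_
  · rw [ofKernel_ket_apply]
    rcases k with _ | k
    · simp [h₀]
    by_cases hk : colSqrt P (k + 1) = 0
    · simp [y, apply_ket_eq_zero hk]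
    · have hk' : (k + 1) % 3 = r := by
        by_contra h
        exact hk (colSqrt_eq_zero (hr _ h))
      have h₁ : ((√((k : ℝ) + 1) : ℝ) : ℂ) ≠ 0 := Complex.ofReal_ne_zero.2 (by positivity)
      rw [Nat.add_sub_cancel, colSqrt_eq_zero (hr k (by omega)), sub_zero]
      simp only [y, Nat.cast_succ]
      field_simp
  · rw [ofKernel_ket_apply]
    refine Eq.symm (mul_eq_zero.2 ?_)
    by_cases hk : (k + 2) % 3 = r
    · left
      rw [colSqrt_eq_zero (hr k (by omega)), colSqrt_eq_zero (hr (k + 1) (by omega)), sub_zero,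
        mul_zero]
    · right
      simp [y, hr (k + 1 + 1) hk j]

/-- The columns of `Q` with index in `p`. -/
def selectCols (p : ℕ → Prop) [DecidablePred p] (Q : rapid) : rapid :=
  have h : RapidKernel fun j k => if p k then (Q : L2 →L[ℂ] L2) (ket k) j else 0 :=
    (rapidKernel_of_mem Q).of_le id id (fun j => by simp; omega) (fun j => by simp; omega) 1 0
      fun j k => by
        split_ifs <;> simp
  ⟨ofKernel h, ofKernel_mem h⟩

theorem selectCols_ket (p : ℕ → Prop) [DecidablePred p] (Q : rapid) (j k : ℕ) :
    (selectCols p Q : L2 →L[ℂ] L2) (ket k) j =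
      if p k then (Q : L2 →L[ℂ] L2) (ket k) j else 0 :=
  ofKernel_ket_apply _ j k

theorem eq_sum_selectCols (Q : rapid) : (Q : L2 →L[ℂ] L2) =
    ∑ r ∈ Finset.range 3, (selectCols (fun k => k % 3 = r) Q : L2 →L[ℂ] L2) := by
  refine ext_entries fun j k => ?_
  rw [Finset.sum_range_succ, Finset.sum_range_succ, Finset.sum_range_one]
  change _ = (selectCols _ Q : L2 →L[ℂ] L2) (ket k) j + (selectCols _ Q : L2 →L[ℂ] L2) (ket k) j +
    (selectCols _ Q : L2 →L[ℂ] L2) (ket k) j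
  rw [selectCols_ket, selectCols_ket, selectCols_ket]
  have : k % 3 = 0 ∨ k % 3 = 1 ∨ k % 3 = 2 := by omega
  rcases this with h | h | h <;> simp [h]

variable {H₀ : Type} [NormedAddCommGroup H₀] [InnerProductSpace ℂ H₀]

theorem oddCLM_zero_sum (s : Finset ℕ) (f : ℕ → H₀ →L[ℂ] H₀) :
    oddCLM 0 (∑ i ∈ s, f i) = ∑ i ∈ s, oddCLM 0 (f i) := by
  induction s using Finset.induction_on with
  | empty => exact ContinuousLinearMap.ext fun v => spinor_ext (by simp) (by simp)
  | insert a s ha ih => rw [Finset.sum_insert ha, Finset.sum_insert ha, ← ih, ← oddCLM_add, add_zero]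

theorem oddCLM_sum_zero (s : Finset ℕ) (f : ℕ → H₀ →L[ℂ] H₀) :
    oddCLM (∑ i ∈ s, f i) 0 = ∑ i ∈ s, oddCLM (f i) 0 := by
  induction s using Finset.induction_on with
  | empty => exact ContinuousLinearMap.ext fun v => spinor_ext (by simp) (by simp)
  | insert a s ha ih => rw [Finset.sum_insert ha, Finset.sum_insert ha, ← ih, ← oddCLM_add, add_zero]

theorem oddCLM_zero_mem_moyal {θ : ℝ} (hθ : 0 < θ) (Q : rapid) :
    oddCLM 0 (Q : L2 →L[ℂ] L2) ∈ (moyal θ).oneForms := by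
  rw [eq_sum_selectCols Q, oddCLM_zero_sum]
  exact Submodule.sum_mem _ fun r _ => oddCLM_zero_mem_of_support hθ r _ fun k hk j => by
    rw [selectCols_ket, if_neg hk]

theorem oddCLM_mem_of_col_zero {θ : ℝ} (hθ : 0 < θ) (P : rapid)
    (h₀ : ∀ j, (P : L2 →L[ℂ] L2) (ket 0) j = 0) :
    oddCLM (P : L2 →L[ℂ] L2) 0 ∈ (moyal θ).oneForms := by
  rw [eq_sum_selectCols P, oddCLM_sum_zero]
  refine Submodule.sum_mem _ fun r _ => oddCLM_zero_mem_of_support' hθ r _ (fun k hk j => ?_)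
    fun j => ?_
  · rw [selectCols_ket, if_neg hk]
  · rw [selectCols_ket, h₀, ite_self]

/-- The one-forms contain all odd matrices of rapid decay operators. -/
theorem oddCLM_mem_moyal {θ : ℝ} (hθ : 0 < θ) (P Q : rapid) :
    oddCLM (P : L2 →L[ℂ] L2) Q ∈ (moyal θ).oneForms := by
  have hk : ∀ k, ket k ∈ rapidSeq := ket_mem_rapidSeq
  have hP : (P : L2 →L[ℂ] L2) (ket 0) ∈ rapidSeq := apply_mem_rapidSeq P.2 _
  -- `R` is column 0 of `P` moved to place 1, where the previous construction applies. Right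
  -- multiplication of the resulting one-form by `|1⟩⟨0|` moves it back.
  let R : rapid := ⟨ketBra ((P : L2 →L[ℂ] L2) (ket 0)) (ket 1), ketBra_mem_rapid hP (hk 1)⟩
  let S : compacts := ketBra (ket 1) (ket 0)
  have h₁ := oddCLM_mem_of_col_zero hθ (selectCols (fun k => k ≠ 0) P) fun j => by
    rw [selectCols_ket, if_neg (by simp)]
  have h₂ := oddCLM_mem_of_col_zero hθ R fun j => by
    rw [ketBra_ket_apply, ket_apply, if_neg (by decide), star_zero, mul_zero]
  have h₃ := (isSpectralTriple_moyal hθ).oneForms_comp_mem (a := S)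
    (ketBra_mem_rapid (hk 1) (hk 0)) h₂
  have e : (P : L2 →L[ℂ] L2) = (selectCols (fun k => k ≠ 0) P : L2 →L[ℂ] L2) +
      (R : L2 →L[ℂ] L2) * (S : L2 →L[ℂ] L2) := by
    refine ext_entries fun j k => ?_
    change _ = (selectCols (fun k => k ≠ 0) P : L2 →L[ℂ] L2) (ket k) j +
      ((R.1 * S : compacts) : L2 →L[ℂ] L2) (ket k) j
    rw [mul_ketBra, ketBra_ket_apply, selectCols_ket]
    change _ = _ + (ketBra ((P : L2 →L[ℂ] L2) (ket 0)) (ket 1) : L2 →L[ℂ] L2) (ket 1) j * _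
    rw [ketBra_ket_apply, ket_apply, ket_apply]
    rcases k with _ | k <;> simp
  have e₂ : oddCLM (P : L2 →L[ℂ] L2) Q = oddCLM (selectCols (fun k => k ≠ 0) P : L2 →L[ℂ] L2) 0 +
      oddCLM (R : L2 →L[ℂ] L2) 0 ∘L amp (S : L2 →L[ℂ] L2) + oddCLM 0 (Q : L2 →L[ℂ] L2) := by
    simp only [oddCLM_comp_amp, ← oddCLM_add, ← e, zero_mul, add_zero, zero_add]
  rw [e₂]
  exact Submodule.add_mem _ (Submodule.add_mem _ h₁ h₃) (oddCLM_zero_mem_moyal hθ Q)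

theorem isCommutator_moyal_unique {θ : ℝ} (hθ : 0 < θ) (T : rapid) {K : Spinor L2 →L[ℂ] Spinor L2}
    (hK : IsCommutator (moyal θ).D ((moyal θ).rep T.1) K) :
    K = scale θ • oddCLM (annComm T : L2 →L[ℂ] L2) (creComm T : L2 →L[ℂ] L2) :=
  hK.unique (isSpectralTriple_moyal hθ).dense_domain (isCommutator_moyal θ T)

theorem commutatorsMem_moyal {θ : ℝ} (hθ : 0 < θ) : CommutatorsMem (moyal θ) := by
  intro T hT K hK
  rw [isCommutator_moyal_unique hθ ⟨T, hT⟩ hK]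
  exact Submodule.smul_mem _ _ (oddCLM_mem_moyal hθ _ _)

end MoyalForms

/-! ## One-forms of the truncations -/

section TruncationForms

variable {n : ℕ}

theorem commutatorsMem_truncation (n : ℕ) (θ : ℝ) : CommutatorsMem (truncation n θ) := by
  intro a ha K hK
  refine Submodule.subset_span ⟨(1 : Matrix (Fin n) (Fin n) ℂ), trivial, a, ha, K, hK, ?_⟩
  rw [rep_truncation, matCLM_one]
  rfl

theorem truncD_commutator (θ : ℝ) (a : Matrix (Fin n) (Fin n) ℂ) :
    truncD n θ * amp (matCLM a) - amp (matCLM a) * truncD n θ = scale θ •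
      oddCLM (matCLM ((Xmat n).conjTranspose * a - a * (Xmat n).conjTranspose))
        (matCLM (Xmat n * a - a * Xmat n)) := by
  refine ContinuousLinearMap.ext fun v => spinor_ext ?_ ?_ <;>
  simp [truncD, smul_sub]

/-- Column 0 of `X_n` has the single entry `√1 = 1` in row 1, while row 0 vanishes. Hence `[X_n,
e₀₀] = e₁₀` and, by taking adjoints, `[X_n*, e₀₀] = -e₀₁`. -/
theorem Xmat_mul_single (hn : 2 ≤ n) :
    Xmat n * Matrix.single ⟨0, by omega⟩ ⟨0, by omega⟩ 1 =
      Matrix.single ⟨1, by omega⟩ ⟨0, by omega⟩ 1 := by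
  ext i j
  by_cases hj : j = ⟨0, by omega⟩
  · subst hj
    rw [Matrix.mul_single_apply_same, Matrix.single_apply, mul_one, Xmat, Matrix.of_apply]
    by_cases hi : (i : ℕ) = 1
    · have : i = ⟨1, by omega⟩ := Fin.ext hi
      simp [this]
    · rw [if_neg (by simpa using hi), if_neg fun h => hi (by rw [← h.1])]
  · rw [Matrix.mul_single_apply_of_ne _ _ _ _ _ hj, Matrix.single_apply,
      if_neg fun h => hj h.2.symm]

theorem single_mul_Xmat (hn : 2 ≤ n) :
    Matrix.single ⟨0, by omega⟩ ⟨0, by omega⟩ 1 * Xmat n = 0 := by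
  ext i j
  by_cases hi : i = ⟨0, by omega⟩
  · subst hi
    rw [Matrix.single_mul_apply_same, one_mul, Xmat, Matrix.of_apply, if_neg (by simp)]
    rfl
  · rw [Matrix.single_mul_apply_of_ne _ _ _ _ _ hi]
    rfl

/-- One-forms are closed under multiplication on both sides, so `a[D_n, b]c` is one; its entries are
`P` and `Q` up to the scale. -/
theorem oddCLM_mem_of_commutator {θ : ℝ} (hθ : 0 < θ) (a b c P Q : Matrix (Fin n) (Fin n) ℂ)
    (hP : a * ((Xmat n).conjTranspose * b - b * (Xmat n).conjTranspose) * c = P)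
    (hQ : a * (Xmat n * b - b * Xmat n) * c = Q) :
    oddCLM (matCLM P) (matCLM Q) ∈ (truncation n θ).oneForms := by
  have h₁ : amp (matCLM a) ∘L (scale θ •
      oddCLM (matCLM ((Xmat n).conjTranspose * b - b * (Xmat n).conjTranspose))
        (matCLM (Xmat n * b - b * Xmat n))) ∈ (truncation n θ).oneForms :=
    Submodule.subset_span ⟨a, trivial, b, trivial, _,
      (truncation_isCommutator_iff θ b _).2 (truncD_commutator θ b).symm, rfl⟩
  have h₂ := (isSpectralTriple_truncation n θ).oneForms_comp_mem (a := c) trivial h₁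
  have h₃ := (truncation n θ).oneForms.smul_mem (scale θ)⁻¹ h₂
  have e : oddCLM (matCLM P) (matCLM Q) = (scale θ)⁻¹ • ((amp (matCLM a) ∘L (scale θ •
      oddCLM (matCLM ((Xmat n).conjTranspose * b - b * (Xmat n).conjTranspose))
        (matCLM (Xmat n * b - b * Xmat n)))) ∘L amp (matCLM c)) := by
    rw [ContinuousLinearMap.comp_smul, ContinuousLinearMap.smul_comp, smul_smul,
      inv_mul_cancel₀ (scale_ne_zero hθ), one_smul, amp_comp_oddCLM, oddCLM_comp_amp,
      ← map_mul, ← map_mul, ← map_mul, ← map_mul, hP, hQ]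
  rw [e]
  exact h₃

theorem oddCLM_add_mem {θ : ℝ} {P Q P' Q' : Matrix (Fin n) (Fin n) ℂ}
    (h : oddCLM (matCLM P) (matCLM Q) ∈ (truncation n θ).oneForms)
    (h' : oddCLM (matCLM P') (matCLM Q') ∈ (truncation n θ).oneForms) :
    oddCLM (matCLM (P + P')) (matCLM (Q + Q')) ∈ (truncation n θ).oneForms := by
  rw [map_add, map_add, oddCLM_add]
  exact (truncation n θ).oneForms.add_mem h h'

/-- For `n ≥ 2`, the one-forms of the truncation are all odd matrices. -/
theorem oddCLM_mem_truncation (hn : 2 ≤ n) {θ : ℝ} (hθ : 0 < θ) (P Q : Matrix (Fin n) (Fin n) ℂ) :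
    oddCLM (matCLM P) (matCLM Q) ∈ (truncation n θ).oneForms := by
  have e₁ := Xmat_mul_single hn
  have e₂ := single_mul_Xmat hn
  have e₃ := congrArg Matrix.conjTranspose e₁
  have e₄ := congrArg Matrix.conjTranspose e₂
  rw [Matrix.conjTranspose_mul, Matrix.conjTranspose_single, Matrix.conjTranspose_single,
    star_one] at e₃
  rw [Matrix.conjTranspose_mul, Matrix.conjTranspose_single, Matrix.conjTranspose_zero,
    star_one] at e₄
  have h01 : (⟨0, by omega⟩ : Fin n) ≠ ⟨1, by omega⟩ := by simp
  have hQ : oddCLM (matCLM 0) (matCLM Q) ∈ (truncation n θ).oneForms := by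
    induction Q using Matrix.induction_on' with
    | h_zero =>
      exact oddCLM_mem_of_commutator hθ 0 0 0 0 0 (by simp) (by simp)
    | h_add Q Q' h h' => simpa only [add_zero] using oddCLM_add_mem h h'
    | h_std_basis i j x =>
      -- Multiplication by `x e_{i1}` on the left and by `e_{0j}` on the right turns `e₁₀` into `x
      -- e_{ij}` and kills `e₀₁`.
      refine oddCLM_mem_of_commutator hθ (Matrix.single i ⟨1, by omega⟩ x)
        (Matrix.single ⟨0, by omega⟩ ⟨0, by omega⟩ 1) (Matrix.single ⟨0, by omega⟩ j 1) 0 _ ?_ ?_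
      · rw [e₃, e₄, zero_sub, mul_neg, Matrix.single_mul_single_of_ne (h := h01.symm)]
        simp
      · rw [e₁, e₂, sub_zero, Matrix.single_mul_single_same, Matrix.single_mul_single_same]
        simp
  have hP : oddCLM (matCLM P) (matCLM 0) ∈ (truncation n θ).oneForms := by
    induction P using Matrix.induction_on' with
    | h_zero =>
      exact oddCLM_mem_of_commutator hθ 0 0 0 0 0 (by simp) (by simp)
    | h_add Q Q' h h' => simpa only [add_zero] using oddCLM_add_mem h h'
    | h_std_basis i j x =>
      -- Here `e₀₁` is kept and `e₁₀` is killed; the sign cancels that of `[X_n*, e₀₀] = -e₀₁`.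
      refine oddCLM_mem_of_commutator hθ (Matrix.single i ⟨0, by omega⟩ (-x))
        (Matrix.single ⟨0, by omega⟩ ⟨0, by omega⟩ 1) (Matrix.single ⟨1, by omega⟩ j 1) _ 0 ?_ ?_
      · rw [e₃, e₄, zero_sub, mul_neg, Matrix.single_mul_single_same, neg_mul,
          Matrix.single_mul_single_same, mul_one, mul_one]
        ext k l
        rw [Matrix.neg_apply, Matrix.single_apply, Matrix.single_apply]
        split_ifs <;> simp
      · rw [e₁, e₂, sub_zero, Matrix.single_mul_single_of_ne (h := h01)]
        simp
  simpa only [add_zero, zero_add] using oddCLM_add_mem hP hQ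

end TruncationForms

end MoritaCat

end

noncomputable section

namespace MoritaCat

open BimoduleData

/-! ## Identity correspondences of the Moyal plane -/

section MoyalId

theorem norm_row_le (a : L2 →L[ℂ] L2) (j k : ℕ) : ‖a (ket k) j‖ ≤ ‖star a (ket j)‖ := by
  have h : a (ket k) j = star (star a (ket j) k) := by
    rw [← inner_ket_left, ← inner_ket_left k, ContinuousLinearMap.star_eq_adjoint,
      ContinuousLinearMap.adjoint_inner_right, ← starRingEnd_apply, inner_conj_symm]
  rw [h, norm_star]
  exact lp.norm_apply_le_norm (by norm_num) _ k

theorem rapidKernel_div_sqrt (a : rapid) {γ : ℕ → ℝ}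
    (hγ : ∀ j k, ‖(a : L2 →L[ℂ] L2) (ket k) j‖ ≤ γ j) :
    RapidKernel fun j k => (a : L2 →L[ℂ] L2) (ket k) j / ((√(γ j) : ℝ) : ℂ) :=
  (rapidKernel_of_mem a).sqrt fun j k => by
    simpa using norm_le_sqrt_mul (hγ j k) le_rfl

theorem eq_diagOp_mul {v : ℕ → ℂ} (hv : RapidSeq v) (a c : compacts)
    (h : ∀ j k, (a : L2 →L[ℂ] L2) (ket k) j = v j * (c : L2 →L[ℂ] L2) (ket k) j) :
    a = (diagOp hv).1 * c :=
  compacts_ext fun j k => (h j k).trans (diagOp_apply hv _ j).symm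

theorem apply_eq_zero_of_row {a : L2 →L[ℂ] L2} {j : ℕ} (h : ∀ k, a (ket k) j = 0) (v : L2) :
    a v j = 0 :=
  (hasSum_coord a v j).unique (hasSum_zero.congr_fun fun k => by rw [h, zero_mul])

/-- Let `γ_j` be the sum of the norms of the `j`-th rows of `a₁` and `a₂`. The factor is the
diagonal operator with entries `√γ_j`, and the rows divided by `√γ_j` still decay rapidly. Where
`γ_j = 0` the divided rows are zero, so the diagonal operator can be cancelled on the values of the
quotients. -/
theorem hasCommonFactors_rapid (θ : ℝ) :
    HasCommonFactors (moyal θ) rapid.toNonUnitalSubalgebra.toSubmodule := by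
  intro (a₁ : compacts) h₁ (a₂ : compacts) h₂
  have h₁' : star a₁ ∈ rapid := star_mem h₁
  have h₂' : star a₂ ∈ rapid := star_mem h₂
  let γ : ℕ → ℝ := fun j => ‖star (a₁ : L2 →L[ℂ] L2) (ket j)‖ + ‖star (a₂ : L2 →L[ℂ] L2) (ket j)‖
  have hγ₁ : ∀ j k, ‖(a₁ : L2 →L[ℂ] L2) (ket k) j‖ ≤ γ j := fun j k =>
    (norm_row_le _ j k).trans (le_add_of_nonneg_right (norm_nonneg _))
  have hγ₂ : ∀ j k, ‖(a₂ : L2 →L[ℂ] L2) (ket k) j‖ ≤ γ j := fun j k =>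
    (norm_row_le _ j k).trans (le_add_of_nonneg_left (norm_nonneg _))
  have hγ₀ : ∀ j, 0 ≤ γ j := fun j => by positivity
  have hγ : RapidSeq fun j => ((γ j : ℝ) : ℂ) := by
    intro p
    obtain ⟨c, hc⟩ := rapidSeq_norm_col ⟨_, h₁'⟩ p
    obtain ⟨d, hd⟩ := rapidSeq_norm_col ⟨_, h₂'⟩ p
    refine ⟨c + d, fun k => ?_⟩
    have hc' := hc k
    have hd' := hd k
    rw [Complex.norm_real, norm_norm] at hc' hd'
    rw [Complex.norm_real, Real.norm_of_nonneg (hγ₀ k), mul_add]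
    exact add_le_add hc' hd'
  have hβ : RapidSeq fun j => ((√(γ j) : ℝ) : ℂ) := hγ.sqrt fun k => by
    rw [Complex.norm_real, Complex.norm_real, Real.norm_of_nonneg (hγ₀ k),
      Real.norm_of_nonneg (Real.sqrt_nonneg _)]
  have hc₁ := rapidKernel_div_sqrt ⟨a₁, h₁⟩ hγ₁
  have hc₂ := rapidKernel_div_sqrt ⟨a₂, h₂⟩ hγ₂
  have hz : ∀ (a : L2 →L[ℂ] L2) (j k : ℕ), ‖a (ket k) j‖ ≤ γ j → ((√(γ j) : ℝ) : ℂ) = 0 →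
      a (ket k) j = 0 := fun a j k h h' => by
    rw [Complex.ofReal_eq_zero, Real.sqrt_eq_zero (hγ₀ j)] at h'
    rwa [h', norm_le_zero_iff] at h
  have hdiv : ∀ (a : L2 →L[ℂ] L2) (j k : ℕ), ‖a (ket k) j‖ ≤ γ j →
      a (ket k) j = ((√(γ j) : ℝ) : ℂ) * (a (ket k) j / ((√(γ j) : ℝ) : ℂ)) := fun a j k h => by
    by_cases h' : ((√(γ j) : ℝ) : ℂ) = 0
    · rw [h', zero_mul, hz a j k h h']
    · rw [mul_div_cancel₀ _ h']
  refine ⟨(diagOp hβ).1, (diagOp hβ).2, ofKernel hc₁, ofKernel_mem hc₁, ofKernel hc₂,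
    ofKernel_mem hc₂, ?_, ?_, ?_⟩
  · exact eq_diagOp_mul hβ _ _ fun j k => by
      rw [ofKernel_ket_apply]
      exact hdiv a₁ j k (hγ₁ j k)
  · exact eq_diagOp_mul hβ _ _ fun j k => by
      rw [ofKernel_ket_apply]
      exact hdiv a₂ j k (hγ₂ j k)
  · intro (ψ₁ : Spinor L2) (ψ₂ : Spinor L2) h
    have h' : amp (diagOp hβ : L2 →L[ℂ] L2) (amp (ofKernel hc₁ : L2 →L[ℂ] L2) ψ₁ +
        amp (ofKernel hc₂ : L2 →L[ℂ] L2) ψ₂) = 0 := h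
    change amp (ofKernel hc₁ : L2 →L[ℂ] L2) ψ₁ + amp (ofKernel hc₂ : L2 →L[ℂ] L2) ψ₂ = 0
    ext i j
    have hij := congrArg (fun v : Spinor L2 => v i j) h'
    simp only [amp_apply] at hij
    rw [diagOp_apply] at hij
    rcases mul_eq_zero.1 hij with h₀ | h₀
    · have e₁ := apply_eq_zero_of_row (a := (ofKernel hc₁ : L2 →L[ℂ] L2)) (j := j)
        (fun k => by rw [ofKernel_ket_apply, h₀, div_zero]) (ψ₁ i)
      have e₂ := apply_eq_zero_of_row (a := (ofKernel hc₂ : L2 →L[ℂ] L2)) (j := j)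
        (fun k => by rw [ofKernel_ket_apply, h₀, div_zero]) (ψ₂ i)
      change (ofKernel hc₁ : L2 →L[ℂ] L2) (ψ₁ i) j + (ofKernel hc₂ : L2 →L[ℂ] L2) (ψ₂ i) j = 0
      rw [e₁, e₂, add_zero]
    · exact h₀

/-- If `[𝔞, a] = bc₁` and `[𝔞†, a] = bc₂`, then `[D, a]` is `b` times the odd matrix of `c₁` and
`c₂`, which is a one-form because all odd matrices over `𝒮(ℕ²)` are. -/
theorem commutatorsFactor_moyal {θ : ℝ} (hθ : 0 < θ) {F : Submodule ℂ compacts}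
    (hF : ∀ a ∈ F, a ∈ rapid) (hc : HasCommonFactors (moyal θ) F)
    (h : ∀ a : rapid, a.1 ∈ F → (annComm a).1 ∈ F ∧ (creComm a).1 ∈ F) :
    CommutatorsFactor (moyal θ) F := by
  intro a ha K hK
  obtain ⟨(b : compacts), hb, (c₁ : compacts), hc₁, (c₂ : compacts), hc₂, e₁, e₂, -⟩ :=
    hc _ (h ⟨a, hF a ha⟩ ha).1 _ (h ⟨a, hF a ha⟩ ha).2
  have e₁' : (annComm ⟨a, hF a ha⟩ : L2 →L[ℂ] L2) = (b : L2 →L[ℂ] L2) * (c₁ : L2 →L[ℂ] L2) :=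
    congrArg Subtype.val e₁
  have e₂' : (creComm ⟨a, hF a ha⟩ : L2 →L[ℂ] L2) = (b : L2 →L[ℂ] L2) * (c₂ : L2 →L[ℂ] L2) :=
    congrArg Subtype.val e₂
  refine ⟨b, hb, _, (moyal θ).oneForms.smul_mem (scale θ)
    (oddCLM_mem_moyal hθ ⟨c₁, hc₁⟩ ⟨c₂, hc₂⟩), ?_⟩
  rw [isCommutator_moyal_unique hθ ⟨a, hF a ha⟩ hK, e₁', e₂', ← amp_comp_oddCLM]
  exact (ContinuousLinearMap.comp_smul _ _ _).symm

theorem dense_of_ketBra {F : Submodule ℂ compacts} (hket : ∀ j k, ketBra (ket j) (ket k) ∈ F) :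
    Dense (F : Set compacts) := by
  have hd := dense_span_ketBra
  rw [← Submodule.dense_iff_topologicalClosure_eq_top] at hd
  refine hd.mono (Submodule.span_le.2 ?_)
  rintro _ ⟨j, k, rfl⟩
  exact hket j k

theorem hasCore_of_ketBra {θ : ℝ} (hθ : 0 < θ) {F : Submodule ℂ compacts}
    (hF : ∀ a ∈ F, a ∈ rapid) (hket : ∀ j k, ketBra (ket j) (ket k) ∈ F) :
    (moyal θ).D.HasCore (Submodule.span ℂ {φ : Spinor L2 | ∃ (a : F)
      (ψ : (oddOp (scale θ) ann cre).domain), φ = amp (a.1 : L2 →L[ℂ] L2) ψ.1}) := by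
  let S : Submodule ℂ (Spinor L2) := Submodule.span ℂ {φ : Spinor L2 | ∃ (a : F)
      (ψ : (oddOp (scale θ) ann cre).domain), φ = amp (a.1 : L2 →L[ℂ] L2) ψ.1}
  have h₁ : S ≤ (oddOp (scale θ) ann cre).domain := by
    refine Submodule.span_le.2 ?_
    rintro _ ⟨a, ψ, rfl⟩ i
    have := apply_mem_rapidSeq (hF a.1 a.2) (ψ.1 i)
    exact ⟨rapidSeq_le_ann this, rapidSeq_le_cre this⟩
  have h₂ : ∀ i k, spin i (ket k) ∈ S := fun i k => Submodule.subset_span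
    ⟨⟨_, hket k k⟩, ⟨spin i (ket k), spin_mem_domain (θ := θ) (ket_mem_ann k) i⟩,
      (amp_ketBra_spin i k k).symm⟩
  exact hasCore_moyal hθ h₁ h₂

theorem idCorrOn_moyal_isCorrespondence {θ : ℝ} (hθ : 0 < θ) {F : Submodule ℂ compacts}
    (hF : ∀ a ∈ F, a ∈ rapid) (hket : ∀ j k, ketBra (ket j) (ket k) ∈ F)
    (hFr : ∀ a ∈ F, ∀ b ∈ rapid, a * b ∈ F) (hFl : ∀ b ∈ rapid, ∀ a ∈ F, b * a ∈ F)
    (hc : HasCommonFactors (moyal θ) F)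
    (h : ∀ a : rapid, a.1 ∈ F → (annComm a).1 ∈ F ∧ (creComm a).1 ∈ F) :
    IsCorrespondence (idCorrOn (moyal θ) F) := by
  exact idCorrOn_isCorrespondence (isSpectralTriple_moyal hθ) (commutatorsMem_moyal hθ)
    (selfBimodule_isMorita _) hF (dense_of_ketBra hket) hFr hFl hc
    (commutatorsFactor_moyal hθ hF hc h) (hasCore_of_ketBra hθ hF hket)

theorem idCorr_moyal_isCorrespondence {θ : ℝ} (hθ : 0 < θ) : IsCorrespondence (idCorr (moyal θ)) :=
  idCorrOn_moyal_isCorrespondence hθ (F := rapid.toNonUnitalSubalgebra.toSubmodule)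
    (fun _ h => h) (fun j k => ketBra_mem_rapid (ket_mem_rapidSeq j) (ket_mem_rapidSeq k))
    (fun _ ha _ hb => mul_mem (S := NonUnitalStarSubalgebra ℂ compacts) ha hb)
    (fun _ ha _ hb => mul_mem (S := NonUnitalStarSubalgebra ℂ compacts) ha hb)
    (hasCommonFactors_rapid θ) fun a _ => ⟨(annComm a).2, (creComm a).2⟩

theorem idConnIsCommutator_moyal {θ : ℝ} (hθ : 0 < θ) : IdConnIsCommutator (moyal θ) :=
  idConnIsCommutator (isSpectralTriple_moyal hθ) (hasCommonFactors_rapid θ)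
    (commutatorsFactor_moyal hθ (F := rapid.toNonUnitalSubalgebra.toSubmodule) (fun _ h => h)
      (hasCommonFactors_rapid θ) fun a _ => ⟨(annComm a).2, (creComm a).2⟩)

/-- The operators of finite rank and rapid decay. -/
def finRank : Submodule ℂ compacts :=
  Submodule.span ℂ {x | ∃ η ∈ rapidSeq, ∃ ξ ∈ rapidSeq, x = ketBra η ξ}

theorem ketBra_mem_finRank {η ξ : L2} (hη : η ∈ rapidSeq) (hξ : ξ ∈ rapidSeq) :
    ketBra η ξ ∈ finRank := Submodule.subset_span ⟨η, hη, ξ, hξ, rfl⟩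

theorem finRank_le : finRank ≤ rapid.toNonUnitalSubalgebra.toSubmodule := by
  refine Submodule.span_le.2 ?_
  rintro _ ⟨η, hη, ξ, hξ, rfl⟩
  exact ketBra_mem_rapid hη hξ

theorem finRank_mul {a b : compacts} (ha : a ∈ finRank) (hb : b ∈ rapid) : a * b ∈ finRank := by
  have hb' : star b ∈ rapid := star_mem hb
  have h : finRank ≤ finRank.comap (LinearMap.mulRight ℂ b) := by
    refine Submodule.span_le.2 ?_
    rintro _ ⟨η, hη, ξ, hξ, rfl⟩
    change ketBra η ξ * b ∈ finRank
    rw [ketBra_mul]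
    exact ketBra_mem_finRank hη (apply_mem_rapidSeq hb' ξ)
  exact h ha

theorem mul_finRank {a b : compacts} (hb : b ∈ rapid) (ha : a ∈ finRank) : b * a ∈ finRank := by
  have h : finRank ≤ finRank.comap (LinearMap.mulLeft ℂ b) := by
    refine Submodule.span_le.2 ?_
    rintro _ ⟨η, hη, ξ, hξ, rfl⟩
    change b * ketBra η ξ ∈ finRank
    rw [mul_ketBra]
    exact ketBra_mem_finRank (apply_mem_rapidSeq hb η) hξ
  exact h ha

theorem exists_finiteDimensional_range {a : compacts} (ha : a ∈ finRank) :
    ∃ W : Submodule ℂ L2, FiniteDimensional ℂ W ∧ W ≤ rapidSeq ∧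
      ∀ v, (a : L2 →L[ℂ] L2) v ∈ W := by
  induction ha using Submodule.span_induction with
  | mem x hx =>
    obtain ⟨η, hη, ξ, hξ, rfl⟩ := hx
    refine ⟨Submodule.span ℂ {η}, inferInstance, (Submodule.span_singleton_le_iff_mem _ _).2 hη,
      fun v => ?_⟩
    rw [ketBra_apply]
    exact Submodule.smul_mem _ _ (Submodule.mem_span_singleton_self η)
  | zero => exact ⟨⊥, inferInstance, bot_le, fun v => rfl⟩
  | add x y _ _ hx hy =>
    obtain ⟨W, h₁, h₂, h₃⟩ := hx
    obtain ⟨W', h₁', h₂', h₃'⟩ := hy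
    exact ⟨W ⊔ W', inferInstance, sup_le h₂ h₂', fun v => Submodule.add_mem_sup (h₃ v) (h₃' v)⟩
  | smul c x _ hx =>
    obtain ⟨W, h₁, h₂, h₃⟩ := hx
    exact ⟨W, h₁, h₂, fun v => W.smul_mem c (h₃ v)⟩

theorem exists_finRank_projection {W : Submodule ℂ L2} [FiniteDimensional ℂ W] (hW : W ≤ rapidSeq) :
    ∃ b ∈ finRank, ∀ v ∈ W, (b : L2 →L[ℂ] L2) v = v := by
  let w := stdOrthonormalBasis ℂ W
  refine ⟨∑ k, ketBra (w k) (w k), Submodule.sum_mem _ fun k _ =>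
    ketBra_mem_finRank (hW (w k).2) (hW (w k).2), fun v hv => ?_⟩
  have h := congrArg Subtype.val (w.sum_repr' ⟨v, hv⟩)
  rw [Submodule.coe_sum] at h
  refine Eq.trans ?_ h
  rw [AddSubmonoidClass.coe_finsetSum, sum_apply]
  rfl

/-- The common factor is the orthogonal projection onto a finite-dimensional space of rapid decay
vectors that contains both ranges. It fixes both elements, so they serve as their own quotients. -/
theorem hasCommonFactors_finRank (θ : ℝ) : HasCommonFactors (moyal θ) finRank := by
  intro (a₁ : compacts) h₁ (a₂ : compacts) h₂
  obtain ⟨W₁, f₁, r₁, i₁⟩ := exists_finiteDimensional_range h₁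
  obtain ⟨W₂, f₂, r₂, i₂⟩ := exists_finiteDimensional_range h₂
  obtain ⟨b, hb, hbW⟩ := exists_finRank_projection (sup_le r₁ r₂)
  have e₁ : ∀ v, (a₁ : L2 →L[ℂ] L2) v ∈ W₁ ⊔ W₂ := fun v => Submodule.mem_sup_left (i₁ v)
  have e₂ : ∀ v, (a₂ : L2 →L[ℂ] L2) v ∈ W₁ ⊔ W₂ := fun v => Submodule.mem_sup_right (i₂ v)
  refine ⟨b, hb, a₁, finRank_le h₁, a₂, finRank_le h₂, ?_, ?_, ?_⟩
  · exact Subtype.ext (ContinuousLinearMap.ext fun v => (hbW _ (e₁ v)).symm)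
  · exact Subtype.ext (ContinuousLinearMap.ext fun v => (hbW _ (e₂ v)).symm)
  · intro (ψ₁ : Spinor L2) (ψ₂ : Spinor L2) h
    have h' : amp (b : L2 →L[ℂ] L2) (amp (a₁ : L2 →L[ℂ] L2) ψ₁ +
        amp (a₂ : L2 →L[ℂ] L2) ψ₂) = 0 := h
    have e : amp (b : L2 →L[ℂ] L2) (amp (a₁ : L2 →L[ℂ] L2) ψ₁ + amp (a₂ : L2 →L[ℂ] L2) ψ₂) =
        amp (a₁ : L2 →L[ℂ] L2) ψ₁ + amp (a₂ : L2 →L[ℂ] L2) ψ₂ := by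
      ext1 i
      exact hbW _ (add_mem (e₁ _) (e₂ _))
    exact e.symm.trans h'

/-! ### Commutators of finite-rank operators. -/

theorem annComm_add (S T : rapid) : annComm (S + T) = annComm S + annComm T := by
  refine Subtype.ext (compacts_ext fun j k => ?_)
  change _ = (annComm S : L2 →L[ℂ] L2) (ket k) j + (annComm T : L2 →L[ℂ] L2) (ket k) j
  rw [annComm_ket, annComm_ket, annComm_ket]
  refine Eq.trans ?_ (add_sub_add_comm _ _ _ _)
  exact congrArg₂ (fun x y : ℂ => x - y) (congrFun (annSeq.map_add _ _) j)
    (congrFun (creSeq.map_add _ _) k)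

theorem creComm_add (S T : rapid) : creComm (S + T) = creComm S + creComm T := by
  refine Subtype.ext (compacts_ext fun j k => ?_)
  change _ = (creComm S : L2 →L[ℂ] L2) (ket k) j + (creComm T : L2 →L[ℂ] L2) (ket k) j
  rw [creComm_ket, creComm_ket, creComm_ket]
  refine Eq.trans ?_ (add_sub_add_comm _ _ _ _)
  exact congrArg₂ (fun x y : ℂ => x - y) (congrFun (creSeq.map_add _ _) j)
    (congrFun (annSeq.map_add _ _) k)

theorem annComm_smul (c : ℂ) {S T : rapid} (h : S.1 = c • T.1) :
    (annComm S).1 = c • (annComm T).1 := by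
  have h' : ∀ k, (S : L2 →L[ℂ] L2) (ket k) = c • (T : L2 →L[ℂ] L2) (ket k) := fun k => by
    rw [h]
    rfl
  refine compacts_ext fun j k => ?_
  change _ = c * (annComm T : L2 →L[ℂ] L2) (ket k) j
  rw [annComm_ket, annComm_ket, mul_sub]
  simp only [h']
  exact congrArg₂ (fun x y : ℂ => x - y) (congrFun (annSeq.map_smul c _) j)
    (congrFun (creSeq.map_smul c _) k)

theorem creComm_smul (c : ℂ) {S T : rapid} (h : S.1 = c • T.1) :
    (creComm S).1 = c • (creComm T).1 := by
  have h' : ∀ k, (S : L2 →L[ℂ] L2) (ket k) = c • (T : L2 →L[ℂ] L2) (ket k) := fun k => by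
    rw [h]
    rfl
  refine compacts_ext fun j k => ?_
  change _ = c * (creComm T : L2 →L[ℂ] L2) (ket k) j
  rw [creComm_ket, creComm_ket, mul_sub]
  simp only [h']
  exact congrArg₂ (fun x y : ℂ => x - y) (congrFun (creSeq.map_smul c _) j)
    (congrFun (annSeq.map_smul c _) k)

theorem ann_mem_rapidSeq {v : L2} (hv : v ∈ rapidSeq) : ann ⟨v, rapidSeq_le_ann hv⟩ ∈ rapidSeq :=
  rapidSeq_ann hv

theorem cre_mem_rapidSeq {v : L2} (hv : v ∈ rapidSeq) : cre ⟨v, rapidSeq_le_cre hv⟩ ∈ rapidSeq :=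
  rapidSeq_cre hv

theorem annComm_ketBra {η ξ : L2} (hη : η ∈ rapidSeq) (hξ : ξ ∈ rapidSeq) :
    (annComm ⟨ketBra η ξ, ketBra_mem_rapid hη hξ⟩).1 =
      ketBra (ann ⟨η, rapidSeq_le_ann hη⟩) ξ - ketBra η (cre ⟨ξ, rapidSeq_le_cre hξ⟩) := by
  refine compacts_ext fun j k => ?_
  change _ = (ketBra (ann ⟨η, rapidSeq_le_ann hη⟩) ξ : L2 →L[ℂ] L2) (ket k) j -
    (ketBra η (cre ⟨ξ, rapidSeq_le_cre hξ⟩) : L2 →L[ℂ] L2) (ket k) j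
  rw [annComm_ket, ketBra_ket_apply, ketBra_ket_apply, ann_apply, cre_apply, annSeq_apply,
    annSeq_apply]
  simp only [ketBra_ket_apply]
  rcases k with _ | k
  · simp [mul_assoc]
  · rw [creSeq_succ, creSeq_succ]
    simp
    ring

theorem creComm_ketBra {η ξ : L2} (hη : η ∈ rapidSeq) (hξ : ξ ∈ rapidSeq) :
    (creComm ⟨ketBra η ξ, ketBra_mem_rapid hη hξ⟩).1 =
      ketBra (cre ⟨η, rapidSeq_le_cre hη⟩) ξ - ketBra η (ann ⟨ξ, rapidSeq_le_ann hξ⟩) := by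
  refine compacts_ext fun j k => ?_
  change _ = (ketBra (cre ⟨η, rapidSeq_le_cre hη⟩) ξ : L2 →L[ℂ] L2) (ket k) j -
    (ketBra η (ann ⟨ξ, rapidSeq_le_ann hξ⟩) : L2 →L[ℂ] L2) (ket k) j
  rw [creComm_ket, ketBra_ket_apply, ketBra_ket_apply, ann_apply, cre_apply, annSeq_apply,
    annSeq_apply]
  simp only [ketBra_ket_apply]
  rcases j with _ | j
  · simp
    ring
  · rw [creSeq_succ, creSeq_succ]
    simp
    ring

/-- On generators, `[𝔞, |η⟩⟨ξ|] = |𝔞η⟩⟨ξ| - |η⟩⟨𝔞†ξ|`, and likewise for `𝔞†`; the spaces of rapid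
decay are preserved. -/
theorem comm_mem_finRank (a : rapid) (ha : a.1 ∈ finRank) :
    (annComm a).1 ∈ finRank ∧ (creComm a).1 ∈ finRank := by
  obtain ⟨a, ha'⟩ := a
  change a ∈ finRank at ha
  revert ha'
  refine Submodule.span_induction (p := fun a _ => ∀ ha' : a ∈ rapid,
    (annComm ⟨a, ha'⟩).1 ∈ finRank ∧ (creComm ⟨a, ha'⟩).1 ∈ finRank) ?_ ?_ ?_ ?_ ha
  · rintro _ ⟨η, hη, ξ, hξ, rfl⟩ _
    exact ⟨(annComm_ketBra hη hξ).symm ▸ sub_mem (ketBra_mem_finRank (ann_mem_rapidSeq hη) hξ)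
      (ketBra_mem_finRank hη (cre_mem_rapidSeq hξ)),
      (creComm_ketBra hη hξ).symm ▸ sub_mem (ketBra_mem_finRank (cre_mem_rapidSeq hη) hξ)
      (ketBra_mem_finRank hη (ann_mem_rapidSeq hξ))⟩
  · intro h
    have e : (⟨0, h⟩ : rapid).1 = (0 : ℂ) • (⟨0, h⟩ : rapid).1 := (zero_smul _ _).symm
    rw [annComm_smul 0 e, creComm_smul 0 e, zero_smul, zero_smul]
    exact ⟨zero_mem _, zero_mem _⟩
  · intro x y hx hy h h' hxy
    have e : (⟨x + y, hxy⟩ : rapid) = ⟨x, finRank_le hx⟩ + ⟨y, finRank_le hy⟩ := rfl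
    rw [e, annComm_add, creComm_add]
    exact ⟨add_mem (h _).1 (h' _).1, add_mem (h _).2 (h' _).2⟩
  · intro c x hx h hcx
    have e : (⟨c • x, hcx⟩ : rapid).1 = c • (⟨x, finRank_le hx⟩ : rapid).1 := rfl
    rw [annComm_smul c e, creComm_smul c e]
    exact ⟨finRank.smul_mem c (h _).1, finRank.smul_mem c (h _).2⟩

theorem idCorrOn_finRank_isCorrespondence {θ : ℝ} (hθ : 0 < θ) :
    IsCorrespondence (idCorrOn (moyal θ) finRank) :=
  idCorrOn_moyal_isCorrespondence hθ finRank_le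
    (fun j k => ketBra_mem_finRank (ket_mem_rapidSeq j) (ket_mem_rapidSeq k))
    (fun _ ha _ hb => finRank_mul ha hb) (fun _ hb _ ha => mul_finRank hb ha)
    (hasCommonFactors_finRank θ) comm_mem_finRank

end MoyalId

/-! ## Identity correspondences of the truncations -/

section TruncationId

variable (n : ℕ) (θ : ℝ)

theorem hasCommonFactors_top : HasCommonFactors (truncation n θ) ⊤ := by
  have h1 : (truncation n θ).rep (1 : Matrix (Fin n) (Fin n) ℂ) = 1 := by
    rw [rep_truncation, matCLM_one]
    rfl
  intro (a₁ : Matrix (Fin n) (Fin n) ℂ) _ (a₂ : Matrix (Fin n) (Fin n) ℂ) _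
  refine ⟨(1 : Matrix (Fin n) (Fin n) ℂ), trivial, a₁, trivial, a₂, trivial, (Matrix.one_mul _).symm,
    (Matrix.one_mul _).symm, fun ψ₁ ψ₂ h => ?_⟩
  rw [h1] at h
  exact h

theorem commutatorsFactor_top : CommutatorsFactor (truncation n θ) ⊤ := by
  intro a _ K hK
  refine ⟨(1 : Matrix (Fin n) (Fin n) ℂ), trivial, K,
    commutatorsMem_truncation n θ a trivial K hK, ?_⟩
  rw [rep_truncation, matCLM_one]
  rfl

theorem idCorr_truncation_isCorrespondence : IsCorrespondence (idCorr (truncation n θ)) := by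
  refine idCorrOn_isCorrespondence (F := ⊤) (isSpectralTriple_truncation n θ)
    (commutatorsMem_truncation n θ) (selfBimodule_isMorita _) (fun _ _ => trivial) dense_univ
    (fun _ _ _ _ => trivial) (fun _ _ _ _ => trivial) (hasCommonFactors_top n θ)
    (commutatorsFactor_top n θ) (hasCore_truncation n θ ?_)
  refine top_le_iff.1 fun ψ _ => Submodule.subset_span
    ⟨⟨(1 : Matrix (Fin n) (Fin n) ℂ), trivial⟩, ⟨ψ, truncation_mem_domain θ ψ⟩, ?_⟩
  rw [rep_truncation, matCLM_one]
  rfl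

theorem idConnIsCommutator_truncation : IdConnIsCommutator (truncation n θ) :=
  idConnIsCommutator (isSpectralTriple_truncation n θ) (hasCommonFactors_top n θ)
    (commutatorsFactor_top n θ)

end TruncationId

end MoritaCat

end

noncomputable section

namespace MoritaCat

open BimoduleData

/-! ## The bimodules are Morita equivalences -/

section Bimod

variable {n : ℕ}

open MatrixOrder in
theorem isPos_gram {E : Type} [NormedAddCommGroup E] [InnerProductSpace ℂ E] (η : Fin n → E) :
    IsPos (Matrix.of fun i j => ⟪η i, η j⟫_ℂ) :=
  CStarAlgebra.nonneg_iff_eq_star_mul_self.mp (Matrix.posSemidef_gram ℂ η).nonneg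

theorem isPos_ketBra (η : L2) : IsPos (ketBra η η) := by
  -- Any unit vector in place of `|0⟩` would do: `|η⟩⟨0|0⟩⟨η| = |η⟩⟨η|`.
  refine ⟨ketBra (ket 0) η, ?_⟩
  rw [star_ketBra, mul_ketBra, ketBra_apply, inner_ket_left, ket_apply, if_pos rfl, one_smul]

/-- The matrix of inner products `⟨η_i, ξ_j⟩`. -/
def gramMat (η ξ : Fin n → L2) : Matrix (Fin n) (Fin n) ℂ := Matrix.of fun i j => ⟪η i, ξ j⟫_ℂ

/-- The operator `∑ |η_i⟩⟨ξ_i|`. -/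
def ketBraSum (η ξ : Fin n → L2) : compacts := ∑ i, ketBra (η i) (ξ i)

theorem gramMat_apply (η ξ : Fin n → L2) (i j : Fin n) :
    gramMat η ξ i j = ⟪η i, ξ j⟫_ℂ := rfl

theorem rowMat_apply (η : Fin n → L2) (a : Matrix (Fin n) (Fin n) ℂ) (j : Fin n) :
    rowMat n η a j = ∑ i, a i j • η i := rfl

theorem ketBraSum_apply (η ξ : Fin n → L2) (v : L2) :
    (ketBraSum η ξ : L2 →L[ℂ] L2) v = ∑ i, ⟪ξ i, v⟫_ℂ • η i := by
  rw [ketBraSum, AddSubmonoidClass.coe_finsetSum, sum_apply]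
  rfl

theorem gramMat_rowMat (η ξ : Fin n → L2) (a b : Matrix (Fin n) (Fin n) ℂ) :
    gramMat (rowMat n η a) (rowMat n ξ b) = star a * gramMat η ξ * b := by
  ext i j
  rw [gramMat_apply, rowMat_apply, rowMat_apply, Matrix.mul_apply, inner_sum]
  refine Finset.sum_congr rfl fun k _ => ?_
  rw [inner_smul_right, Matrix.mul_apply, sum_inner, mul_comm]
  refine congrArg (· * b k j) (Finset.sum_congr rfl fun l _ => ?_)
  rw [inner_smul_left]
  rfl

theorem ketBraSum_rowMat (η ξ : Fin n → L2) (a : Matrix (Fin n) (Fin n) ℂ) :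
    ketBraSum (rowMat n η a) ξ = ketBraSum η (rowMat n ξ (star a)) := by
  refine Subtype.ext (ContinuousLinearMap.ext fun v => ?_)
  rw [ketBraSum_apply, ketBraSum_apply]
  simp only [rowMat_apply, Finset.smul_sum, sum_inner, Finset.sum_smul, inner_smul_left]
  rw [Finset.sum_comm]
  refine Finset.sum_congr rfl fun k _ => Finset.sum_congr rfl fun l _ => ?_
  rw [smul_smul, Matrix.star_apply, starRingEnd_apply, star_star, mul_comm]

theorem rowMat_mul (η : Fin n → L2) (a b : Matrix (Fin n) (Fin n) ℂ) :
    rowMat n η (a * b) = rowMat n (rowMat n η a) b := by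
  ext1 j
  simp only [rowMat_apply, Matrix.mul_apply, Finset.sum_smul, Finset.smul_sum, smul_smul]
  rw [Finset.sum_comm]
  simp only [mul_comm]

/-! ### The two Hilbert module norms: definiteness and completeness. -/

theorem norm_entry_le (M : Matrix (Fin n) (Fin n) ℂ) (i j : Fin n) : ‖M i j‖ ≤ ‖M‖ := by
  have h₁ := Matrix.l2_opNorm_mulVec M (EuclideanSpace.single j 1)
  rw [PiLp.norm_single, norm_one, mul_one] at h₁
  refine le_trans ?_ h₁
  refine le_trans (le_of_eq ?_) (PiLp.norm_apply_le _ i)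
  simp

theorem norm_le_bimod_rnorm (η : Fin n → L2) (i : Fin n) : ‖η i‖ ≤ (bimod n).rnorm η := by
  refine Real.le_sqrt_of_sq_le ?_
  refine le_trans (le_of_eq ?_) (norm_entry_le (gramMat η η) i i)
  rw [gramMat_apply, inner_self_eq_norm_sq_to_K]
  simp

/-- For `S = ∑ |η_k⟩⟨η_k|` one has `‖η_i‖⁴ ≤ ∑ |⟨η_k, η_i⟩|² = ⟨η_i, Sη_i⟩ ≤ ‖S‖ ‖η_i‖²`. -/
theorem norm_le_bimod_lnorm (η : Fin n → L2) (i : Fin n) : ‖η i‖ ≤ (bimod n).lnorm η := by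
  refine Real.le_sqrt_of_sq_le ?_
  have h₁ : ⟪η i, (ketBraSum η η : L2 →L[ℂ] L2) (η i)⟫_ℂ =
      ((∑ k, ‖⟪η k, η i⟫_ℂ‖ ^ 2 : ℝ) : ℂ) := by
    rw [ketBraSum_apply, inner_sum, Complex.ofReal_sum]
    refine Finset.sum_congr rfl fun k _ => ?_
    rw [inner_smul_right, ← inner_conj_symm, mul_comm, ← Complex.normSq_eq_norm_sq,
      Complex.normSq_eq_conj_mul_self, inner_conj_symm, inner_conj_symm, mul_comm]
  have h₂ : ‖η i‖ ^ 2 * ‖η i‖ ^ 2 ≤ ∑ k, ‖⟪η k, η i⟫_ℂ‖ ^ 2 := by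
    refine le_trans (le_of_eq ?_) (Finset.single_le_sum (f := fun k => ‖⟪η k, η i⟫_ℂ‖ ^ 2)
      (fun k _ => by positivity) (Finset.mem_univ i))
    simp only [inner_self_eq_norm_sq_to_K]
    simp
    ring
  have h₃ : (∑ k, ‖⟪η k, η i⟫_ℂ‖ ^ 2 : ℝ) ≤ ‖ketBraSum η η‖ * ‖η i‖ ^ 2 := by
    have h := norm_inner_le_norm (𝕜 := ℂ) (η i) ((ketBraSum η η : L2 →L[ℂ] L2) (η i))
    rw [h₁, Complex.norm_real, Real.norm_of_nonneg (by positivity)] at h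
    refine h.trans ?_
    have := (ketBraSum η η : L2 →L[ℂ] L2).le_opNorm (η i)
    calc _ ≤ ‖η i‖ * (‖(ketBraSum η η : L2 →L[ℂ] L2)‖ * ‖η i‖) := by gcongr
      _ = ‖ketBraSum η η‖ * ‖η i‖ ^ 2 := by
        rw [pow_two, mul_left_comm]
        rfl
  rcases eq_or_ne (η i) 0 with h | h
  · rw [h, norm_zero, zero_pow two_ne_zero]
    exact norm_nonneg _
  · have : 0 < ‖η i‖ ^ 2 := by positivity
    exact le_of_mul_le_mul_right (h₂.trans h₃) this

theorem eq_zero_of_gramMat (η : Fin n → L2) (h : gramMat η η = 0) : η = 0 := by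
  ext1 i
  have h₁ := norm_le_bimod_rnorm η i
  have h₂ : (bimod n).rnorm η = √‖gramMat η η‖ := rfl
  rwa [h₂, h, norm_zero, Real.sqrt_zero, norm_le_zero_iff] at h₁

theorem eq_zero_of_ketBraSum (η : Fin n → L2) (h : ketBraSum η η = 0) : η = 0 := by
  ext1 i
  have h₁ := norm_le_bimod_lnorm η i
  have h₂ : (bimod n).lnorm η = √‖ketBraSum η η‖ := rfl
  rwa [h₂, h, norm_zero, Real.sqrt_zero, norm_le_zero_iff] at h₁

theorem continuous_bimod_rnorm : Continuous fun η : Fin n → L2 => (bimod n).rnorm η := by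
  have h : Continuous fun η : Fin n → L2 => gramMat η η := continuous_matrix fun i j => by
    change Continuous fun η : Fin n → L2 => ⟪η i, η j⟫_ℂ
    fun_prop
  exact Real.continuous_sqrt.comp h.norm

theorem norm_ketBra (η ξ : L2) : ‖ketBra η ξ‖ = ‖η‖ * ‖ξ‖ := by
  change ‖InnerProductSpace.rankOne ℂ η ξ‖ = _
  rw [InnerProductSpace.norm_rankOne]

theorem bimod_lnorm_le (η : Fin n → L2) : (bimod n).lnorm η ≤ √(∑ i, ‖η i‖ * ‖η i‖) := by
  have h : ‖ketBraSum η η‖ ≤ ∑ i, ‖η i‖ * ‖η i‖ := by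
    rw [ketBraSum]
    exact (norm_sum_le _ _).trans_eq (Finset.sum_congr rfl fun i _ => norm_ketBra _ _)
  exact Real.sqrt_le_sqrt h

/-- Completeness transfers from the supremum norm: `N` dominates it, so Cauchy sequences have a
limit, and `N` is dominated by a continuous function vanishing at 0, so the convergence also holds
for `N`. -/
theorem exists_limit_of_seminorm [Nonempty (Fin n)] {N g : (Fin n → L2) → ℝ} (hN : ∀ η, N η ≤ g η)
    (hg : Continuous g) (h₀ : g 0 = 0)
    (h : ∀ η i, ‖η i‖ ≤ N η) (u : ℕ → Fin n → L2)
    (hu : ∀ ε > 0, ∃ M, ∀ p ≥ M, ∀ q ≥ M, N (u p - u q) < ε) :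
    ∃ x, ∀ ε > 0, ∃ M, ∀ p ≥ M, N (u p - x) < ε := by
  have h' : ∀ η, ‖η‖ ≤ N η := fun η => by
    exact (pi_norm_le_iff_of_nonempty _).2 (h η)
  obtain ⟨x, hx⟩ := exists_limit_of_cauchy u fun ε hε => by
    obtain ⟨M, hM⟩ := hu ε hε
    exact ⟨M, fun p hp q hq => (h' _).trans_lt (hM p hp q hq)⟩
  refine ⟨x, fun ε hε => ?_⟩
  have ht : Filter.Tendsto u Filter.atTop (nhds x) := Metric.tendsto_atTop.2 fun δ hδ => by
    obtain ⟨M, hM⟩ := hx δ hδ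
    exact ⟨M, fun p hp => (dist_eq_norm _ _).trans_lt (hM p hp)⟩
  have ht₂ := (hg.tendsto _).comp (ht.sub_const x)
  rw [sub_self, h₀] at ht₂
  obtain ⟨M, hM⟩ := Filter.eventually_atTop.1 (ht₂.eventually (gt_mem_nhds hε))
  exact ⟨M, fun p hp => (hN _).trans_lt (hM p hp)⟩

theorem bimod_rnorm_zero : (bimod n).rnorm (0 : Fin n → L2) = 0 := by
  have : gramMat (0 : Fin n → L2) (0 : Fin n → L2) = 0 := by
    ext i j
    exact inner_zero_left (𝕜 := ℂ) (0 : L2)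
  have h : (bimod n).rnorm (0 : Fin n → L2) = √‖gramMat (0 : Fin n → L2) 0‖ := rfl
  rw [h, this, norm_zero, Real.sqrt_zero]

/-! ### Algebra, fullness and boundedness of the two inner products. -/

theorem isPos_ketBraSum (η : Fin n → L2) : IsPos (ketBraSum η η) :=
  isPos_sum _ _ fun i _ => isPos_ketBra (η i)

theorem star_gramMat (η ξ : Fin n → L2) : star (gramMat η ξ) = gramMat ξ η := by
  ext i j
  exact inner_conj_symm (𝕜 := ℂ) (ξ i) (η j)

theorem gramMat_add_right (η ξ ζ : Fin n → L2) : gramMat η (ξ + ζ) = gramMat η ξ + gramMat η ζ := by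
  ext i j
  exact inner_add_right (η i) (ξ j) (ζ j)

theorem gramMat_smul_right (η : Fin n → L2) (c : ℂ) (ξ : Fin n → L2) :
    gramMat η (c • ξ) = c • gramMat η ξ := by
  ext i j
  exact inner_smul_right (η i) (ξ j) c

theorem ketBraSum_add_left (η ξ ζ : Fin n → L2) :
    ketBraSum (η + ξ) ζ = ketBraSum η ζ + ketBraSum ξ ζ := by
  rw [ketBraSum, ketBraSum, ketBraSum, ← Finset.sum_add_distrib]
  exact Finset.sum_congr rfl fun i _ => ketBra_add_left _ _ _

theorem ketBraSum_smul_left (c : ℂ) (η ξ : Fin n → L2) :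
    ketBraSum (c • η) ξ = c • ketBraSum η ξ := by
  rw [ketBraSum, ketBraSum, Finset.smul_sum]
  exact Finset.sum_congr rfl fun i _ => ketBra_smul_left _ _ _

theorem star_ketBraSum (η ξ : Fin n → L2) : star (ketBraSum η ξ) = ketBraSum ξ η := by
  rw [ketBraSum, ketBraSum, star_sum]
  exact Finset.sum_congr rfl fun i _ => star_ketBra _ _

theorem ketBraSum_lact (a b : compacts) (η ξ : Fin n → L2) :
    ketBraSum (fun i => (a : L2 →L[ℂ] L2) (η i)) (fun i => (b : L2 →L[ℂ] L2) (ξ i)) =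
      a * ketBraSum η ξ * star b := by
  rw [ketBraSum, ketBraSum, Finset.mul_sum, Finset.sum_mul]
  refine Finset.sum_congr rfl fun i _ => ?_
  rw [mul_ketBra, ketBra_mul, star_star]

theorem rowMat_gramMat (η ξ ζ : Fin n → L2) :
    rowMat n η (gramMat ξ ζ) = fun i => (ketBraSum η ξ : L2 →L[ℂ] L2) (ζ i) := by
  ext1 j
  rw [ketBraSum_apply]
  rfl

theorem gramMat_single (i j : Fin n) (x : ℂ) :
    gramMat (Pi.single i (ket 0)) (Pi.single j (x • ket 0)) = Matrix.single i j x := by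
  ext k l
  rw [gramMat_apply, Matrix.single_apply, Pi.single_apply, Pi.single_apply]
  by_cases hk : k = i <;> by_cases hl : l = j
  · rw [if_pos hk, if_pos hl, if_pos ⟨hk.symm, hl.symm⟩, inner_smul_right, inner_ket_left,
      ket_apply, if_pos rfl, mul_one]
  · rw [if_neg hl, inner_zero_right, if_neg fun h => hl h.2.symm]
  · rw [if_neg hk, inner_zero_left, if_neg fun h => hk h.1.symm]
  · rw [if_neg hk, inner_zero_left, if_neg fun h => hk h.1.symm]

theorem ketBraSum_single (i : Fin n) (v w : L2) :
    ketBraSum (Pi.single i v) (Pi.single i w) = ketBra v w := by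
  rw [ketBraSum, Finset.sum_eq_single i]
  · rw [Pi.single_eq_same, Pi.single_eq_same]
  · intro j _ hj
    rw [Pi.single_eq_of_ne hj, Pi.single_eq_of_ne hj]
    exact Subtype.ext (by simp)
  · simp

theorem span_gramMat :
    Submodule.span ℂ {x | ∃ η ξ : Fin n → L2, x = gramMat η ξ} = ⊤ := by
  refine top_le_iff.1 fun M _ => ?_
  induction M using Matrix.induction_on' with
  | h_zero => exact zero_mem _
  | h_add p q hp hq => exact add_mem (hp trivial) (hq trivial)
  | h_std_basis i j x => exact Submodule.subset_span ⟨_, _, (gramMat_single i j x).symm⟩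

theorem dense_span_ketBraSum (hn : 0 < n) :
    (Submodule.span ℂ {x | ∃ η ξ : Fin n → L2, x = ketBraSum η ξ}).topologicalClosure = ⊤ := by
  refine top_le_iff.1 (dense_span_ketBra.ge.trans (Submodule.topologicalClosure_mono
    (Submodule.span_mono ?_)))
  rintro _ ⟨j, k, rfl⟩
  exact ⟨_, _, (ketBraSum_single ⟨0, hn⟩ (ket j) (ket k)).symm⟩

theorem rowMat_one (η : Fin n → L2) : rowMat n η 1 = η := by
  ext1 j
  rw [rowMat_apply, Finset.sum_eq_single j]
  · simp
  · intro b _ hb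
    simp [hb]
  · simp

theorem isPos_ketBraSum_rowMat (η : Fin n → L2) (a : Matrix (Fin n) (Fin n) ℂ) :
    IsPos (((‖a‖ ^ 2 : ℝ) : ℂ) • ketBraSum η η - ketBraSum (rowMat n η a) (rowMat n η a)) := by
  -- The left inner product of `ηa` with itself involves `aa*`. From `‖a‖² - aa* = d*d`, the
  -- difference to be shown positive is the left inner product of `ηd*` with itself.
  obtain ⟨d, hd⟩ := exists_norm_sq_sub_eq (star a)
  rw [norm_star, star_star] at hd
  have e : ∀ x : Matrix (Fin n) (Fin n) ℂ, ketBraSum (rowMat n η x) (rowMat n η x) =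
      ketBraSum (rowMat n η (x * star x)) η := fun x => by
    rw [rowMat_mul, ketBraSum_rowMat (rowMat n η x), star_star]
  have h : ((‖a‖ ^ 2 : ℝ) : ℂ) • ketBraSum η η - ketBraSum (rowMat n η a) (rowMat n η a) =
      ketBraSum (rowMat n η (star d)) (rowMat n η (star d)) := by
    rw [e, e, star_star, ← hd, Algebra.algebraMap_eq_smul_one, map_sub, map_smul, rowMat_one,
      sub_eq_iff_eq_add, ← ketBraSum_add_left, sub_add_cancel, ketBraSum_smul_left]
  rw [h]
  exact isPos_ketBraSum _

theorem isPos_gramMat_lact (b : L2 →L[ℂ] L2) (η : Fin n → L2) :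
    IsPos (((‖b‖ ^ 2 : ℝ) : ℂ) • gramMat η η - gramMat (fun i => b (η i)) (fun i => b (η i))) := by
  obtain ⟨d, hd⟩ := exists_norm_sq_sub_eq b
  have h : ((‖b‖ ^ 2 : ℝ) : ℂ) • gramMat η η - gramMat (fun i => b (η i)) (fun i => b (η i)) =
      gramMat (fun i => d (η i)) (fun i => d (η i)) := by
    ext i j
    have e := congrArg (fun T : L2 →L[ℂ] L2 => ⟪η i, T (η j)⟫_ℂ) hd
    simp only [ContinuousLinearMap.star_eq_adjoint] at e
    change ((‖b‖ ^ 2 : ℝ) : ℂ) * ⟪η i, η j⟫_ℂ - ⟪b (η i), b (η j)⟫_ℂ = ⟪d (η i), d (η j)⟫_ℂ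
    rw [← ContinuousLinearMap.adjoint_inner_right d, ← ContinuousLinearMap.adjoint_inner_right b,
      ← inner_smul_right, ← inner_sub_right]
    exact e
  rw [h]
  exact isPos_gram fun i => d (η i)

theorem bimod_isMorita (hn : 0 < n) : (bimod n).IsMorita where
  ract_mul := rowMat_mul
  lact_mul _ _ _ := rfl
  lact_ract b (η : Fin n → L2) a := funext fun j => by
    change (b : L2 →L[ℂ] L2) (∑ i, a i j • η i) = ∑ i, a i j • (b : L2 →L[ℂ] L2) (η i)
    simp
  rinner_add := gramMat_add_right
  rinner_smul := gramMat_smul_right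
  rinner_star := star_gramMat
  rinner_ract η a ξ b := gramMat_rowMat η ξ a b
  rinner_pos := isPos_gram
  rinner_definite := eq_zero_of_gramMat
  linner_add := ketBraSum_add_left
  linner_smul := ketBraSum_smul_left
  linner_star := star_ketBraSum
  linner_lact a η b ξ := ketBraSum_lact a b η ξ
  linner_pos := isPos_ketBraSum
  linner_definite := eq_zero_of_ketBraSum
  rcomplete u hu :=
    have : Nonempty (Fin n) := ⟨⟨0, hn⟩⟩
    exists_limit_of_seminorm (fun _ => le_rfl) continuous_bimod_rnorm bimod_rnorm_zero
      norm_le_bimod_rnorm u hu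
  lcomplete u hu :=
    have : Nonempty (Fin n) := ⟨⟨0, hn⟩⟩
    exists_limit_of_seminorm (g := fun η => √(∑ i, ‖η i‖ * ‖η i‖)) bimod_lnorm_le (by fun_prop)
      (by simp) norm_le_bimod_lnorm u hu
  compatible := rowMat_gramMat
  rfull := top_le_iff.1 (span_gramMat.ge.trans (Submodule.le_topologicalClosure _))
  lfull := dense_span_ketBraSum hn
  linner_ract_le := isPos_ketBraSum_rowMat
  rinner_lact_le b η := isPos_gramMat_lact b η

theorem inner_star_star (v w : L2) : ⟪star v, star w⟫_ℂ = ⟪w, v⟫_ℂ := by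
  refine (hasSum_inner_coord _ _).unique ((hasSum_inner_coord w v).congr_fun fun k => ?_)
  rw [lp.star_apply, lp.star_apply, star_star, mul_comm]

/-- Entrywise complex conjugation. -/
def starEquiv (n : ℕ) : (Fin n → L2) ≃ (Fin n → L2) := ⟨star, star, star_star, star_star⟩

theorem starEquiv_smul (c : ℂ) (η : Fin n → L2) : starEquiv n (c • η) = star c • starEquiv n η :=
  star_smul c η

theorem bimodBar_isMorita (hn : 0 < n) : (bimodBar n).IsMorita := by
  refine (bimod_isMorita hn).conjugate (Y := bimodBar n) (starEquiv n)
    (fun η ξ => star_add (R := Fin n → L2) η ξ) starEquiv_smul (fun (η : Fin n → L2) b => ?_)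
    (fun a (η : Fin n → L2) => ?_) (fun η ξ => rfl) (fun (η : Fin n → L2) (ξ : Fin n → L2) => ?_)
  · exact funext fun i => star_star _
  · refine funext fun i => ?_
    change star (∑ j, a i j • η j) = ∑ j, star (a i j) • star (η j)
    simp [star_sum]
  · exact Matrix.ext fun i j => (inner_star_star (η i) (ξ j)).symm

end Bimod

end MoritaCat

end

noncomputable section

namespace MoritaCat

open BimoduleData

/-! ## The correspondence from the truncation -/

section Corr

variable {n : ℕ}

theorem pair_apply (η : Fin n → L2) (v : EuclideanSpace ℂ (Fin n)) :
    pair n η v = ∑ i, v i • η i := rfl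

theorem pair_single (η : Fin n → L2) (i : Fin n) :
    pair n η (EuclideanSpace.single i 1) = η i := by
  rw [pair_apply, Finset.sum_eq_single i (fun j _ hj => by simp [hj]) (by simp)]
  simp

theorem pair_rowMat (η : Fin n → L2) (a : Matrix (Fin n) (Fin n) ℂ)
    (v : EuclideanSpace ℂ (Fin n)) : pair n (rowMat n η a) v = pair n η (matCLM a v) := by
  rw [pair_apply, pair_apply]
  simp only [rowMat_apply, matCLM_apply, Matrix.mulVec, dotProduct, Finset.smul_sum,
    Finset.sum_smul, smul_smul]
  rw [Finset.sum_comm]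
  simp only [mul_comm]

theorem pair_mem_rapidSeq (η : rapidDom n) (v : EuclideanSpace ℂ (Fin n)) :
    pair n η.1 v ∈ rapidSeq :=
  rapidSeq.sum_mem fun i _ => rapidSeq.smul_mem _ (mem_rapidDom η i)

theorem pmap_sum_smul (T : L2 →ₗ.[ℂ] L2) (x : Fin n → L2) (hx : ∀ i, x i ∈ T.domain) (v : Fin n → ℂ)
    (h : ∑ i, v i • x i ∈ T.domain) :
    T ⟨∑ i, v i • x i, h⟩ = ∑ i, v i • T ⟨x i, hx i⟩ := by
  have e : (⟨∑ i, v i • x i, h⟩ : T.domain) = ∑ i, v i • ⟨x i, hx i⟩ :=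
    Subtype.ext (by simp)
  rw [e]
  change T.toFun _ = _
  rw [map_sum]
  exact Finset.sum_congr rfl fun i _ => map_smul T.toFun _ _

theorem ann_pair (η : rapidDom n) (v : EuclideanSpace ℂ (Fin n)) (h : pair n η.1 v ∈ ann.domain) :
    ann ⟨pair n η.1 v, h⟩ = pair n (annE η) v :=
  pmap_sum_smul ann η.1 (fun i => rapidSeq_le_ann (mem_rapidDom η i)) v.ofLp h

theorem cre_pair (η : rapidDom n) (v : EuclideanSpace ℂ (Fin n)) (h : pair n η.1 v ∈ cre.domain) :
    cre ⟨pair n η.1 v, h⟩ = pair n (creE η) v :=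
  pmap_sum_smul cre η.1 (fun i => rapidSeq_le_cre (mem_rapidDom η i)) v.ofLp h

theorem inner_pair (η ξ : Fin n → L2) (v w : EuclideanSpace ℂ (Fin n)) :
    ⟪pair n η v, pair n ξ w⟫_ℂ = ⟪v, matCLM (gramMat η ξ) w⟫_ℂ := by
  rw [pair_apply, pair_apply, sum_inner, PiLp.inner_apply]
  refine Finset.sum_congr rfl fun i _ => ?_
  rw [inner_smul_left, inner_sum]
  simp only [matCLM_apply, Matrix.mulVec, dotProduct, gramMat_apply, inner_smul_right]
  simp [mul_comm]

theorem annE_mem (η : rapidDom n) : annE η ∈ rapidDom n :=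
  fun i _ => ann_mem_rapidSeq (mem_rapidDom η i)

theorem creE_mem (η : rapidDom n) : creE η ∈ rapidDom n :=
  fun i _ => cre_mem_rapidSeq (mem_rapidDom η i)

theorem rowMat_mem_rapidDom (η : rapidDom n) (a : Matrix (Fin n) (Fin n) ℂ) :
    rowMat n η.1 a ∈ rapidDom n :=
  fun _ _ => rapidSeq.sum_mem fun i _ => rapidSeq.smul_mem _ (mem_rapidDom η i)

theorem matCol_mem_rapidDom (a : Matrix (Fin n) (Fin n) ℂ) (η : rapidDom n) :
    matCol n a η.1 ∈ rapidDom n :=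
  fun _ _ => rapidSeq.sum_mem fun i _ => rapidSeq.smul_mem _ (mem_rapidDom η i)

theorem single_mem_rapidDom (i : Fin n) {v : L2} (hv : v ∈ rapidSeq) :
    Pi.single i v ∈ rapidDom n := fun j _ => by
  rw [Pi.single_apply]
  split_ifs
  · exact hv
  · exact rapidSeq.zero_mem

theorem spinorMul_apply {H₀ K₀ E : Type} [NormedAddCommGroup H₀] [InnerProductSpace ℂ H₀]
    [NormedAddCommGroup K₀] [InnerProductSpace ℂ K₀] [AddCommGroup E] [Module ℂ E]
    (m : E →ₗ[ℂ] H₀ →ₗ[ℂ] K₀) (η : E) (ψ : Spinor H₀) (i : Fin 2) :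
    spinorMul m η ψ i = m η (ψ i) := rfl

theorem corr_isIsometric (n : ℕ) (θ : ℝ) : IsIsometric (corr n θ) := by
  intro η₁ ψ₁ η₂ ψ₂
  have h : ∀ (η ξ : Fin n → L2) (v w : Spinor (EuclideanSpace ℂ (Fin n))),
      ⟪spinorMul (pair n) η v, spinorMul (pair n) ξ w⟫_ℂ = ⟪v, amp (matCLM (gramMat η ξ)) w⟫_ℂ := by
    intro η ξ v w
    rw [inner_spinor, inner_spinor]
    simp only [spinorMul_apply, amp_apply, inner_pair]
  exact h η₁ η₂ ψ₁ ψ₂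

theorem amp_comp_oddCLM_matCLM (R P Q : Matrix (Fin n) (Fin n) ℂ) :
    amp (matCLM R) ∘L oddCLM (matCLM P) (matCLM Q) =
      oddCLM (matCLM (R * P)) (matCLM (R * Q)) := by
  rw [amp_comp_oddCLM, map_mul, map_mul]

theorem exists_oddCLM_of_mem_truncation {θ : ℝ}
    {ω : Spinor (EuclideanSpace ℂ (Fin n)) →L[ℂ] Spinor (EuclideanSpace ℂ (Fin n))}
    (hω : ω ∈ (truncation n θ).oneForms) :
    ∃ P Q : Matrix (Fin n) (Fin n) ℂ, ω = oddCLM (matCLM P) (matCLM Q) := by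
  let S : Submodule ℂ (Spinor (EuclideanSpace ℂ (Fin n)) →L[ℂ] Spinor (EuclideanSpace ℂ (Fin n))) :=
    { carrier := {ω | ∃ P Q : Matrix (Fin n) (Fin n) ℂ, ω = oddCLM (matCLM P) (matCLM Q)}
      add_mem' := by
        rintro _ _ ⟨P, Q, rfl⟩ ⟨P', Q', rfl⟩
        exact ⟨P + P', Q + Q', by rw [map_add, map_add, oddCLM_add]⟩
      zero_mem' := ⟨0, 0, by
        rw [map_zero]
        exact ContinuousLinearMap.ext fun v => spinor_ext (by simp) (by simp)⟩
      smul_mem' := by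
        rintro c _ ⟨P, Q, rfl⟩
        exact ⟨c • P, c • Q, by rw [map_smul, map_smul, oddCLM_smul]⟩ }
  have h : (truncation n θ).oneForms ≤ S := by
    refine Submodule.span_le.2 ?_
    rintro _ ⟨(a : Matrix (Fin n) (Fin n) ℂ), -, (b : Matrix (Fin n) (Fin n) ℂ), -, K, hK, rfl⟩
    rw [(truncation_isCommutator_iff θ b K).1 hK, truncD_commutator, ← oddCLM_smul, ← map_smul,
      ← map_smul]
    exact ⟨_, _, amp_comp_oddCLM_matCLM a _ _⟩
  exact h hω

/-- The one-form `(0 P; Q 0)`. -/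
def truncForm (hn : 2 ≤ n) {θ : ℝ} (hθ : 0 < θ) (P Q : Matrix (Fin n) (Fin n) ℂ) :
    (truncation n θ).oneForms :=
  ⟨oddCLM (matCLM P) (matCLM Q), oddCLM_mem_truncation hn hθ P Q⟩

/-- The element `(0 η₁; η₂ 0)` of `E₁ ⊗ Ω¹`. -/
def corrForm (hn : 2 ≤ n) {θ : ℝ} (hθ : 0 < θ) (η₁ η₂ : (corr n θ).dom) :
    FormTensor (truncation n θ) (corr n θ).X (corr n θ).dom :=
  fmul (truncation n θ) (corr n θ).X (corr n θ).dom η₁ (truncForm hn hθ 1 0) +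
    fmul (truncation n θ) (corr n θ).X (corr n θ).dom η₂ (truncForm hn hθ 0 1)

theorem corrForm_add (hn : 2 ≤ n) {θ : ℝ} (hθ : 0 < θ) (η₁ η₂ ξ₁ ξ₂ : (corr n θ).dom) :
    corrForm hn hθ (η₁ + ξ₁) (η₂ + ξ₂) = corrForm hn hθ η₁ η₂ + corrForm hn hθ ξ₁ ξ₂ :=
  (congrArg₂ (· + ·) (btmul_add_left _ _ _) (btmul_add_left _ _ _)).trans (add_add_add_comm _ _ _ _)

theorem corrForm_zero (hn : 2 ≤ n) {θ : ℝ} (hθ : 0 < θ) :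
    corrForm hn hθ (0 : (corr n θ).dom) 0 = 0 :=
  (congrArg₂ (· + ·) (btmul_zero_left _) (btmul_zero_left _)).trans (add_zero _)

theorem fmul_truncForm (hn : 2 ≤ n) {θ : ℝ} (hθ : 0 < θ) (η : (corr n θ).dom)
    (P Q R : Matrix (Fin n) (Fin n) ℂ) :
    fmul (truncation n θ) (corr n θ).X (corr n θ).dom η (truncForm hn hθ (R * P) (R * Q)) =
    fmul (truncation n θ) (corr n θ).X (corr n θ).dom
      ⟨rowMat n η.1 R, rowMat_mem_rapidDom η R⟩ (truncForm hn hθ P Q) := by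
  exact (btmul_balanced (a := (⟨R, trivial⟩ : (truncation n θ).smooth)) rfl
    (amp_comp_oddCLM_matCLM R P Q).symm).symm

theorem truncForm_eq_add (hn : 2 ≤ n) {θ : ℝ} (hθ : 0 < θ) (P Q : Matrix (Fin n) (Fin n) ℂ) :
    truncForm hn hθ P Q = truncForm hn hθ (P * 1) (P * 0) + truncForm hn hθ (Q * 0) (Q * 1) :=
  Subtype.ext (by
    rw [Matrix.mul_one, Matrix.mul_one, Matrix.mul_zero, Matrix.mul_zero]
    change oddCLM (matCLM P) (matCLM Q) = oddCLM (matCLM P) (matCLM 0) + oddCLM (matCLM 0) (matCLM Q)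
    rw [← oddCLM_add, map_zero, add_zero, zero_add])

/-- Since `(0 P; Q 0) = P(0 1; 0 0) + Q(0 0; 1 0)`, the matrices `P` and `Q` can be moved across the
tensor product. This is the identification of `E₁ ⊗ Ω¹` with off-diagonal matrices over `E₁`; it
requires the two constant matrices to be one-forms, hence `n ≥ 2`. -/
theorem exists_eq_corrForm (hn : 2 ≤ n) {θ : ℝ} (hθ : 0 < θ)
    (t : FormTensor (truncation n θ) (corr n θ).X (corr n θ).dom) :
    ∃ η₁ η₂, t = corrForm hn hθ η₁ η₂ := by
  induction t using BalancedTensor.induction with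
  | zero => exact ⟨0, 0, (corrForm_zero hn hθ).symm⟩
  | add s t hs ht =>
    obtain ⟨η₁, η₂, rfl⟩ := hs
    obtain ⟨ξ₁, ξ₂, rfl⟩ := ht
    exact ⟨η₁ + ξ₁, η₂ + ξ₂, (corrForm_add hn hθ _ _ _ _).symm⟩
  | mul η ω =>
    obtain ⟨P, Q, h⟩ := exists_oddCLM_of_mem_truncation ω.2
    obtain rfl : ω = truncForm hn hθ P Q := Subtype.ext h
    rw [truncForm_eq_add, btmul_add_right]
    exact ⟨_, _, congrArg₂ (· + ·) (fmul_truncForm hn hθ η 1 0 P) (fmul_truncForm hn hθ η 0 1 Q)⟩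

theorem formU_corrForm (hn : 2 ≤ n) {θ : ℝ} (hθ : 0 < θ) (η₁ η₂ : (corr n θ).dom)
    (ψ : (truncation n θ).H) :
    formU (corr n θ) ψ (corrForm hn hθ η₁ η₂) =
      oddMap 1 (pair n η₁.1) (pair n η₂.1) ψ := by
  have h : ∀ (η ξ : Fin n → L2) (v : Spinor (EuclideanSpace ℂ (Fin n))),
      spinorMul (pair n) η (oddCLM (matCLM 1) (matCLM 0) v) +
        spinorMul (pair n) ξ (oddCLM (matCLM 0) (matCLM 1) v) = oddMap 1 (pair n η) (pair n ξ) v := by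
    intro η ξ v
    refine spinor_ext ?_ ?_
    · simp [spinorMul_apply, matCLM_one]
    · simp [spinorMul_apply, matCLM_one]
  exact (map_add (formU (corr n θ) ψ) _ _).trans (h η₁.1 η₂.1 ψ)

theorem eq_zero_of_pair {η : Fin n → L2} (h : ∀ v, pair n η v = 0) : η = 0 :=
  funext fun i => (pair_single η i).symm.trans (h _)

/-- The form `(0 η₁; η₂ 0)` sends `(v₀, v₁)` to `(η₁v₁, η₂v₀)`, so both entries are recovered from
its action. -/
theorem corr_formsFaithful (hn : 2 ≤ n) {θ : ℝ} (hθ : 0 < θ) : FormsFaithful (corr n θ) := by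
  intro t ht
  obtain ⟨η₁, η₂, rfl⟩ := exists_eq_corrForm hn hθ t
  have h : ∀ ψ, oddMap 1 (pair n η₁.1) (pair n η₂.1) ψ = 0 := fun ψ =>
    (formU_corrForm hn hθ η₁ η₂ ψ).symm.trans (ht ψ)
  have h₁ : η₁ = 0 := Subtype.ext (eq_zero_of_pair fun v => by
    have h₂ := congrArg (fun x : Spinor L2 => x 0) (h (spin 1 v))
    simpa using h₂)
  have h₂ : η₂ = 0 := Subtype.ext (eq_zero_of_pair fun v => by
    have h₂ := congrArg (fun x : Spinor L2 => x 1) (h (spin 0 v))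
    simpa using h₂)
  rw [h₁, h₂, corrForm_zero]

/-- Existence makes the choice in the definition of the connection meaningful, and faithfulness
makes its result unique. -/
theorem connIs_of_exists {T T' : TripleData} {C : CorrData T T'} {F : C.dom → T.H → T'.H}
    (hF : FormsFaithful C)
    (h : ∀ η, C.conn η = Classical.epsilon fun t => ∀ ψ, formU C ψ t = F η ψ)
    (hex : ∀ η, ∃ t, ∀ ψ, formU C ψ t = F η ψ) : ConnIs C F := by
  intro η t
  have h₁ : ∀ ψ, formU C ψ (C.conn η) = F η ψ := by
    rw [h η]
    exact Classical.epsilon_spec (hex η)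
  exact ⟨fun e ψ => by rw [e]; exact h₁ ψ, fun h₂ => hF.ext fun ψ => (h₂ ψ).trans (h₁ ψ).symm⟩

theorem corr_connIs (hn : 2 ≤ n) {θ : ℝ} (hθ : 0 < θ) : ConnIs (corr n θ) (connOp n θ) := by
  refine connIs_of_exists (corr_formsFaithful hn hθ) (fun η => rfl) fun (η : rapidDom n) => ?_
  let η₁ : rapidDom n := ⟨annE η - rowMat n η.1 (Xmat n).conjTranspose,
    (rapidDom n).sub_mem (annE_mem η) (rowMat_mem_rapidDom η _)⟩
  let η₂ : rapidDom n := ⟨creE η - rowMat n η.1 (Xmat n),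
    (rapidDom n).sub_mem (creE_mem η) (rowMat_mem_rapidDom η _)⟩
  refine ⟨corrForm hn hθ (scale θ • η₁) (scale θ • η₂), fun ψ => (formU_corrForm hn hθ _ _ ψ).trans ?_⟩
  refine spinor_ext ?_ ?_
  · change (1 : ℂ) • pair n (scale θ • η₁.1) _ = scale θ • pair n η₁.1 _
    rw [one_smul, map_smul, LinearMap.smul_apply]
  · change (1 : ℂ) • pair n (scale θ • η₂.1) _ = scale θ • pair n η₂.1 _
    rw [one_smul, map_smul, LinearMap.smul_apply]

theorem ConnIs.formU_conn {T T' : TripleData} {C : CorrData T T'} {F : C.dom → T.H → T'.H}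
    (h : ConnIs C F) (η : C.dom) (ψ : T.H) : formU C ψ (C.conn η) = F η ψ :=
  (h η _).1 rfl ψ

theorem spinorMul_pair_mem_domain (c : ℂ) (η : rapidDom n)
    (ψ : Spinor (EuclideanSpace ℂ (Fin n))) :
    spinorMul (pair n) η.1 ψ ∈ (oddOp c ann cre).domain := fun i =>
  ⟨rapidSeq_le_ann (pair_mem_rapidSeq η (ψ i)), rapidSeq_le_cre (pair_mem_rapidSeq η (ψ i))⟩

/-- The product `(ηX_n*)v` equals `η(X_n*v)`: the terms `-ηX_n*` and `-ηX_n` of the connection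
cancel the contribution of `D_n`, and `𝔞η`, `𝔞†η` remain. -/
theorem oddOp_spinorMul_pair (θ : ℝ) (η : rapidDom n) (ψ : Spinor (EuclideanSpace ℂ (Fin n)))
    (hd : spinorMul (pair n) η.1 ψ ∈ (oddOp (scale θ) ann cre).domain) :
    oddOp (scale θ) ann cre ⟨_, hd⟩ = spinorMul (pair n) η.1 (truncD n θ ψ) +
      oddMap (scale θ) (pair n (annE η - rowMat n η.1 (Xmat n).conjTranspose))
        (pair n (creE η - rowMat n η.1 (Xmat n))) ψ := by
  refine spinor_ext ?_ ?_
  · rw [oddOp_zero]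
    refine (congrArg (scale θ • ·) (ann_pair η _ _)).trans ?_
    rw [PiLp.add_apply, spinorMul_apply, oddMap_zero, truncD_zero, map_smul, map_sub,
      LinearMap.sub_apply, pair_rowMat, ← smul_add, add_sub_cancel]
  · rw [oddOp_one]
    refine (congrArg (scale θ • ·) (cre_pair η _ _)).trans ?_
    rw [PiLp.add_apply, spinorMul_apply, oddMap_one, truncD_one, map_smul, map_sub,
      LinearMap.sub_apply, pair_rowMat, ← smul_add, add_sub_cancel]

theorem corr_intertwines (hn : 2 ≤ n) {θ : ℝ} (hθ : 0 < θ) : Intertwines (corr n θ) := by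
  intro (η : rapidDom n) ψ
  have hd := spinorMul_pair_mem_domain (scale θ) η ψ.1
  have h₁ := (corr_connIs hn hθ).formU_conn η ψ.1
  have h₂ := congrArg (fun ψ => (corr n θ).U (hmul (truncation n θ) (corr n θ).X η.1 ψ))
    (truncation_D_apply θ ψ)
  exact ⟨hd, (oddOp_spinorMul_pair θ η ψ.1 hd).trans (congrArg₂ (· + ·) h₂ h₁).symm⟩

theorem exists_rapidDom_near (η : Fin n → L2) {f : (Fin n → L2) → ℝ} (hf : Continuous f)
    (h₀ : f 0 = 0) {ε : ℝ} (hε : 0 < ε) : ∃ ξ ∈ rapidDom n, f (η - ξ) < ε := by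
  have hd : Dense (rapidDom n : Set (Fin n → L2)) := by
    have h : Dense (rapidSeq : Set L2) := by
      rw [Submodule.dense_iff_topologicalClosure_eq_top, ← top_le_iff, ← dense_span_ket]
      refine Submodule.topologicalClosure_mono (Submodule.span_le.2 ?_)
      rintro _ ⟨k, rfl⟩
      exact ket_mem_rapidSeq k
    rw [rapidDom, Submodule.coe_pi]
    exact dense_pi _ fun _ _ => h
  have hg : Continuous fun ξ => f (η - ξ) := by fun_prop
  obtain ⟨ξ, h₁, h₂⟩ := hd.inter_open_nonempty _ (isOpen_Iio (a := ε) |>.preimage hg)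
    ⟨η, by simpa [h₀] using hε⟩
  exact ⟨ξ, h₂, h₁⟩

theorem spinorMul_pair_single (i : Fin n) (j : Fin 2) (v : L2) :
    spinorMul (pair n) (Pi.single i v) (spin j (EuclideanSpace.single i 1)) = spin j v := by
  ext1 k
  rw [spinorMul_apply, spin_apply, spin_apply]
  split_ifs
  · rw [pair_single, Pi.single_eq_same]
  · rw [map_zero]

theorem corr_isCorrespondence (hn : 2 ≤ n) {θ : ℝ} (hθ : 0 < θ) :
    IsCorrespondence (corr n θ) := by
  let i₀ : Fin n := ⟨0, by omega⟩
  refine IsCorrespondence.of_intertwines (isSpectralTriple_truncation n θ)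
    (commutatorsMem_truncation n θ) (corr_formsFaithful hn hθ) (corr_isIsometric n θ)
    (corr_intertwines hn hθ) (bimod_isMorita (by omega)) ?_ ?_ ?_ ?_ ?_ ?_
  · intro (η : Fin n → L2) ε hε
    exact exists_rapidDom_near η continuous_bimod_rnorm bimod_rnorm_zero hε
  · intro η hη a _
    exact rowMat_mem_rapidDom ⟨η, hη⟩ a
  · intro b hb η _ i _
    exact apply_mem_rapidSeq hb _
  · let S : Submodule ℂ (moyal θ).H := LinearMap.range (corrU n θ)
    have h : Dense (S : Set (moyal θ).H) := dense_of_ket (S := S) fun i k =>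
      ⟨hmul (truncation n θ) (bimod n) (Pi.single i₀ (ket k) : Fin n → L2)
        (spin i (EuclideanSpace.single i₀ 1)), spinorMul_pair_single i₀ i (ket k)⟩
    exact h
  · intro b η ψ
    have h : ∀ (b : compacts) (η : Fin n → L2) (ψ : Spinor (EuclideanSpace ℂ (Fin n))),
        spinorMul (pair n) (fun i => (b : L2 →L[ℂ] L2) (η i)) ψ =
          amp (b : L2 →L[ℂ] L2) (spinorMul (pair n) η ψ) := by
      intro b η ψ
      ext1 k
      rw [amp_apply, spinorMul_apply, spinorMul_apply, pair_apply, pair_apply, map_sum]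
      simp only [map_smul]
    exact h b η ψ
  · let S : Submodule ℂ (moyal θ).H := Submodule.span ℂ
      {φ | ∃ (η : (corr n θ).dom) (ψ : (truncation n θ).D.domain),
        φ = (corr n θ).U (hmul (truncation n θ) (corr n θ).X η ψ)}
    have hS : S ≤ (moyal θ).D.domain := Submodule.span_le.2 (by
      rintro _ ⟨η, ψ, rfl⟩
      exact spinorMul_pair_mem_domain _ η ψ.1)
    have hk : ∀ i k, (show (moyal θ).H from spin i (ket k)) ∈ S := fun i k => Submodule.subset_span
      ⟨⟨Pi.single i₀ (ket k), single_mem_rapidDom i₀ (ket_mem_rapidSeq k)⟩,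
        ⟨spin i (EuclideanSpace.single i₀ 1), truncation_mem_domain θ _⟩,
        (spinorMul_pair_single i₀ i (ket k)).symm⟩
    exact hasCore_moyal hθ (S := S) hS hk

end Corr

end MoritaCat

end

noncomputable section

namespace MoritaCat

open BimoduleData

/-! ## The conjugate correspondence -/

section CorrBar

variable {n : ℕ}

theorem pairBar_apply (ξ : Fin n → L2) (v : L2) (i : Fin n) :
    pairBar n ξ v i = ⟪star (ξ i), v⟫_ℂ := rfl

theorem pairBar_matCol (a : Matrix (Fin n) (Fin n) ℂ) (ξ : Fin n → L2) (v : L2) :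
    pairBar n (matCol n a ξ) v = matCLM a (pairBar n ξ v) := by
  ext i
  rw [pairBar_apply, matCLM_apply]
  change ⟪star (∑ j, a i j • ξ j), v⟫_ℂ = ∑ j, a i j * ⟪star (ξ j), v⟫_ℂ
  rw [star_sum, sum_inner]
  exact Finset.sum_congr rfl fun j _ => by rw [star_smul, inner_smul_left]; simp

theorem inner_pairBar (ξ ζ : Fin n → L2) (v w : L2) :
    ⟪pairBar n ξ v, pairBar n ζ w⟫_ℂ = ⟪v, (ketBraSum (star ξ) (star ζ) : L2 →L[ℂ] L2) w⟫_ℂ := by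
  rw [ketBraSum_apply, inner_sum, PiLp.inner_apply]
  refine Finset.sum_congr rfl fun i _ => ?_
  rw [inner_smul_right, pairBar_apply, pairBar_apply, RCLike.inner_apply, inner_conj_symm]
  rfl

theorem star_cre {v : L2} (hv : v ∈ cre.domain) (hv' : star v ∈ cre.domain) :
    star (cre ⟨v, hv⟩) = cre ⟨star v, hv'⟩ := by
  ext k
  rw [lp.star_apply, cre_apply, cre_apply]
  rcases k with _ | k
  · simp [creSeq_zero]
  · simp [creSeq_succ]

theorem star_ann {v : L2} (hv : v ∈ ann.domain) (hv' : star v ∈ ann.domain) :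
    star (ann ⟨v, hv⟩) = ann ⟨star v, hv'⟩ := by
  ext k
  rw [lp.star_apply, ann_apply, ann_apply]
  simp [annSeq_apply]

/-- Associativity `(ξ𝔞)v = ξ(𝔞v)`. On the entries of a row, right multiplication by `𝔞` is the
transpose `𝔞†`, which has real coefficients and so commutes with conjugation. -/
theorem pairBar_creE (ξ : rapidDom n) (v : ann.domain) :
    pairBar n (creE ξ) v = pairBar n ξ.1 (ann v) := by
  ext i
  have h := rapidSeq_le_cre (star_mem_rapidSeq (mem_rapidDom ξ i))
  rw [pairBar_apply, pairBar_apply]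
  exact (congrArg (⟪·, (v : L2)⟫_ℂ) (star_cre _ h)).trans (inner_cre ⟨_, h⟩ v)

theorem pairBar_annE (ξ : rapidDom n) (v : cre.domain) :
    pairBar n (annE ξ) v = pairBar n ξ.1 (cre v) := by
  ext i
  have h := rapidSeq_le_ann (star_mem_rapidSeq (mem_rapidDom ξ i))
  rw [pairBar_apply, pairBar_apply]
  exact (congrArg (⟪·, (v : L2)⟫_ℂ) (star_ann _ h)).trans (inner_ann ⟨_, h⟩ v)

theorem corrBar_isIsometric (n : ℕ) (θ : ℝ) : IsIsometric (corrBar n θ) := by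
  intro η₁ ψ₁ η₂ ψ₂
  have h : ∀ (η ξ : Fin n → L2) (v w : Spinor L2),
      ⟪spinorMul (pairBar n) η v, spinorMul (pairBar n) ξ w⟫_ℂ =
        ⟪v, amp (ketBraSum (star η) (star ξ) : L2 →L[ℂ] L2) w⟫_ℂ := by
    intro η ξ v w
    rw [inner_spinor, inner_spinor]
    simp only [spinorMul_apply, amp_apply, inner_pairBar]
  exact h η₁ η₂ ψ₁ ψ₂

/-- The element of `\overline{E}₁` whose `k`-th entry is `⟨0|`. -/
def barUnit (θ : ℝ) (k : Fin n) : (corrBar n θ).dom :=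
  ⟨(Pi.single k (ket 0) : Fin n → L2), single_mem_rapidDom k (ket_mem_rapidSeq 0)⟩

/-- The element `∑ eₖ⟨0| ⊗ ωₖ` of `\overline{E}₁ ⊗ Ω¹`. -/
def barForm (θ : ℝ) (ω : Fin n → (moyal θ).oneForms) :
    FormTensor (moyal θ) (corrBar n θ).X (corrBar n θ).dom :=
  ∑ k, fmul (moyal θ) (corrBar n θ).X (corrBar n θ).dom (barUnit θ k) (ω k)

theorem barForm_add (θ : ℝ) (ω ω' : Fin n → (moyal θ).oneForms) :
    barForm θ (ω + ω') = barForm θ ω + barForm θ ω' :=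
  (Finset.sum_congr rfl fun _ _ => btmul_add_right _ _ _).trans Finset.sum_add_distrib

theorem barForm_zero (θ : ℝ) : barForm θ (0 : Fin n → (moyal θ).oneForms) = 0 :=
  Finset.sum_eq_zero fun _ _ => btmul_zero_right _

theorem rowMul_ketBra (ξ v w : L2) : rowMul ξ (ketBra v w : L2 →L[ℂ] L2) = ⟪star ξ, v⟫_ℂ • star w := by
  have h : ContinuousLinearMap.adjoint (ketBra v w : L2 →L[ℂ] L2) = ketBra w v :=
    congrArg Subtype.val (star_ketBra v w)
  rw [rowMul, h, ketBra_apply, star_smul]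
  congr 1
  exact inner_conj_symm _ _

/-- Left multiplication of a one-form by `|0⟩⟨v|`. -/
def ketZeroMul (θ : ℝ) {v : L2} (hv : v ∈ rapidSeq) (ω : (moyal θ).oneForms) :
    (moyal θ).oneForms :=
  ⟨(moyal θ).rep (ketBra (ket 0) v) ∘L ω.1,
    (moyal θ).comp_mem_oneForms (ketBra_mem_rapid (ket_mem_rapidSeq 0) hv) ω.2⟩

/-- Every row factors as `ξ_k = ⟨0| · (|0⟩ξ_k)`, and the rank-one operator `|0⟩ξ_k` of rapid decay
moves across the tensor product onto `ω`. -/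
theorem fmul_eq_barForm (θ : ℝ) (ξ : (corrBar n θ).dom) (ω : (moyal θ).oneForms) :
    fmul (moyal θ) (corrBar n θ).X (corrBar n θ).dom ξ ω = barForm θ fun k =>
      ketZeroMul θ (star_mem_rapidSeq (mem_rapidDom ξ k)) ω := by
  have h : ∀ k, fmul (moyal θ) (corrBar n θ).X (corrBar n θ).dom (barUnit θ k)
      (ketZeroMul θ (star_mem_rapidSeq (mem_rapidDom ξ k)) ω) =
      fmul (moyal θ) (corrBar n θ).X (corrBar n θ).dom
        ⟨(Pi.single k (ξ.1 k) : Fin n → L2), single_mem_rapidDom k (mem_rapidDom ξ k)⟩ ω := fun k => by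
    refine (btmul_balanced (a := (⟨ketBra (ket 0) (star (ξ.1 k)), ketBra_mem_rapid
      (ket_mem_rapidSeq 0) (star_mem_rapidSeq (mem_rapidDom ξ k))⟩ : (moyal θ).smooth)) ?_ rfl).symm
    refine funext fun i => ?_
    change (Pi.single k (ξ.1 k) : Fin n → L2) i =
      rowMul ((Pi.single k (ket 0) : Fin n → L2) i) (ketBra (ket 0) (star (ξ.1 k)) : L2 →L[ℂ] L2)
    rw [rowMul_ketBra, Pi.single_apply, Pi.single_apply]
    split_ifs with hi
    · rw [star_ket, inner_ket_left, ket_apply, if_pos rfl, one_smul, star_star]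
    · rw [star_zero, inner_zero_left, zero_smul]
  refine Eq.trans ?_ (Finset.sum_congr rfl fun k _ => (h k).symm)
  have hs : ξ = ∑ k, (⟨(Pi.single k (ξ.1 k) : Fin n → L2),
      single_mem_rapidDom k (mem_rapidDom ξ k)⟩ : (corrBar n θ).dom) := by
    refine Subtype.ext ?_
    rw [AddSubmonoidClass.coe_finsetSum]
    exact (Finset.univ_sum_single (ξ.1 : Fin n → L2)).symm
  refine (congrArg (fun ξ => fmul (moyal θ) (corrBar n θ).X (corrBar n θ).dom ξ ω) hs).trans ?_
  exact map_sum ((btmulₗ _ _).flip ω) _ _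

/-- The normalization `|0⟩⟨0|ωₖ = ωₖ` removes the ambiguity in `ωₖ`: the action only sees `⟨0|ωₖ`.
-/
theorem exists_eq_barForm (θ : ℝ) (t : FormTensor (moyal θ) (corrBar n θ).X (corrBar n θ).dom) :
    ∃ ω : Fin n → (moyal θ).oneForms,
      (∀ k, (moyal θ).rep (ketBra (ket 0) (ket 0)) ∘L (ω k).1 = ω k) ∧ t = barForm θ ω := by
  induction t using BalancedTensor.induction with
  | zero => exact ⟨0, fun k => ContinuousLinearMap.comp_zero _, (barForm_zero θ).symm⟩
  | add s t hs ht =>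
    obtain ⟨ω, hω, rfl⟩ := hs
    obtain ⟨ω', hω', rfl⟩ := ht
    exact ⟨ω + ω', fun k => (ContinuousLinearMap.comp_add _ _ _).trans
      (congrArg₂ (· + ·) (hω k) (hω' k)), (barForm_add θ ω ω').symm⟩
  | mul ξ ω =>
    refine ⟨_, fun k => ?_, fmul_eq_barForm θ ξ ω⟩
    have h : ∀ (v : L2) (ω : Spinor L2 →L[ℂ] Spinor L2),
        amp (ketBra (ket 0) (ket 0) : L2 →L[ℂ] L2) ∘L (amp (ketBra (ket 0) v : L2 →L[ℂ] L2) ∘L ω) =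
          amp (ketBra (ket 0) v : L2 →L[ℂ] L2) ∘L ω := by
      intro v ω
      refine ContinuousLinearMap.ext fun ψ => PiLp.ext fun j => ?_
      simp only [ContinuousLinearMap.comp_apply, amp_apply, ketBra_apply, inner_smul_right,
        inner_ket_left, ket_apply, if_pos, mul_one]
    exact h (star ((ξ.1 : Fin n → L2) k)) ω.1

theorem formU_barForm (θ : ℝ) (ω : Fin n → (moyal θ).oneForms) (ψ : Spinor L2) (j : Fin 2)
    (i : Fin n) : (show Spinor (EuclideanSpace ℂ (Fin n)) from
      formU (corrBar n θ) ψ (barForm θ ω)) j i =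
      ⟪ket 0, (show Spinor L2 from (ω i).1 ψ) j⟫_ℂ := by
  have h : ∀ φ : Fin n → Spinor L2,
      (∑ k, spinorMul (pairBar n) (Pi.single k (ket 0)) (φ k)) j i = ⟪ket 0, φ i j⟫_ℂ := by
    intro φ
    simp only [WithLp.ofLp_sum, Finset.sum_apply, spinorMul_apply, pairBar_apply]
    rw [Finset.sum_eq_single i]
    · rw [Pi.single_eq_same, star_ket]
    · intro k _ hk
      rw [Pi.single_eq_of_ne hk.symm, star_zero, inner_zero_left]
    · simp
  have h₁ := map_sum (formU (corrBar n θ) ψ)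
    (fun k => fmul (moyal θ) (corrBar n θ).X (corrBar n θ).dom (barUnit θ k) (ω k)) Finset.univ
  exact (congrArg (fun x : Spinor (EuclideanSpace ℂ (Fin n)) => x j i) h₁).trans
    (h fun k => (ω k).1 ψ)

/-- The `i`-th entries of the image of `ψ` are the coefficients `⟨0|ω_iψ`. If they vanish for all
`ψ`, then so does `ω_i = |0⟩⟨0|ω_i`. -/
theorem corrBar_formsFaithful (n : ℕ) (θ : ℝ) : FormsFaithful (corrBar n θ) := by
  intro t ht
  obtain ⟨ω, hω, rfl⟩ := exists_eq_barForm θ t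
  have h : ω = 0 := funext fun i => Subtype.ext (by
    rw [← hω i]
    refine ContinuousLinearMap.ext fun ψ => PiLp.ext fun j => ?_
    have h₁ := congrArg (fun x : Spinor (EuclideanSpace ℂ (Fin n)) => x j i) (ht ψ)
    exact (congrArg (· • ket 0) ((formU_barForm θ ω ψ j i).symm.trans h₁)).trans (zero_smul _ _))
  rw [h, barForm_zero]

theorem corrBar_connIs (n : ℕ) {θ : ℝ} (hθ : 0 < θ) : ConnIs (corrBar n θ) (connBarOp n θ) := by
  refine connIs_of_exists (corrBar_formsFaithful n θ) (fun η => rfl) fun (ξ : rapidDom n) => ?_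
  let ζ₁ : rapidDom n := ⟨matCol n (Xmat n).conjTranspose ξ.1 - creE ξ,
    (rapidDom n).sub_mem (matCol_mem_rapidDom _ ξ) (creE_mem ξ)⟩
  let ζ₂ : rapidDom n := ⟨matCol n (Xmat n) ξ.1 - annE ξ,
    (rapidDom n).sub_mem (matCol_mem_rapidDom _ ξ) (annE_mem ξ)⟩
  have hk : scale θ • ket 0 ∈ rapidSeq := rapidSeq.smul_mem _ (ket_mem_rapidSeq 0)
  have hr : ∀ (ζ : rapidDom n) (k : Fin n), ketBra (scale θ • ket 0) (star (ζ.1 k)) ∈ rapid :=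
    fun ζ k => ketBra_mem_rapid hk (star_mem_rapidSeq (mem_rapidDom ζ k))
  -- The preimage of `√(2/θ)(0 ζ₁; ζ₂ 0)`: its `k`-th one-form has the entries `√(2/θ)|0⟩` times the
  -- `k`-th rows of `ζ₁` and `ζ₂`, and `⟨0|` recovers these rows.
  let ω : Fin n → (moyal θ).oneForms := fun k =>
    ⟨oddCLM (ketBra (scale θ • ket 0) (star (ζ₁.1 k)) : L2 →L[ℂ] L2)
      (ketBra (scale θ • ket 0) (star (ζ₂.1 k)) : L2 →L[ℂ] L2),
      oddCLM_mem_moyal hθ ⟨_, hr ζ₁ k⟩ ⟨_, hr ζ₂ k⟩⟩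
  have key : ∀ (ζ : Fin n → L2) (i : Fin n) (v : L2),
      ⟪ket 0, (ketBra (scale θ • ket 0) (star (ζ i)) : L2 →L[ℂ] L2) v⟫_ℂ =
        (scale θ • pairBar n ζ v) i := by
    intro ζ i v
    rw [ketBra_apply, inner_smul_right, inner_smul_right, inner_ket_left, ket_apply, if_pos rfl,
      mul_one, mul_comm]
    rfl
  refine ⟨barForm θ ω, fun ψ => ?_⟩
  refine spinor_ext (PiLp.ext fun i => ?_) (PiLp.ext fun i => ?_)
  · refine (formU_barForm θ ω ψ 0 i).trans (Eq.trans ?_ (key ζ₁.1 i _))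
    exact congrArg (⟪ket 0, ·⟫_ℂ) (oddCLM_zero _ _ _)
  · refine (formU_barForm θ ω ψ 1 i).trans (Eq.trans ?_ (key ζ₂.1 i _))
    exact congrArg (⟪ket 0, ·⟫_ℂ) (oddCLM_one _ _ _)

theorem truncD_spinorMul_pairBar (θ : ℝ) (ξ : rapidDom n) (ψ : (oddOp (scale θ) ann cre).domain) :
    truncD n θ (spinorMul (pairBar n) ξ.1 ψ.1) =
      spinorMul (pairBar n) ξ.1 (oddOp (scale θ) ann cre ψ) +
      oddMap (scale θ) (pairBar n (matCol n (Xmat n).conjTranspose ξ.1 - creE ξ))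
        (pairBar n (matCol n (Xmat n) ξ.1 - annE ξ)) ψ.1 := by
  have h₁ := pairBar_creE ξ ⟨ψ.1 1, (ψ.2 1).1⟩
  have h₂ := pairBar_annE ξ ⟨ψ.1 0, (ψ.2 0).2⟩
  refine spinor_ext ?_ ?_
  · rw [truncD_zero, PiLp.add_apply, spinorMul_apply, spinorMul_apply, oddMap_zero, oddOp_zero,
      map_smul, ← h₁, map_sub, LinearMap.sub_apply, pairBar_matCol, ← smul_add, add_sub_cancel]
  · rw [truncD_one, PiLp.add_apply, spinorMul_apply, spinorMul_apply, oddMap_one, oddOp_one,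
      map_smul, ← h₂, map_sub, LinearMap.sub_apply, pairBar_matCol, ← smul_add, add_sub_cancel]

theorem corrBar_intertwines (n : ℕ) {θ : ℝ} (hθ : 0 < θ) : Intertwines (corrBar n θ) := by
  intro (ξ : rapidDom n) ψ
  have h₁ := (corrBar_connIs n hθ).formU_conn ξ ψ.1
  have h₂ := truncation_D_apply θ ⟨_, truncation_mem_domain θ (spinorMul (pairBar n) ξ.1 ψ.1)⟩
  refine ⟨truncation_mem_domain θ _, h₂.trans ((truncD_spinorMul_pairBar θ ξ ψ).trans ?_)⟩
  exact congrArg₂ (· + ·) rfl h₁.symm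

theorem spinorMul_pairBar_ket (v : EuclideanSpace ℂ (Fin n)) (j : Fin 2) :
    spinorMul (pairBar n) (fun i => v i • ket 0) (spin j (ket 0)) = spin j v := by
  ext1 k
  rw [spinorMul_apply, spin_apply, spin_apply]
  split_ifs
  · ext i
    rw [pairBar_apply, star_smul, star_ket, inner_smul_left, inner_ket_left, ket_apply, if_pos rfl,
      mul_one]
    exact star_star _
  · rw [map_zero]

theorem eq_top_of_spin {S : Submodule ℂ (Spinor (EuclideanSpace ℂ (Fin n)))}
    (h : ∀ i v, spin i v ∈ S) : S = ⊤ :=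
  top_le_iff.1 fun ψ _ => by
    rw [spinor_eq_add ψ]
    exact S.add_mem (h _ _) (h _ _)

theorem bimodBar_rnorm_le (ξ : Fin n → L2) :
    (bimodBar n).rnorm ξ ≤ √(∑ i, ‖ξ i‖ * ‖ξ i‖) := by
  refine (bimod_lnorm_le (star ξ)).trans_eq ?_
  simp only [Pi.star_apply, norm_star]

theorem corrBar_isCorrespondence (hn : 0 < n) {θ : ℝ} (hθ : 0 < θ) :
    IsCorrespondence (corrBar n θ) := by
  refine IsCorrespondence.of_intertwines (isSpectralTriple_moyal hθ)
    (commutatorsMem_moyal hθ) (corrBar_formsFaithful n θ) (corrBar_isIsometric n θ)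
    (corrBar_intertwines n hθ) (bimodBar_isMorita hn) ?_ ?_ ?_ ?_ ?_ ?_
  · intro (ξ : Fin n → L2) ε hε
    obtain ⟨ζ, h₁, h₂⟩ := exists_rapidDom_near ξ (f := fun ξ => √(∑ i, ‖ξ i‖ * ‖ξ i‖))
      (by fun_prop) (by simp) hε
    exact ⟨ζ, h₁, (bimodBar_rnorm_le _).trans_lt h₂⟩
  · intro (ξ : Fin n → L2) hξ (a : compacts) ha i _
    exact star_mem_rapidSeq (apply_mem_rapidSeq (T := star a) (star_mem ha) _)
  · intro b _ ξ hξ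
    exact matCol_mem_rapidDom b ⟨ξ, hξ⟩
  · let S : Submodule ℂ (truncation n θ).H := LinearMap.range (corrUBar n θ)
    have h : S = ⊤ := eq_top_of_spin fun i v =>
      ⟨hmul (moyal θ) (bimodBar n) (fun i => v i • ket 0 : Fin n → L2) (spin i (ket 0)),
        spinorMul_pairBar_ket v i⟩
    exact (LinearMap.range_eq_top.1 h).denseRange
  · intro b ξ ψ
    have h : ∀ (b : Matrix (Fin n) (Fin n) ℂ) (ξ : Fin n → L2) (ψ : Spinor L2),
        spinorMul (pairBar n) (matCol n b ξ) ψ = amp (matCLM b) (spinorMul (pairBar n) ξ ψ) := by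
      intro b ξ ψ
      ext1 k
      rw [amp_apply, spinorMul_apply, spinorMul_apply, pairBar_matCol]
    exact h b ξ ψ
  · let S : Submodule ℂ (truncation n θ).H := Submodule.span ℂ
      {φ | ∃ (ξ : (corrBar n θ).dom) (ψ : (moyal θ).D.domain),
        φ = (corrBar n θ).U (hmul (moyal θ) (corrBar n θ).X ξ ψ)}
    have hS : ∀ i v, (show (truncation n θ).H from spin i v) ∈ S := fun i v =>
      Submodule.subset_span
        ⟨⟨(fun i => v i • ket 0 : Fin n → L2), fun _ _ =>
          rapidSeq.smul_mem _ (ket_mem_rapidSeq 0)⟩,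
        ⟨spin i (ket 0), spin_mem_domain (ket_mem_ann 0) i⟩, (spinorMul_pairBar_ket v i).symm⟩
    exact hasCore_truncation n θ (eq_top_of_spin hS)

end CorrBar

end MoritaCat

end

noncomputable section

namespace MoritaCat

open BimoduleData

/-! ## The compositions -/

section Compositions

variable {n : ℕ}

/-- The pairing of columns of row vectors with rows of column vectors, with values in matrices. -/
def matPairing (n : ℕ) : (Fin n → L2) →ₗ[ℂ] (Fin n → L2) →ₗ[ℂ] Matrix (Fin n) (Fin n) ℂ :=
  LinearMap.mk₂ ℂ (fun ξ η => gramMat (star ξ) η)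
    (fun ξ ζ η => Matrix.ext fun i j => by simp [gramMat_apply])
    (fun c ξ η => Matrix.ext fun i j => by simp [gramMat_apply, mul_comm])
    (fun ξ => gramMat_add_right (star ξ))
    (fun c ξ η => gramMat_smul_right (star ξ) c η)

/-- The pairing of rows of column vectors with columns of row vectors, with values in compact
operators. -/
def opPairing (n : ℕ) : (Fin n → L2) →ₗ[ℂ] (Fin n → L2) →ₗ[ℂ] compacts :=
  LinearMap.mk₂ ℂ (fun η ξ => ketBraSum η (star ξ))
    (fun η ζ ξ => ketBraSum_add_left η ζ (star ξ))
    (fun c η ξ => ketBraSum_smul_left c η (star ξ))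
    (fun η ξ ζ => by simp [ketBraSum, ketBra_add_right, Finset.sum_add_distrib])
    (fun c η ξ => by simp [ketBraSum, ketBra_smul_right, Finset.smul_sum])

theorem matPairing_apply (ξ η : Fin n → L2) : matPairing n ξ η = gramMat (star ξ) η := rfl

theorem opPairing_apply (η ξ : Fin n → L2) : opPairing n η ξ = ketBraSum η (star ξ) := rfl

theorem pairBar_pair (ξ η : Fin n → L2) (v : EuclideanSpace ℂ (Fin n)) :
    pairBar n ξ (pair n η v) = matCLM (matPairing n ξ η) v := by
  ext i
  rw [pairBar_apply, pair_apply, inner_sum, matCLM_apply]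
  exact Finset.sum_congr rfl fun j _ => by rw [inner_smul_right, mul_comm]; rfl

theorem pair_pairBar (η ξ : Fin n → L2) (v : L2) :
    pair n η (pairBar n ξ v) = (opPairing n η ξ : L2 →L[ℂ] L2) v := by
  rw [opPairing_apply, ketBraSum_apply]
  rfl

theorem isPairing_matPairing (n : ℕ) (θ : ℝ) :
    IsPairing (corrBar n θ) (corr n θ) (matPairing n) := by
  intro ξ η ψ
  have h : ∀ (ξ η : Fin n → L2) (ψ : Spinor (EuclideanSpace ℂ (Fin n))),
      amp (matCLM (matPairing n ξ η)) ψ = spinorMul (pairBar n) ξ (spinorMul (pair n) η ψ) :=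
    fun ξ η ψ => PiLp.ext fun k => (pairBar_pair ξ η (ψ k)).symm
  exact h ξ η ψ

theorem isPairing_opPairing (n : ℕ) (θ : ℝ) :
    IsPairing (corr n θ) (corrBar n θ) (opPairing n) := by
  intro η ξ ψ
  have h : ∀ (η ξ : Fin n → L2) (ψ : Spinor L2),
      amp (opPairing n η ξ : L2 →L[ℂ] L2) ψ = spinorMul (pair n) η (spinorMul (pairBar n) ξ ψ) :=
    fun η ξ ψ => PiLp.ext fun k => (pair_pairBar η ξ (ψ k)).symm
  exact h η ξ ψ

theorem pairDom_matPairing (n : ℕ) (θ : ℝ) :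
    pairDom (corrBar n θ) (corr n θ) (matPairing n) = ⊤ := by
  refine top_le_iff.1 fun (M : Matrix (Fin n) (Fin n) ℂ) _ => ?_
  let S : Submodule ℂ (Matrix (Fin n) (Fin n) ℂ) :=
    pairDom (corrBar n θ) (corr n θ) (matPairing n)
  have hS : ∀ ξ ∈ rapidDom n, ∀ η ∈ rapidDom n, matPairing n ξ η ∈ S := fun ξ hξ η hη =>
    Submodule.subset_span (R := ℂ) (M := (truncation n θ).A) ⟨ξ, hξ, η, hη, rfl⟩
  have h : M ∈ S := by
    induction M using Matrix.induction_on' with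
    | h_zero => exact S.zero_mem
    | h_add p q hp hq => exact S.add_mem (hp trivial) (hq trivial)
    | h_std_basis i j x =>
      have h₁ := hS _ (single_mem_rapidDom i (ket_mem_rapidSeq 0)) _
        (single_mem_rapidDom j (rapidSeq.smul_mem x (ket_mem_rapidSeq 0)))
      have h₂ : star (Pi.single i (ket 0) : Fin n → L2) = Pi.single i (ket 0) := by
        rw [← Pi.single_star, star_ket]
      rwa [matPairing_apply, h₂, gramMat_single] at h₁
  exact h

/-- A single nonzero entry already produces every `|η⟩⟨ξ|` of rapid decay. As only finite sums
occur, operators of infinite rank in `𝒮(ℕ²)` are not reached. -/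
theorem pairDom_opPairing (hn : 0 < n) (θ : ℝ) :
    pairDom (corr n θ) (corrBar n θ) (opPairing n) = finRank := by
  let S : Submodule ℂ compacts := pairDom (corr n θ) (corrBar n θ) (opPairing n)
  have h₁ : S ≤ finRank := Submodule.span_le.2 (by
    rintro _ ⟨(η : Fin n → L2), hη, (ξ : Fin n → L2), hξ, rfl⟩
    have h : ketBraSum η (star ξ) ∈ finRank := by
      rw [ketBraSum]
      exact finRank.sum_mem fun i _ => ketBra_mem_finRank (mem_rapidDom ⟨η, hη⟩ i)
        (star_mem_rapidSeq (mem_rapidDom ⟨ξ, hξ⟩ i))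
    exact h)
  have h₂ : finRank ≤ S := Submodule.span_le.2 (by
    rintro _ ⟨η, hη, ξ, hξ, rfl⟩
    have h : opPairing n (Pi.single ⟨0, hn⟩ η) (Pi.single ⟨0, hn⟩ (star ξ)) = ketBra η ξ := by
      rw [opPairing_apply, ← Pi.single_star, star_star, ketBraSum_single]
    rw [← h]
    exact Submodule.subset_span (R := ℂ) (M := (moyal θ).A) ⟨_, single_mem_rapidDom _ hη, _,
      single_mem_rapidDom _ (star_mem_rapidSeq hξ), rfl⟩)
  exact le_antisymm h₁ h₂

theorem composesToId_corrBar_corr (hn : 2 ≤ n) {θ : ℝ} (hθ : 0 < θ) :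
    ComposesToId (corrBar n θ) (corr n θ) := by
  have hd := pairDom_matPairing n θ
  refine composesToId_of_pairing (isPairing_matPairing n θ) (isSpectralTriple_truncation n θ)
    (idConnIsCommutator_truncation n θ) (corr_isCorrespondence hn hθ)
    (corrBar_isCorrespondence (by omega) hθ) (corr_formsFaithful hn hθ) ?_ (fun _ _ => trivial)
    ?_ ?_
  · rw [hd]
    exact dense_univ
  · rw [hd]
    exact idCorr_truncation_isCorrespondence n θ
  · rw [hd]
    exact (hasCommonFactors_top n θ).formsFaithful

theorem composesToId_corr_corrBar (hn : 2 ≤ n) {θ : ℝ} (hθ : 0 < θ) :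
    ComposesToId (corr n θ) (corrBar n θ) := by
  have hd := pairDom_opPairing (show 0 < n by omega) θ
  refine composesToId_of_pairing (isPairing_opPairing n θ) (isSpectralTriple_moyal hθ)
    (idConnIsCommutator_moyal hθ) (corrBar_isCorrespondence (by omega) hθ)
    (corr_isCorrespondence hn hθ) (corrBar_formsFaithful n θ) ?_ ?_ ?_ ?_
  · rw [hd]
    exact dense_of_ketBra fun j k => ketBra_mem_finRank (ket_mem_rapidSeq j) (ket_mem_rapidSeq k)
  · rw [hd]
    exact finRank_le
  · rw [hd]
    exact idCorrOn_finRank_isCorrespondence hθ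
  · rw [hd]
    exact (hasCommonFactors_finRank θ).formsFaithful

end Compositions

end MoritaCat

end

open MoritaCat in
theorem mainTheorem4 (n : ℕ) (hn : 2 ≤ n) (θ : ℝ) (hθ : 0 < θ) :
    IsSpectralTriple (truncation n θ) ∧ IsSpectralTriple (moyal θ) ∧
    IsCorrespondence (corr n θ) ∧ ConnIs (corr n θ) (connOp n θ) ∧
    IsCorrespondence (corrBar n θ) ∧ ConnIs (corrBar n θ) (connBarOp n θ) ∧
    IsCorrespondence (idCorr (truncation n θ)) ∧ IdConnIsCommutator (truncation n θ) ∧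
    IsCorrespondence (idCorr (moyal θ)) ∧ IdConnIsCommutator (moyal θ) ∧
    ComposesToId (corrBar n θ) (corr n θ) ∧ ComposesToId (corr n θ) (corrBar n θ) ∧
    MoritaIsomorphic (moyal θ) (truncation n θ) := by
  have h₁ := corr_isCorrespondence hn hθ
  have h₂ := corrBar_isCorrespondence (n := n) (by omega) hθ
  have h₃ := composesToId_corrBar_corr hn hθ
  have h₄ := composesToId_corr_corrBar hn hθ
  exact ⟨isSpectralTriple_truncation n θ, isSpectralTriple_moyal hθ, h₁, corr_connIs hn hθ, h₂,
    corrBar_connIs n hθ, idCorr_truncation_isCorrespondence n θ, idConnIsCommutator_truncation n θ,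
    idCorr_moyal_isCorrespondence hθ, idConnIsCommutator_moyal hθ, h₃, h₄,
    corrBar n θ, corr n θ, h₂, h₁, h₄, h₃⟩
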